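/- Conventions. Manifolds are smooth, finite-dimensional, Hausdorff, second countable and without boundary. $\mathsf{LieGpd}$ is the 2-category of Lie groupoids (source map a surjective submersion), smooth homomorphisms, and smooth natural transformations. For a smooth left action of a Lie group $G$ on a manifold $X$, the translation groupoid $G\ltimes X$ is the Lie groupoid with objects $X$ and arrows $(g,x)\colon x\to gx$, $(g,x)\in G\times X$. $\mathsf{EqTrGpd}$ is the 2-category of translation groupoids, equivariant maps $(\varphi,f)\colon G\ltimes X\to H\ltimes Y$ ($\varphi\colon G\to H$ a homomorphism of Lie groups, $f\colon X\to Y$ smooth with $f(gx)=\varphi(g)f(x)$), and smooth natural transformations between the associated homomorphisms. A homomorphism $\varphi\colon\mathcal G\to\mathcal H$ is an essential equivalence if $G_0\times_{H_0}H_1=\{(x,h)\mid \varphi_0(x)=s(h)\}\to H_0$, $(x,h)\mapsto t(h)$, is a surjective submersion, and $G_1$ is the pullback, as a manifold, of $(s,t)\colon H_1\to H_0\times H_0$ along $\varphi_0\times\varphi_0$. Let $W$ be the class of essential equivalences in $\mathsf{LieGpd}$, and also the class of equivariant maps that are essential equivalences in $\mathsf{EqTrGpd}$. An orbifold groupoid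 is a Lie groupoid $\mathcal G$ for which there are essential equivalences $\mathcal G\leftarrow\mathcal K\to\mathcal E$ with $\mathcal E$ étale (the source map is a local diffeomorphism) and proper (the map $(s,t)$ is proper). For $\mathsf C=\mathsf{LieGpd}$ or $\mathsf{EqTrGpd}$, the bicategory of fractions $\mathsf C(W^{-1})$ has the objects of $\mathsf C$; its 1-cells $\mathcal G\to\mathcal H$ are the spans $\mathcal G\xleftarrow{\omega}\mathcal K\xrightarrow{\varphi}\mathcal H$ in $\mathsf C$ with $\omega\in W$, composed by means of weak fibre products; its 2-cells $(\omega,\varphi)\Rightarrow(\omega',\varphi')$ are classes of diagrams $(\mathcal L,\nu\colon\mathcal L\to\mathcal K,\nu'\colon\mathcal L\to\mathcal K',\alpha_1\colon\omega\nu\Rightarrow\omega'\nu',\alpha_2\colon\varphi\nu\Rightarrow\varphi'\nu')$ in $\mathsf C$ with $\omega\nu,\omega'\nu'\in W$. Two diagrams with middle objects $\mathcal L_1,\mathcal L_2$ are identified if there are an object $\mathcal N$ and 1-cells $\mathcal N\to\mathcal L_i$ with invertible 2-cells between the two composites $\mathcal N\to\mathcal K$, and between the two composites $\mathcal N\to\mathcal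 K'$, such that the diagrams agree after pasting and the resulting 1-cells from $\mathcal N$ to $\mathcal G$ are in $W$. The operations on 2-cells are given by pasting. **Theorem 3.3.** Both bicategories of fractions exist. Let $\mathsf{LieGpd}_{\mathsf{Tr}}(W^{-1})$ be the full sub-bicategory of $\mathsf{LieGpd}(W^{-1})$ on the translation groupoids, and restrict it and $\mathsf{EqTrGpd}(W^{-1})$ to the (translation groupoids that are) orbifold groupoids. Then the inclusion $\mathsf{EqTrGpd}\hookrightarrow\mathsf{LieGpd}_{\mathsf{Tr}}$ induces, by sending each span and each class of diagrams of equivariant maps to the underlying span and class of diagrams in $\mathsf{LieGpd}$, and with the canonical comparison 2-cells for units and composites, a homomorphism of bicategories $$\mathsf{EqTrGpd}(W^{-1})\longrightarrow\mathsf{LieGpd}_{\mathsf{Tr}}(W^{-1})$$ which is an equivalence of bicategories: it is essentially surjective on objects up to equivalence, and for any two objects it induces an equivalence of the categories of 1-cells and 2-cells between them. In particular every generalized map between orbifold translation groupoids is isomorphic to a span of equivariant maps, and every 2-cell between such spans is represented by exactly one class of diagrams of equivariant maps. -/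

import Mathlib

open CategoryTheory
open CategoryTheory.Bicategory
open scoped ContDiff

universe u w v

/-! ## Smooth manifolds -/

/-- A smooth (`C^∞`) finite-dimensional manifold without boundary, Hausdorff and second countable.
The model space is allowed to be any finite-dimensional real normed space. -/
structure Mfd : Type (u + 1) where
  carrier : Type u
  E : Type u
  H : Type u
  [normedAddCommGroup : NormedAddCommGroup E]
  [normedSpace : NormedSpace ℝ E]
  [finiteDimensional : FiniteDimensional ℝ E]
  [topModel : TopologicalSpace H]
  I : ModelWithCorners ℝ E H
  [boundaryless : I.Boundaryless]
  [top : TopologicalSpace carrier]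
  [charted : ChartedSpace H carrier]
  [isManifold : IsManifold I ∞ carrier]
  [t2 : T2Space carrier]
  [secondCountable : SecondCountableTopology carrier]

namespace Mfd

instance : CoeSort Mfd.{u} (Type u) := ⟨Mfd.carrier⟩

attribute [instance] normedAddCommGroup normedSpace finiteDimensional topModel boundaryless top
  charted isManifold t2 secondCountable

/-- Smooth maps. -/
@[ext]
structure Hom (X Y : Mfd.{u}) where
  toFun : X → Y
  smooth : ContMDiff X.I Y.I ∞ toFun

/-- The category of smooth manifolds and smooth maps. -/
instance : Category Mfd.{u} where
  Hom := Hom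
  id X := ⟨fun x => x, contMDiff_id⟩
  comp f g := ⟨fun x => g.toFun (f.toFun x), g.smooth.comp f.smooth⟩

instance (X Y : Mfd.{u}) : FunLike (X ⟶ Y) X Y where
  coe f := f.toFun
  coe_injective _ _ h := Hom.ext h

@[ext]
theorem hom_ext {X Y : Mfd.{u}} {f g : X ⟶ Y} (h : ∀ x, f x = g x) : f = g :=
  DFunLike.ext _ _ h

@[simp] theorem comp_apply {X Y Z : Mfd.{u}} (f : X ⟶ Y) (g : Y ⟶ Z) (x : X) :
    (f ≫ g) x = g (f x) := rfl

@[simp] theorem id_apply {X : Mfd.{u}} (x : X) : (𝟙 X : X ⟶ X) x = x := rfl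

theorem contMDiff {X Y : Mfd.{u}} (f : X ⟶ Y) : ContMDiff X.I Y.I ∞ f := f.smooth

/-- Bundle a smooth function as a morphism. -/
def homMk {X Y : Mfd.{u}} (f : X → Y) (hf : ContMDiff X.I Y.I ∞ f) : X ⟶ Y := ⟨f, hf⟩

@[simp] theorem homMk_apply {X Y : Mfd.{u}} (f : X → Y) (hf : ContMDiff X.I Y.I ∞ f) (x : X) :
    homMk f hf x = f x := rfl

/-- The product manifold. -/
noncomputable def prod (X Y : Mfd.{u}) : Mfd.{u} where
  carrier := X × Y
  E := X.E × Y.E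
  H := ModelProd X.H Y.H
  I := X.I.prod Y.I

/-- The map `(f, g) : T ⟶ X × Y`. -/
noncomputable def pair {T X Y : Mfd.{u}} (f : T ⟶ X) (g : T ⟶ Y) : T ⟶ X.prod Y :=
  ⟨fun x => (f x, g x), (contMDiff f).prodMk (contMDiff g)⟩

/-- The map `f × g : X × Y ⟶ X' × Y'`. -/
noncomputable def prodMap {X Y X' Y' : Mfd.{u}} (f : X ⟶ X') (g : Y ⟶ Y') : X.prod Y ⟶ X'.prod Y' :=
  ⟨fun p => (f p.1, g p.2), (contMDiff f).prodMap (contMDiff g)⟩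

/-- `f` is a surjective submersion: it is surjective and its differential is surjective at
every point. -/
def IsSurjectiveSubmersion {X Y : Mfd.{u}} (f : X ⟶ Y) : Prop :=
  Function.Surjective f ∧ ∀ x : X, Function.Surjective (mfderiv X.I Y.I f x)

end Mfd

/-! ## Lie groupoids -/

/-- A (Hausdorff) Lie groupoid. `comp g f` is the composite `g ∘ f`, defined when the source of
`g` is the target of `f`. Smoothness of `comp` on the fibre product manifold
`arr ×_{src, obj, tgt} arr` (which exists, as `src` is a submersion) is expressed through the
universal property of that manifold: composing with any smooth map `(a, b)` from a manifold into
the fibre product gives a smooth map. -/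
structure LieGpd : Type (u + 1) where
  obj : Mfd.{u}
  arr : Mfd.{u}
  src : arr ⟶ obj
  tgt : arr ⟶ obj
  unit : obj ⟶ arr
  inv : arr ⟶ arr
  comp : (g f : arr) → src g = tgt f → arr
  smooth_comp : ∀ (T : Mfd.{u}) (a b : T ⟶ arr) (h : ∀ x, src (a x) = tgt (b x)),
    ContMDiff T.I arr.I ∞ (fun x => comp (a x) (b x) (h x))
  src_unit : ∀ x, src (unit x) = x
  tgt_unit : ∀ x, tgt (unit x) = x
  src_inv : ∀ g, src (inv g) = tgt g
  tgt_inv : ∀ g, tgt (inv g) = src g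
  src_comp : ∀ g f h, src (comp g f h) = src f
  tgt_comp : ∀ g f h, tgt (comp g f h) = tgt g
  comp_unit : ∀ g, comp g (unit (src g)) (tgt_unit _).symm = g
  unit_comp : ∀ g, comp (unit (tgt g)) g (src_unit _) = g
  comp_assoc : ∀ k g f (h₁ : src k = tgt g) (h₂ : src g = tgt f),
    comp (comp k g h₁) f ((src_comp _ _ _).trans h₂) =
      comp k (comp g f h₂) (h₁.trans (tgt_comp _ _ _).symm)
  inv_comp : ∀ g, comp (inv g) g (src_inv g) = unit (src g)
  comp_inv : ∀ g, comp g (inv g) (tgt_inv g).symm = unit (tgt g)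
  src_submersion : Mfd.IsSurjectiveSubmersion src

namespace LieGpd

attribute [simp] src_unit tgt_unit src_inv tgt_inv src_comp tgt_comp comp_unit unit_comp
  inv_comp comp_inv

theorem comp_congr (G : LieGpd.{u}) {g g' f f' : G.arr} (hg : g = g') (hf : f = f')
    (h : G.src g = G.tgt f) :
    G.comp g f h = G.comp g' f' (by rw [← hg, ← hf, h]) := by
  subst hg; subst hf; rfl

theorem unit_comp' (G : LieGpd.{u}) (x : G.obj) (g : G.arr) (h : G.src (G.unit x) = G.tgt g) :
    G.comp (G.unit x) g h = g := by
  have hx : x = G.tgt g := by simpa using h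
  subst hx
  exact G.unit_comp g

theorem comp_unit' (G : LieGpd.{u}) (x : G.obj) (g : G.arr) (h : G.src g = G.tgt (G.unit x)) :
    G.comp g (G.unit x) h = g := by
  have hx : x = G.src g := by simpa using h.symm
  subst hx
  exact G.comp_unit g

/-- The map `(s, t) : G₁ ⟶ G₀ × G₀`. -/
noncomputable def srcTgt (G : LieGpd.{u}) : G.arr ⟶ G.obj.prod G.obj := Mfd.pair G.src G.tgt

/-- Homomorphisms of Lie groupoids. -/
@[ext]
structure Hom (G H : LieGpd.{u}) where
  obj : G.obj ⟶ H.obj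
  arr : G.arr ⟶ H.arr
  src_arr : ∀ g, H.src (arr g) = obj (G.src g)
  tgt_arr : ∀ g, H.tgt (arr g) = obj (G.tgt g)
  arr_unit : ∀ x, arr (G.unit x) = H.unit (obj x)
  arr_comp : ∀ g f (h : G.src g = G.tgt f),
    arr (G.comp g f h) = H.comp (arr g) (arr f) (by rw [src_arr, tgt_arr, h])

attribute [simp] Hom.src_arr Hom.tgt_arr Hom.arr_unit

instance : CategoryStruct LieGpd.{u} where
  Hom := Hom
  id G := ⟨𝟙 _, 𝟙 _, fun _ => rfl, fun _ => rfl, fun _ => rfl, fun _ _ _ => rfl⟩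
  comp φ ψ :=
    { obj := φ.obj ≫ ψ.obj
      arr := φ.arr ≫ ψ.arr
      src_arr := by simp
      tgt_arr := by simp
      arr_unit := by simp
      arr_comp := fun g f h => by simp [Hom.arr_comp] }

/-- Natural transformations `φ ⇒ ψ` (2-cells): smooth maps `α : G₀ ⟶ H₁` with
`α x : φ x ⟶ ψ x`, natural in `x`. -/
@[ext]
structure TwoCell {G H : LieGpd.{u}} (φ ψ : G ⟶ H) where
  app : G.obj ⟶ H.arr
  src_app : ∀ x, H.src (app x) = Hom.obj φ x
  tgt_app : ∀ x, H.tgt (app x) = Hom.obj ψ x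
  natural : ∀ g, H.comp (Hom.arr ψ g) (app (G.src g)) (by rw [tgt_app, Hom.src_arr]) =
    H.comp (app (G.tgt g)) (Hom.arr φ g) (by rw [src_app, Hom.tgt_arr])

attribute [simp] TwoCell.src_app TwoCell.tgt_app

namespace TwoCell

/-- The identity 2-cell. -/
def refl {G H : LieGpd.{u}} (φ : G ⟶ H) : TwoCell φ φ where
  app := Hom.obj φ ≫ H.unit
  src_app := by simp
  tgt_app := by simp
  natural := fun g => by
    simp only [Mfd.comp_apply]
    rw [comp_unit', unit_comp']

/-- Vertical composition of 2-cells. -/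
def vcomp {G H : LieGpd.{u}} {φ ψ χ : G ⟶ H} (α : TwoCell φ ψ) (β : TwoCell ψ χ) :
    TwoCell φ χ where
  app := Mfd.homMk (fun x => H.comp (β.app x) (α.app x) (by simp))
    (H.smooth_comp _ _ _ (by simp))
  src_app := by simp
  tgt_app := by simp
  natural := fun g => by
    simp only [Mfd.homMk_apply]
    rw [← H.comp_assoc _ _ _ (by simp) (by simp),
      H.comp_congr (β.natural g) rfl, H.comp_assoc _ _ _ (by simp) (by simp),
      H.comp_congr rfl (α.natural g), ← H.comp_assoc _ _ _ (by simp) (by simp)]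

/-- Precomposition of a 2-cell with a homomorphism. -/
def precomp {G H K : LieGpd.{u}} (φ : G ⟶ H) {ψ ψ' : H ⟶ K} (α : TwoCell ψ ψ') :
    TwoCell (φ ≫ ψ) (φ ≫ ψ') where
  app := Hom.obj φ ≫ α.app
  src_app := fun x => α.src_app _
  tgt_app := fun x => α.tgt_app _
  natural := fun g => by
    simp only [Mfd.comp_apply]
    rw [K.comp_congr rfl (congrArg α.app (Hom.src_arr φ g).symm),
      K.comp_congr (congrArg α.app (Hom.tgt_arr φ g).symm) rfl]
    exact α.natural (Hom.arr φ g)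

/-- Postcomposition of a 2-cell with a homomorphism. -/
def postcomp {G H K : LieGpd.{u}} {φ φ' : G ⟶ H} (α : TwoCell φ φ') (ψ : H ⟶ K) :
    TwoCell (φ ≫ ψ) (φ' ≫ ψ) where
  app := α.app ≫ Hom.arr ψ
  src_app := fun x => (Hom.src_arr ψ _).trans (congrArg (Hom.obj ψ) (α.src_app x))
  tgt_app := fun x => (Hom.tgt_arr ψ _).trans (congrArg (Hom.obj ψ) (α.tgt_app x))
  natural := fun g => by
    have := congrArg (Hom.arr ψ) (α.natural g)
    rw [Hom.arr_comp, Hom.arr_comp] at this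
    exact this

theorem ext_app {G H : LieGpd.{u}} {φ ψ : G ⟶ H} {α β : TwoCell φ ψ}
    (h : ∀ x, α.app x = β.app x) : α = β :=
  TwoCell.ext (Mfd.hom_ext h)

theorem postcomp_refl {G H K : LieGpd.{u}} (φ : G ⟶ H) (ψ : H ⟶ K) :
    (refl φ).postcomp ψ = refl (φ ≫ ψ) :=
  ext_app fun _ => Hom.arr_unit ψ _

theorem refl_vcomp {G H : LieGpd.{u}} {φ ψ : G ⟶ H} (α : TwoCell φ ψ) :
    (refl φ).vcomp α = α :=
  ext_app fun _ => comp_unit' _ _ _ _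

theorem vcomp_refl {G H : LieGpd.{u}} {φ ψ : G ⟶ H} (α : TwoCell φ ψ) :
    α.vcomp (refl ψ) = α :=
  ext_app fun _ => unit_comp' _ _ _ _

theorem vcomp_assoc {G H : LieGpd.{u}} {φ ψ χ ζ : G ⟶ H} (α : TwoCell φ ψ) (β : TwoCell ψ χ)
    (γ : TwoCell χ ζ) : (α.vcomp β).vcomp γ = α.vcomp (β.vcomp γ) :=
  ext_app fun _ => (H.comp_assoc _ _ _ _ _).symm

end TwoCell

instance homCategory (G H : LieGpd.{u}) : Category (G ⟶ H) where
  Hom φ ψ := TwoCell φ ψ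
  id φ := TwoCell.refl φ
  comp α β := TwoCell.vcomp α β
  id_comp α := TwoCell.refl_vcomp α
  comp_id α := TwoCell.vcomp_refl α
  assoc α β γ := TwoCell.vcomp_assoc α β γ

/-- The 2-category of Lie groupoids, homomorphisms and natural transformations. -/
instance bicategory : Bicategory LieGpd.{u} where
  homCategory := homCategory
  whiskerLeft φ _ _ α := TwoCell.precomp φ α
  whiskerRight α ψ := TwoCell.postcomp α ψ
  associator φ ψ χ := Iso.refl (φ ≫ ψ ≫ χ)
  leftUnitor φ := Iso.refl φ
  rightUnitor φ := Iso.refl φ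
  whiskerLeft_id _ _ := rfl
  whiskerLeft_comp _ _ _ _ _ _ := rfl
  id_whiskerLeft α := ((TwoCell.refl_vcomp _).trans (TwoCell.vcomp_refl _)).symm
  comp_whiskerLeft φ ψ _ _ α := ((TwoCell.refl_vcomp _).trans (TwoCell.vcomp_refl _)).symm
  id_whiskerRight φ ψ := TwoCell.postcomp_refl φ ψ
  comp_whiskerRight α β ψ := TwoCell.ext_app fun x => Hom.arr_comp ψ _ _ _
  whiskerRight_id α := ((TwoCell.refl_vcomp _).trans (TwoCell.vcomp_refl _)).symm
  whiskerRight_comp α ψ χ := ((TwoCell.refl_vcomp _).trans (TwoCell.vcomp_refl _)).symm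
  whisker_assoc _ _ _ _ _ := ((TwoCell.refl_vcomp _).trans (TwoCell.vcomp_refl _)).symm
  whisker_exchange {_ _ _ φ φ' ψ ψ'} α β := by
    refine TwoCell.ext_app fun x => ?_
    refine Eq.trans ?_ ((TwoCell.natural β (TwoCell.app α x)).trans ?_)
    · exact LieGpd.comp_congr _ rfl (congrArg (TwoCell.app β) (TwoCell.src_app α x).symm) _
    · exact LieGpd.comp_congr _ (congrArg (TwoCell.app β) (TwoCell.tgt_app α x)) rfl _
  pentagon φ ψ χ ζ := by
    refine Eq.trans (congrArg₂ TwoCell.vcomp (TwoCell.postcomp_refl _ ζ) rfl) ?_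
    exact (TwoCell.refl_vcomp _)
  triangle φ ψ := by
    refine Eq.trans ?_ (TwoCell.postcomp_refl φ ψ).symm
    exact (TwoCell.refl_vcomp _)

instance : Bicategory.Strict LieGpd.{u} where
  id_comp _ := rfl
  comp_id _ := rfl
  assoc _ _ _ := rfl
  leftUnitor_eqToIso _ := rfl
  rightUnitor_eqToIso _ := rfl
  associator_eqToIso φ ψ χ := by
    apply Iso.ext
    exact (eqToHom_refl (φ ≫ ψ ≫ χ) rfl).symm

end LieGpd

/-! ## Essential equivalences and orbifold groupoids -/

namespace LieGpd

/-- Essential equivalences of Lie groupoids. -/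
structure IsEssEquiv {G H : LieGpd.{u}} (φ : G ⟶ H) : Prop where
  /-- Essential surjectivity: the map `(x, h) ↦ t(h)` from the fibre product manifold
  `G₀ ×_{H₀} H₁ = {(x, h) | φ x = s(h)}` to `H₀` is a surjective submersion. -/
  essSurj : ∃ (P : Mfd.{u}) (p : P ⟶ G.obj) (q : P ⟶ H.arr),
    IsPullback p q (Hom.obj φ) H.src ∧ Mfd.IsSurjectiveSubmersion (q ≫ H.tgt)
  /-- Full faithfulness: `G₁` is the pullback of `(s, t) : H₁ ⟶ H₀ × H₀` along `φ₀ × φ₀`, in the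
  category of manifolds. -/
  fullyFaithful : IsPullback (Hom.arr φ) G.srcTgt H.srcTgt
    (Mfd.prodMap (Hom.obj φ) (Hom.obj φ))

/-- The groupoid is étale: its source map is a local diffeomorphism. -/
def IsEtale (G : LieGpd.{u}) : Prop := IsLocalDiffeomorph G.arr.I G.obj.I ∞ G.src

/-- The groupoid is proper: `(s, t)` is a proper map. -/
def IsProper (G : LieGpd.{u}) : Prop :=
  IsProperMap (fun g : G.arr => (G.src g, G.tgt g))

/-- An orbifold groupoid is a Lie groupoid which is essentially equivalent (through a span of
essential equivalences) to a proper étale Lie groupoid. -/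
def IsOrbifold (G : LieGpd.{u}) : Prop :=
  ∃ (K E : LieGpd.{u}) (ν : K ⟶ G) (ν' : K ⟶ E),
    IsEssEquiv ν ∧ IsEssEquiv ν' ∧ E.IsEtale ∧ E.IsProper

/-- The square
```
  P --ζ--> K
  |        |
  ξ   θ    ψ
  v        v
  H --φ--> G
```
commuting up to the 2-cell `θ` exhibits `P` as the weak fibre product of `φ` and `ψ`: the objects
of `P` are the triples `(y, g, z)` with `g : φ y ⟶ ψ z` (that is, `P₀` is the fibre product of
manifolds `H₀ ×_{G₀} G₁ ×_{G₀} K₀`), and the arrows `(y, g, z) ⟶ (y', g', z')` are the pairs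
`(h : y ⟶ y', k : z ⟶ z')` with `g' φ(h) = ψ(k) g` (again as a fibre product of manifolds). -/
structure IsWeakFibreProduct {H K G P : LieGpd.{u}} {φ : H ⟶ G} {ψ : K ⟶ G}
    {ξ : P ⟶ H} {ζ : P ⟶ K} (θ : ξ ≫ φ ⟶ ζ ≫ ψ) : Prop where
  obj : ∀ (T : Mfd.{u}) (y : T ⟶ H.obj) (g : T ⟶ G.arr) (z : T ⟶ K.obj),
    g ≫ G.src = y ≫ Hom.obj φ → g ≫ G.tgt = z ≫ Hom.obj ψ →
    ∃! c : T ⟶ P.obj,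
      c ≫ Hom.obj ξ = y ∧ c ≫ TwoCell.app θ = g ∧ c ≫ Hom.obj ζ = z
  arr : ∀ (T : Mfd.{u}) (c c' : T ⟶ P.obj) (h : T ⟶ H.arr) (k : T ⟶ K.arr)
    (_hs : h ≫ H.src = c ≫ Hom.obj ξ) (ht : h ≫ H.tgt = c' ≫ Hom.obj ξ)
    (ks : k ≫ K.src = c ≫ Hom.obj ζ) (_kt : k ≫ K.tgt = c' ≫ Hom.obj ζ),
    (∀ x : T, G.comp (TwoCell.app θ (c' x)) (Hom.arr φ (h x))
        ((TwoCell.src_app θ _).trans ((congrArg (Hom.obj φ) (DFunLike.congr_fun ht x)).symm.trans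
          (Hom.tgt_arr φ _).symm)) =
      G.comp (Hom.arr ψ (k x)) (TwoCell.app θ (c x))
        ((Hom.src_arr ψ _).trans ((congrArg (Hom.obj ψ) (DFunLike.congr_fun ks x)).trans
          (TwoCell.tgt_app θ _).symm))) →
    ∃! a : T ⟶ P.arr,
      a ≫ P.src = c ∧ a ≫ P.tgt = c' ∧ a ≫ Hom.arr ξ = h ∧ a ≫ Hom.arr ζ = k

end LieGpd

/-! ## Translation groupoids and equivariant maps -/

/-- The data of a translation groupoid `G ⋉ X`: a Lie group `G` with a smooth left action on a
manifold `X`. -/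
structure TransGpd : Type (u + 1) where
  grp : Mfd.{u}
  space : Mfd.{u}
  [group : Group grp]
  [lieGroup : LieGroup grp.I ∞ grp]
  [action : MulAction grp space]
  [smoothAction : ContMDiffSMul grp.I space.I ∞ grp space]

namespace TransGpd

attribute [instance] group lieGroup action smoothAction

/-- The Lie groupoid `G ⋉ X`: its objects are the points of `X`, its arrows are the pairs
`(g, x) : x ⟶ g x`. -/
noncomputable def toLieGpd (A : TransGpd.{u}) : LieGpd.{u} where
  obj := A.space
  arr := A.grp.prod A.space
  src := Mfd.homMk (fun p => p.2) contMDiff_snd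
  tgt := Mfd.homMk (fun p => p.1 • p.2) contMDiff_smul
  unit := Mfd.homMk (fun x => (1, x)) (contMDiff_const.prodMk contMDiff_id)
  inv := Mfd.homMk (fun p => (p.1⁻¹, p.1 • p.2))
    (((contMDiff_inv A.grp.I ∞).comp contMDiff_fst).prodMk contMDiff_smul)
  comp q p _ := (q.1 * p.1, p.2)
  smooth_comp T a b _ :=
    ((contMDiff_fst.comp (Mfd.contMDiff a)).mul (contMDiff_fst.comp (Mfd.contMDiff b))).prodMk
      (contMDiff_snd.comp (Mfd.contMDiff b))
  src_unit _ := rfl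
  tgt_unit x := one_smul A.grp x
  src_inv _ := rfl
  tgt_inv p := inv_smul_smul p.1 p.2
  src_comp _ _ _ := rfl
  tgt_comp q p h := by
    have h' : q.2 = p.1 • p.2 := h
    change (q.1 * p.1) • p.2 = q.1 • q.2
    rw [h', mul_smul]
  comp_unit p := Prod.ext (mul_one p.1) rfl
  unit_comp p := Prod.ext (one_mul p.1) rfl
  comp_assoc r q p _ _ := Prod.ext (mul_assoc r.1 q.1 p.1) rfl
  inv_comp p := Prod.ext (inv_mul_cancel p.1) rfl
  comp_inv p := Prod.ext (mul_inv_cancel p.1) rfl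
  src_submersion := by
    refine ⟨fun x => ⟨((1 : A.grp), x), rfl⟩, fun p => ?_⟩
    intro w
    refine ⟨((0 : A.grp.E), w), ?_⟩
    exact DFunLike.congr_fun
      (mfderiv_snd (I := A.grp.I) (I' := A.space.I) (x := (p : A.grp × A.space))) _

/-- Equivariant maps `G ⋉ X ⟶ H ⋉ Y`: pairs of a homomorphism of Lie groups `G ⟶ H` and an
equivariant smooth map `X ⟶ Y`. -/
@[ext]
structure Hom (A B : TransGpd.{u}) where
  grp : A.grp ⟶ B.grp
  space : A.space ⟶ B.space
  map_mul : ∀ g g', grp (g * g') = grp g * grp g'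
  map_smul : ∀ g x, space (g • x) = grp g • space x

instance : CategoryStruct TransGpd.{u} where
  Hom := Hom
  id A := ⟨𝟙 _, 𝟙 _, fun _ _ => rfl, fun _ _ => rfl⟩
  comp f g := ⟨f.grp ≫ g.grp, f.space ≫ g.space, by simp [Hom.map_mul], by simp [Hom.map_smul]⟩

/-- The homomorphism of Lie groupoids given by an equivariant map. -/
noncomputable def Hom.toLieGpd {A B : TransGpd.{u}} (f : A ⟶ B) : A.toLieGpd ⟶ B.toLieGpd :=
  ({ obj := Hom.space f
     arr := Mfd.prodMap (Hom.grp f) (Hom.space f)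
     src_arr := fun _ => rfl
     tgt_arr := fun p => (Hom.map_smul f p.1 p.2).symm
     arr_unit := fun x => Prod.ext
       (by
        have h := Hom.map_mul f 1 1
        rw [mul_one] at h
        exact left_eq_mul.mp h) rfl
     arr_comp := fun q p _ => Prod.ext (Hom.map_mul f q.1 p.1) rfl } :
    LieGpd.Hom A.toLieGpd B.toLieGpd)

noncomputable instance homCategory (A B : TransGpd.{u}) : Category (A ⟶ B) where
  Hom f g := LieGpd.TwoCell (Hom.toLieGpd f) (Hom.toLieGpd g)
  id f := LieGpd.TwoCell.refl (Hom.toLieGpd f)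
  comp α β := LieGpd.TwoCell.vcomp α β
  id_comp α := LieGpd.TwoCell.refl_vcomp α
  comp_id α := LieGpd.TwoCell.vcomp_refl α
  assoc α β γ := LieGpd.TwoCell.vcomp_assoc α β γ

/-- The 2-category of translation groupoids, equivariant maps and natural transformations between
the associated homomorphisms of Lie groupoids. -/
noncomputable instance bicategory : Bicategory TransGpd.{u} where
  homCategory := homCategory
  whiskerLeft f _ _ α := LieGpd.TwoCell.precomp (Hom.toLieGpd f) α
  whiskerRight α g := LieGpd.TwoCell.postcomp α (Hom.toLieGpd g)
  associator f g h := Iso.refl (f ≫ g ≫ h)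
  leftUnitor f := Iso.refl f
  rightUnitor f := Iso.refl f
  whiskerLeft_id _ _ := rfl
  whiskerLeft_comp _ _ _ _ _ _ := rfl
  id_whiskerLeft α := id_whiskerLeft (B := LieGpd.{u}) α
  comp_whiskerLeft f g _ _ α :=
    comp_whiskerLeft (B := LieGpd.{u}) (Hom.toLieGpd f) (Hom.toLieGpd g) α
  id_whiskerRight f g := LieGpd.TwoCell.postcomp_refl (Hom.toLieGpd f) (Hom.toLieGpd g)
  comp_whiskerRight α β g := comp_whiskerRight (B := LieGpd.{u}) α β (Hom.toLieGpd g)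
  whiskerRight_id α := whiskerRight_id (B := LieGpd.{u}) α
  whiskerRight_comp α g h :=
    whiskerRight_comp (B := LieGpd.{u}) α (Hom.toLieGpd g) (Hom.toLieGpd h)
  whisker_assoc f _ _ α h :=
    whisker_assoc (B := LieGpd.{u}) (Hom.toLieGpd f) α (Hom.toLieGpd h)
  whisker_exchange α β := whisker_exchange (B := LieGpd.{u}) α β
  pentagon f g h k :=
    pentagon (B := LieGpd.{u}) (Hom.toLieGpd f) (Hom.toLieGpd g) (Hom.toLieGpd h) (Hom.toLieGpd k)
  triangle f g := triangle (B := LieGpd.{u}) (Hom.toLieGpd f) (Hom.toLieGpd g)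

instance : Bicategory.Strict TransGpd.{u} where
  id_comp _ := rfl
  comp_id _ := rfl
  assoc _ _ _ := rfl
  leftUnitor_eqToIso _ := rfl
  rightUnitor_eqToIso _ := rfl
  associator_eqToIso f g h := by
    apply Iso.ext
    exact (eqToHom_refl (f ≫ g ≫ h) rfl).symm

end TransGpd

/-! ## Bicategories of fractions -/

/-- A class of 1-cells of a 2-category. -/
abbrev OneCellClass (C : Type u) [Bicategory.{w, v} C] := ∀ ⦃X Y : C⦄, (X ⟶ Y) → Prop

namespace Fractions

variable {C : Type u} [Bicategory.{w, v} C]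

/-- A generalized map `X ⟶ Y`: a span `X ⟵ K ⟶ Y` whose left leg is in `W`. -/
structure Span (W : OneCellClass C) (X Y : C) where
  apex : C
  left : apex ⟶ X
  right : apex ⟶ Y
  mem : W left

/-- The identity span. -/
def Span.id {W : OneCellClass C} (X : C) (h : W (𝟙 X)) : Span W X X := ⟨X, 𝟙 X, 𝟙 X, h⟩

variable {W : OneCellClass C}

/-- A diagram representing a 2-cell between two spans `S` and `S'`:
```
            K
       ω  / ^  \  φ
         v  ν   v
       X    L    Y       α₁ : ω ν ≅ ω' ν',   α₂ : φ ν ⟶ φ' ν'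
         ^  ν'  ^
      ω'  \ v  /  φ'
            K'
```
in which `ω ν` and `ω' ν'` are in `W`. -/
structure Diagram {X Y : C} (S S' : Span W X Y) where
  apex : C
  ν : apex ⟶ S.apex
  ν' : apex ⟶ S'.apex
  α₁ : ν ≫ S.left ≅ ν' ≫ S'.left
  α₂ : ν ≫ S.right ⟶ ν' ≫ S'.right
  mem : W (ν ≫ S.left)
  mem' : W (ν' ≫ S'.left)

/-- Two diagrams are equivalent if their middle objects receive 1-cells `s`, `s'` from a common
object such that, up to invertible 2-cells `η`, `η'`, the two diagrams become equal after pasting,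
and the resulting 1-cells to `X` are in `W`. -/
def Diagram.Rel {X Y : C} {S S' : Span W X Y} (d e : Diagram S S') : Prop :=
  ∃ (N : C) (s : N ⟶ d.apex) (s' : N ⟶ e.apex)
    (η : s ≫ d.ν ≅ s' ≫ e.ν) (η' : s ≫ d.ν' ≅ s' ≫ e.ν'),
    W (s ≫ d.ν ≫ S.left) ∧ W (s' ≫ e.ν' ≫ S'.left) ∧
    (α_ _ _ _).hom ≫ s ◁ d.α₁.hom ≫ (α_ _ _ _).inv ≫ η'.hom ▷ S'.left =
      η.hom ▷ S.left ≫ (α_ _ _ _).hom ≫ s' ◁ e.α₁.hom ≫ (α_ _ _ _).inv ∧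
    (α_ _ _ _).hom ≫ s ◁ d.α₂ ≫ (α_ _ _ _).inv ≫ η'.hom ▷ S'.right =
      η.hom ▷ S.right ≫ (α_ _ _ _).hom ≫ s' ◁ e.α₂ ≫ (α_ _ _ _).inv

/-- A 2-cell between spans: an equivalence class of diagrams. -/
def Cell {X Y : C} (S S' : Span W X Y) := Quot (Diagram.Rel (S := S) (S' := S'))

/-- The class of a diagram. -/
def Cell.mk {X Y : C} {S S' : Span W X Y} (d : Diagram S S') : Cell S S' := Quot.mk _ d

/-- The identity diagram. -/
def Diagram.id [Bicategory.Strict C] {X Y : C} (S : Span W X Y) : Diagram S S where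
  apex := S.apex
  ν := 𝟙 _
  ν' := 𝟙 _
  α₁ := Iso.refl _
  α₂ := 𝟙 _
  mem := by rw [Bicategory.Strict.id_comp]; exact S.mem
  mem' := by rw [Bicategory.Strict.id_comp]; exact S.mem

/-- Data allowing to compose the diagrams `d : S ⇒ S'` and `e : S' ⇒ S''` vertically: an object
over the middle objects of `d` and `e` filling, up to an invertible 2-cell, the square over the
apex of `S'`. -/
structure VComposite {X Y : C} {S S' S'' : Span W X Y} (d : Diagram S S') (e : Diagram S' S'')
    where
  apex : C
  r : apex ⟶ d.apex
  r' : apex ⟶ e.apex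
  σ : r ≫ d.ν' ≅ r' ≫ e.ν
  mem : W ((r ≫ d.ν) ≫ S.left)
  mem' : W ((r' ≫ e.ν') ≫ S''.left)

/-- The vertical composite of two diagrams, obtained by pasting. -/
def VComposite.diagram {X Y : C} {S S' S'' : Span W X Y} {d : Diagram S S'} {e : Diagram S' S''}
    (N : VComposite d e) : Diagram S S'' where
  apex := N.apex
  ν := N.r ≫ d.ν
  ν' := N.r' ≫ e.ν'
  α₁ := α_ _ _ _ ≪≫ whiskerLeftIso N.r d.α₁ ≪≫ (α_ _ _ _).symm ≪≫ whiskerRightIso N.σ S'.left ≪≫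
    α_ _ _ _ ≪≫ whiskerLeftIso N.r' e.α₁ ≪≫ (α_ _ _ _).symm
  α₂ := (α_ _ _ _).hom ≫ N.r ◁ d.α₂ ≫ (α_ _ _ _).inv ≫ N.σ.hom ▷ S'.right ≫
    (α_ _ _ _).hom ≫ N.r' ◁ e.α₂ ≫ (α_ _ _ _).inv
  mem := N.mem
  mem' := N.mem'

/-- A square filling the composable pair of spans `X ⟵ K ⟶ Y ⟵ L ⟶ Z`:
```
        P --q--> L
        |        |
        p   θ   left
        v        v
        K -----> Y
```
such that the composite `P ⟶ K ⟶ X` is in `W`. -/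
structure Filler {X Y Z : C} (S : Span W X Y) (T : Span W Y Z) where
  apex : C
  p : apex ⟶ S.apex
  q : apex ⟶ T.apex
  θ : p ≫ S.right ≅ q ≫ T.left
  mem : W (p ≫ S.left)

/-- The composite span determined by a filling square. -/
def Filler.span {X Y Z : C} {S : Span W X Y} {T : Span W Y Z} (c : Filler S T) : Span W X Z :=
  ⟨c.apex, c.p ≫ S.left, c.q ≫ T.right, c.mem⟩

/-- Data allowing to compose the diagrams `d : S ⇒ S'` and `e : T ⇒ T'` horizontally, giving
a diagram from the composite of `S` and `T` along the filling square `c` to the composite of `S'`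
and `T'` along the filling square `c'`: an object over the four middle objects, compatible with all
the 2-cells over the middle object `Y`. -/
structure HComposite {X Y Z : C} {S S' : Span W X Y} {T T' : Span W Y Z}
    (d : Diagram S S') (e : Diagram T T') (c : Filler S T) (c' : Filler S' T') where
  apex : C
  n : apex ⟶ c.apex
  n' : apex ⟶ c'.apex
  r : apex ⟶ d.apex
  r' : apex ⟶ e.apex
  σ : n ≫ c.p ≅ r ≫ d.ν
  σ' : r ≫ d.ν' ≅ n' ≫ c'.p
  τ : n ≫ c.q ≅ r' ≫ e.ν
  τ' : r' ≫ e.ν' ⟶ n' ≫ c'.q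
  compat :
    σ.hom ▷ S.right ≫ (α_ _ _ _).hom ≫ r ◁ d.α₂ ≫ (α_ _ _ _).inv ≫ σ'.hom ▷ S'.right ≫
        (α_ _ _ _).hom ≫ n' ◁ c'.θ.hom =
      (α_ _ _ _).hom ≫ n ◁ c.θ.hom ≫ (α_ _ _ _).inv ≫ τ.hom ▷ T.left ≫ (α_ _ _ _).hom ≫
        r' ◁ e.α₁.hom ≫ (α_ _ _ _).inv ≫ τ' ▷ T'.left ≫ (α_ _ _ _).hom
  mem : W (n ≫ c.p ≫ S.left)
  mem' : W (n' ≫ c'.p ≫ S'.left)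

/-- The horizontal composite of two diagrams, obtained by pasting. -/
def HComposite.diagram {X Y Z : C} {S S' : Span W X Y} {T T' : Span W Y Z}
    {d : Diagram S S'} {e : Diagram T T'} {c : Filler S T} {c' : Filler S' T'}
    (N : HComposite d e c c') : Diagram c.span c'.span where
  apex := N.apex
  ν := N.n
  ν' := N.n'
  α₁ := (α_ N.n c.p S.left).symm ≪≫ whiskerRightIso N.σ S.left ≪≫ α_ _ _ _ ≪≫
    whiskerLeftIso N.r d.α₁ ≪≫ (α_ _ _ _).symm ≪≫ whiskerRightIso N.σ' S'.left ≪≫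
    α_ N.n' c'.p S'.left
  α₂ := (α_ N.n c.q T.right).inv ≫ N.τ.hom ▷ T.right ≫ (α_ _ _ _).hom ≫
    N.r' ◁ e.α₂ ≫ (α_ _ _ _).inv ≫ N.τ' ▷ T'.right ≫ (α_ N.n' c'.q T'.right).hom
  mem := N.mem
  mem' := N.mem'

/-- Data comparing the two ways of composing three spans `S`, `T`, `R`: an object over the apexes
of both triple composites, with compatible identifications of its 1-cells to the apexes of `S`,
`T` and `R`. -/
structure AssocComparison {X Y Z V : C} {S : Span W X Y} {T : Span W Y Z} {R : Span W Z V}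
    {c : Filler S T} {c' : Filler T R} (a : Filler c.span R) (a' : Filler S c'.span) where
  apex : C
  n : apex ⟶ a.apex
  n' : apex ⟶ a'.apex
  ρ : n ≫ a.p ≫ c.p ≅ n' ≫ a'.p
  τ : n ≫ a.p ≫ c.q ≅ n' ≫ a'.q ≫ c'.p
  κ : n ≫ a.q ≅ n' ≫ a'.q ≫ c'.q
  compat₁ :
    ρ.hom ▷ S.right ≫ (α_ _ _ _).hom ≫ n' ◁ a'.θ.hom =
      (α_ _ _ _).hom ≫ n ◁ (α_ _ _ _).hom ≫ n ◁ a.p ◁ c.θ.hom ≫ n ◁ (α_ _ _ _).inv ≫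
        (α_ _ _ _).inv ≫ τ.hom ▷ T.left ≫ (α_ _ _ _).hom ≫ n' ◁ (α_ a'.q c'.p T.left).hom
  compat₂ :
    τ.hom ▷ T.right ≫ (α_ _ _ _).hom ≫ n' ◁ (α_ _ _ _).hom ≫ n' ◁ a'.q ◁ c'.θ.hom ≫
        n' ◁ (α_ _ _ _).inv ≫ (α_ _ _ _).inv =
      (α_ _ _ _).hom ≫ n ◁ (α_ a.p c.q T.right).hom ≫ n ◁ a.θ.hom ≫ (α_ _ _ _).inv ≫
        κ.hom ▷ R.left
  mem : W (n ≫ a.p ≫ c.p ≫ S.left)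
  mem' : W (n' ≫ a'.p ≫ S.left)

/-- The diagram between the two triple composites given by such a comparison. -/
def AssocComparison.diagram {X Y Z V : C} {S : Span W X Y} {T : Span W Y Z} {R : Span W Z V}
    {c : Filler S T} {c' : Filler T R} {a : Filler c.span R} {a' : Filler S c'.span}
    (N : AssocComparison a a') : Diagram a.span a'.span where
  apex := N.apex
  ν := N.n
  ν' := N.n'
  α₁ := whiskerLeftIso N.n (α_ a.p c.p S.left).symm ≪≫ (α_ _ _ _).symm ≪≫
    whiskerRightIso N.ρ S.left ≪≫ α_ N.n' a'.p S.left
  α₂ := (α_ N.n a.q R.right).inv ≫ N.κ.hom ▷ R.right ≫ (α_ _ _ _).hom ≫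
    N.n' ◁ (α_ a'.q c'.q R.right).hom
  mem := N.mem
  mem' := N.mem'

/-- The bicategory of fractions `C(W⁻¹)` of a 2-category `C` (all of whose 2-cells are invertible
in the applications). Its objects are those of `C`, its 1-cells are the spans with left leg in `W`,
and its 2-cells are the equivalence classes of diagrams. The only choice involved is that of the
square `fill S T` by which two spans are composed. All the operations on 2-cells are determined by
pasting of diagrams, as described by the fields whose names end in `mk`; the remaining fields say
that the operations are well-defined and satisfy the laws of a bicategory. -/
structure FractionBicategory [Bicategory.Strict C] (W : OneCellClass C) where
  id_mem : ∀ X : C, W (𝟙 X)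
  /-- the squares defining the composition of spans -/
  fill : ∀ {X Y Z : C} (S : Span W X Y) (T : Span W Y Z), Filler S T
  /-- vertical composition -/
  vcomp : ∀ {X Y : C} {S S' S'' : Span W X Y}, Cell S S' → Cell S' S'' → Cell S S''
  vcomp_mk : ∀ {X Y : C} {S S' S'' : Span W X Y} (d : Diagram S S') (e : Diagram S' S'')
    (N : VComposite d e), vcomp (Cell.mk d) (Cell.mk e) = Cell.mk N.diagram
  exists_vcomposite : ∀ {X Y : C} {S S' S'' : Span W X Y} (d : Diagram S S') (e : Diagram S' S''),
    Nonempty (VComposite d e)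
  /-- left whiskering -/
  whiskerL : ∀ {X Y Z : C} (S : Span W X Y) {T T' : Span W Y Z}, Cell T T' →
    Cell (fill S T).span (fill S T').span
  whiskerL_mk : ∀ {X Y Z : C} (S : Span W X Y) {T T' : Span W Y Z} (e : Diagram T T')
    (N : HComposite (Diagram.id S) e (fill S T) (fill S T')),
    whiskerL S (Cell.mk e) = Cell.mk N.diagram
  exists_whiskerL : ∀ {X Y Z : C} (S : Span W X Y) {T T' : Span W Y Z} (e : Diagram T T'),
    Nonempty (HComposite (Diagram.id S) e (fill S T) (fill S T'))
  /-- right whiskering -/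
  whiskerR : ∀ {X Y Z : C} {S S' : Span W X Y}, Cell S S' → ∀ T : Span W Y Z,
    Cell (fill S T).span (fill S' T).span
  whiskerR_mk : ∀ {X Y Z : C} {S S' : Span W X Y} (d : Diagram S S') (T : Span W Y Z)
    (N : HComposite d (Diagram.id T) (fill S T) (fill S' T)),
    whiskerR (Cell.mk d) T = Cell.mk N.diagram
  exists_whiskerR : ∀ {X Y Z : C} {S S' : Span W X Y} (d : Diagram S S') (T : Span W Y Z),
    Nonempty (HComposite d (Diagram.id T) (fill S T) (fill S' T))
  /-- the associator and its inverse -/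
  assoc : ∀ {X Y Z V : C} (S : Span W X Y) (T : Span W Y Z) (R : Span W Z V),
    Cell (fill (fill S T).span R).span (fill S (fill T R).span).span
  assocInv : ∀ {X Y Z V : C} (S : Span W X Y) (T : Span W Y Z) (R : Span W Z V),
    Cell (fill S (fill T R).span).span (fill (fill S T).span R).span
  assoc_mk : ∀ {X Y Z V : C} (S : Span W X Y) (T : Span W Y Z) (R : Span W Z V)
    (N : AssocComparison (fill (fill S T).span R) (fill S (fill T R).span)),
    assoc S T R = Cell.mk N.diagram
  exists_assoc : ∀ {X Y Z V : C} (S : Span W X Y) (T : Span W Y Z) (R : Span W Z V),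
    Nonempty (AssocComparison (fill (fill S T).span R) (fill S (fill T R).span))
  /-- the left unitor and its inverse -/
  leftUnit : ∀ {X Y : C} (S : Span W X Y), Cell (fill (Span.id X (id_mem X)) S).span S
  leftUnitInv : ∀ {X Y : C} (S : Span W X Y), Cell S (fill (Span.id X (id_mem X)) S).span
  leftUnit_mk : ∀ {X Y : C} (S : Span W X Y), ∃ h h',
    leftUnit S = Cell.mk
      { apex := (fill (Span.id X (id_mem X)) S).apex
        ν := 𝟙 _
        ν' := (fill (Span.id X (id_mem X)) S).q
        α₁ := λ_ _ ≪≫ (fill (Span.id X (id_mem X)) S).θ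
        α₂ := (λ_ _).hom
        mem := h
        mem' := h' }
  /-- the right unitor and its inverse -/
  rightUnit : ∀ {X Y : C} (S : Span W X Y), Cell (fill S (Span.id Y (id_mem Y))).span S
  rightUnitInv : ∀ {X Y : C} (S : Span W X Y), Cell S (fill S (Span.id Y (id_mem Y))).span
  rightUnit_mk : ∀ {X Y : C} (S : Span W X Y), ∃ h h',
    rightUnit S = Cell.mk
      { apex := (fill S (Span.id Y (id_mem Y))).apex
        ν := 𝟙 _
        ν' := (fill S (Span.id Y (id_mem Y))).p
        α₁ := λ_ _
        α₂ := (λ_ _).hom ≫ (fill S (Span.id Y (id_mem Y))).θ.inv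
        mem := h
        mem' := h' }
  -- laws of vertical composition
  id_vcomp : ∀ {X Y : C} {S S' : Span W X Y} (a : Cell S S'),
    vcomp (Cell.mk (Diagram.id S)) a = a
  vcomp_id : ∀ {X Y : C} {S S' : Span W X Y} (a : Cell S S'),
    vcomp a (Cell.mk (Diagram.id S')) = a
  vcomp_assoc : ∀ {X Y : C} {S₁ S₂ S₃ S₄ : Span W X Y} (a : Cell S₁ S₂) (b : Cell S₂ S₃)
    (c : Cell S₃ S₄), vcomp (vcomp a b) c = vcomp a (vcomp b c)
  -- invertibility of the associator and the unitors
  assoc_assocInv : ∀ {X Y Z V : C} (S : Span W X Y) (T : Span W Y Z) (R : Span W Z V),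
    vcomp (assoc S T R) (assocInv S T R) = Cell.mk (Diagram.id _)
  assocInv_assoc : ∀ {X Y Z V : C} (S : Span W X Y) (T : Span W Y Z) (R : Span W Z V),
    vcomp (assocInv S T R) (assoc S T R) = Cell.mk (Diagram.id _)
  leftUnit_leftUnitInv : ∀ {X Y : C} (S : Span W X Y),
    vcomp (leftUnit S) (leftUnitInv S) = Cell.mk (Diagram.id _)
  leftUnitInv_leftUnit : ∀ {X Y : C} (S : Span W X Y),
    vcomp (leftUnitInv S) (leftUnit S) = Cell.mk (Diagram.id _)
  rightUnit_rightUnitInv : ∀ {X Y : C} (S : Span W X Y),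
    vcomp (rightUnit S) (rightUnitInv S) = Cell.mk (Diagram.id _)
  rightUnitInv_rightUnit : ∀ {X Y : C} (S : Span W X Y),
    vcomp (rightUnitInv S) (rightUnit S) = Cell.mk (Diagram.id _)
  -- laws of whiskering
  whiskerL_id : ∀ {X Y Z : C} (S : Span W X Y) (T : Span W Y Z),
    whiskerL S (Cell.mk (Diagram.id T)) = Cell.mk (Diagram.id _)
  whiskerL_comp : ∀ {X Y Z : C} (S : Span W X Y) {T₁ T₂ T₃ : Span W Y Z} (a : Cell T₁ T₂)
    (b : Cell T₂ T₃), whiskerL S (vcomp a b) = vcomp (whiskerL S a) (whiskerL S b)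
  id_whiskerL : ∀ {X Y : C} {S S' : Span W X Y} (a : Cell S S'),
    whiskerL (Span.id X (id_mem X)) a = vcomp (leftUnit S) (vcomp a (leftUnitInv S'))
  comp_whiskerL : ∀ {X Y Z V : C} (S : Span W X Y) (T : Span W Y Z) {R R' : Span W Z V}
    (a : Cell R R'), whiskerL (fill S T).span a =
      vcomp (assoc S T R) (vcomp (whiskerL S (whiskerL T a)) (assocInv S T R'))
  id_whiskerR : ∀ {X Y Z : C} (S : Span W X Y) (T : Span W Y Z),
    whiskerR (Cell.mk (Diagram.id S)) T = Cell.mk (Diagram.id _)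
  comp_whiskerR : ∀ {X Y Z : C} {S₁ S₂ S₃ : Span W X Y} (a : Cell S₁ S₂) (b : Cell S₂ S₃)
    (T : Span W Y Z), whiskerR (vcomp a b) T = vcomp (whiskerR a T) (whiskerR b T)
  whiskerR_id : ∀ {X Y : C} {S S' : Span W X Y} (a : Cell S S'),
    whiskerR a (Span.id Y (id_mem Y)) = vcomp (rightUnit S) (vcomp a (rightUnitInv S'))
  whiskerR_comp : ∀ {X Y Z V : C} {S S' : Span W X Y} (a : Cell S S') (T : Span W Y Z)
    (R : Span W Z V), whiskerR a (fill T R).span =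
      vcomp (assocInv S T R) (vcomp (whiskerR (whiskerR a T) R) (assoc S' T R))
  whisker_assoc : ∀ {X Y Z V : C} (S : Span W X Y) {T T' : Span W Y Z} (a : Cell T T')
    (R : Span W Z V), whiskerR (whiskerL S a) R =
      vcomp (assoc S T R) (vcomp (whiskerL S (whiskerR a R)) (assocInv S T' R))
  whisker_exchange : ∀ {X Y Z : C} {S S' : Span W X Y} {T T' : Span W Y Z} (a : Cell S S')
    (b : Cell T T'),
    vcomp (whiskerL S b) (whiskerR a T') = vcomp (whiskerR a T) (whiskerL S' b)
  -- coherence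
  pentagon : ∀ {X Y Z V U : C} (S : Span W X Y) (T : Span W Y Z) (R : Span W Z V)
    (Q : Span W V U),
    vcomp (whiskerR (assoc S T R) Q)
        (vcomp (assoc S (fill T R).span Q) (whiskerL S (assoc T R Q))) =
      vcomp (assoc (fill S T).span R Q) (assoc S T (fill R Q).span)
  triangle : ∀ {X Y Z : C} (S : Span W X Y) (T : Span W Y Z),
    vcomp (assoc S (Span.id Y (id_mem Y)) T) (whiskerL S (leftUnit T)) = whiskerR (rightUnit S) T

/-- The objects of the full sub-bicategory of a bicategory of fractions on the objects with the
property `P`. -/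
structure Obj [Bicategory.Strict C] (F : FractionBicategory W) (P : C → Prop) where
  obj : C
  property : P obj

section

variable [Bicategory.Strict C] {F : FractionBicategory W} {P : C → Prop}

instance : CategoryStruct (Obj F P) where
  Hom X Y := Span W X.obj Y.obj
  id X := Span.id X.obj (F.id_mem X.obj)
  comp S T := (F.fill S T).span

instance (X Y : Obj F P) : Category (X ⟶ Y) where
  Hom S S' := Cell (W := W) (X := X.obj) (Y := Y.obj) S S'
  id S := Cell.mk (Diagram.id S)
  comp a b := F.vcomp a b
  id_comp a := F.id_vcomp a
  comp_id a := F.vcomp_id a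
  assoc a b c := F.vcomp_assoc a b c

/-- The full sub-bicategory of a bicategory of fractions on the objects with property `P`. -/
instance : Bicategory (Obj F P) where
  whiskerLeft S _ _ a := F.whiskerL S a
  whiskerRight a T := F.whiskerR a T
  associator S T R := ⟨F.assoc S T R, F.assocInv S T R, F.assoc_assocInv S T R,
    F.assocInv_assoc S T R⟩
  leftUnitor S := ⟨F.leftUnit S, F.leftUnitInv S, F.leftUnit_leftUnitInv S,
    F.leftUnitInv_leftUnit S⟩
  rightUnitor S := ⟨F.rightUnit S, F.rightUnitInv S, F.rightUnit_rightUnitInv S,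
    F.rightUnitInv_rightUnit S⟩
  whiskerLeft_id S T := F.whiskerL_id S T
  whiskerLeft_comp S _ _ _ a b := F.whiskerL_comp S a b
  id_whiskerLeft a := F.id_whiskerL a
  comp_whiskerLeft S T _ _ a := F.comp_whiskerL S T a
  id_whiskerRight S T := F.id_whiskerR S T
  comp_whiskerRight a b T := F.comp_whiskerR a b T
  whiskerRight_id a := F.whiskerR_id a
  whiskerRight_comp a T R := F.whiskerR_comp a T R
  whisker_assoc S _ _ a R := F.whisker_assoc S a R
  whisker_exchange a b := F.whisker_exchange a b
  pentagon S T R Q := F.pentagon S T R Q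
  triangle S T := F.triangle S T

end

end Fractions

/-- A homomorphism of bicategories is an equivalence if it is essentially surjective on objects (up
to internal equivalence) and if it induces an equivalence of categories on the categories of 1-cells
and 2-cells between any two objects. -/
structure IsBiequivalence {B : Type*} [Bicategory B] {D : Type*} [Bicategory D]
    (F : Pseudofunctor B D) : Prop where
  essSurj : ∀ d : D, ∃ b : B, Nonempty (F.obj b ≌ d)
  localEquiv : ∀ a b : B, (F.mapFunctor a b).IsEquivalence

/-! ## The two bicategories of fractions and the inclusion -/

open Fractions

/-- The class of essential equivalences in the 2-category of Lie groupoids. -/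
def lieW : OneCellClass LieGpd.{u} := fun _ _ φ => LieGpd.IsEssEquiv φ

/-- The class of equivariant maps which are essential equivalences, in the 2-category of
translation groupoids and equivariant maps. -/
def eqW : OneCellClass TransGpd.{u} := fun _ _ f => LieGpd.IsEssEquiv (TransGpd.Hom.toLieGpd f)

namespace TransGpd

/-- The inclusion on invertible 2-cells. -/
noncomputable def inclIso {A B : TransGpd.{u}} {f g : A ⟶ B} (α : f ≅ g) :
    Hom.toLieGpd f ≅ Hom.toLieGpd g where
  hom := α.hom
  inv := α.inv
  hom_inv_id := α.hom_inv_id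
  inv_hom_id := α.inv_hom_id

/-- The inclusion on generalized maps. -/
noncomputable def inclSpan {A B : TransGpd.{u}} (S : Span eqW A B) :
    Span lieW A.toLieGpd B.toLieGpd :=
  ⟨S.apex.toLieGpd, Hom.toLieGpd S.left, Hom.toLieGpd S.right, S.mem⟩

/-- The inclusion on diagrams. -/
noncomputable def inclDiagram {A B : TransGpd.{u}} {S S' : Span eqW A B} (d : Diagram S S') :
    Diagram (inclSpan S) (inclSpan S') where
  apex := d.apex.toLieGpd
  ν := Hom.toLieGpd d.ν
  ν' := Hom.toLieGpd d.ν'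
  α₁ := inclIso d.α₁
  α₂ := d.α₂
  mem := d.mem
  mem' := d.mem'

/-- The inclusion on 2-cells between generalized maps. -/
noncomputable def inclCell {A B : TransGpd.{u}} {S S' : Span eqW A B} :
    Cell S S' → Cell (inclSpan S) (inclSpan S') :=
  Quot.map inclDiagram (by
    rintro d e ⟨N, s, s', η, η', h₁, h₂, h₃, h₄⟩
    exact ⟨N.toLieGpd, Hom.toLieGpd s, Hom.toLieGpd s', inclIso η, inclIso η', h₁, h₂, h₃, h₄⟩)

/-- The inclusion on filling squares. -/
noncomputable def inclFiller {A B D : TransGpd.{u}} {S : Span eqW A B} {T : Span eqW B D}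
    (c : Filler S T) : Filler (inclSpan S) (inclSpan T) where
  apex := c.apex.toLieGpd
  p := Hom.toLieGpd c.p
  q := Hom.toLieGpd c.q
  θ := inclIso c.θ
  mem := c.mem

end TransGpd

/-- The bicategory of fractions of the 2-category of Lie groupoids with respect to the essential
equivalences, in which generalized maps are composed by means of weak fibre products. -/
structure LieFractions extends FractionBicategory lieW.{u} where
  weakFibreProduct : ∀ {X Y Z : LieGpd.{u}} (S : Span lieW X Y) (T : Span lieW Y Z),
    LieGpd.IsWeakFibreProduct (fill S T).θ.hom

/-- The bicategory of fractions of the 2-category of translation groupoids and equivariant maps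
with respect to the equivariant essential equivalences, in which generalized maps are composed by
means of weak fibre products (of the underlying Lie groupoids). -/
structure EqTrFractions extends FractionBicategory eqW.{u} where
  weakFibreProduct : ∀ {A B D : TransGpd.{u}} (S : Span eqW A B) (T : Span eqW B D),
    LieGpd.IsWeakFibreProduct (TransGpd.inclFiller (fill S T)).θ.hom

/-- The full sub-bicategory of `EqTrGpd(W⁻¹)` on the orbifold groupoids. -/
abbrev OrbEqTr (𝓐 : EqTrFractions.{u}) :=
  Fractions.Obj 𝓐.toFractionBicategory fun A => A.toLieGpd.IsOrbifold

/-- The full sub-bicategory of `LieGpd(W⁻¹)` on the translation groupoids which are orbifold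
groupoids. -/
abbrev OrbLieTr (𝓑 : LieFractions.{u}) :=
  Fractions.Obj 𝓑.toFractionBicategory fun G =>
    (∃ A : TransGpd.{u}, A.toLieGpd = G) ∧ G.IsOrbifold

/-- The effect of the inclusion of the equivariant maps on objects, generalized maps and
2-cells. -/
noncomputable def eqTrInclusion (𝓐 : EqTrFractions.{u}) (𝓑 : LieFractions.{u}) :
    PrelaxFunctorStruct (OrbEqTr 𝓐) (OrbLieTr 𝓑) where
  obj A := ⟨A.obj.toLieGpd, ⟨A.obj, rfl⟩, A.property⟩
  map S := TransGpd.inclSpan S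
  map₂ a := TransGpd.inclCell a

/-! Existence of the two bicategories rests on evaluation at points. Forgetting smoothness, a Lie
groupoid has an ordinary groupoid of points `Pt`, and an essential equivalence induces an
equivalence between such groupoids. A span therefore induces a functor `Span.func`, and a diagram
between spans a natural transformation `Diagram.ev`. This evaluation is faithful: any two parallel
diagrams have a common refinement on which their left halves agree
(`Calculus.exists_overlap_of_square`), and agreement of the right halves is then an equation of
2-cells of Lie groupoids, which can be tested at points (`Diagram.pasting_eq`). Hence two diagrams
are equivalent exactly when their evaluations coincide. Once the evaluations of all pasted diagrams
are computed (`Diagram.ev_vcomp`, `Diagram.ev_hcomp`, `Diagram.ev_assoc` and the unit versions),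
well-definedness and every bicategory law become identities between natural transformations
(`Realization.fractionBicategory`).

What this leaves to geometry is the existence of the pasting data: weak fibre products along
essential equivalences exist, and essential equivalences are stable under composition, isomorphism
and weak pullback. The weak fibre product of equivariant maps is again a translation groupoid, for
the product of the two groups, so the same argument applies to equivariant maps.

The pseudofunctor laws are checked by evaluation as well. The induced functor on 1-cells and 2-cells
between two objects is: faithful, because the common refinement of two diagrams of equivariant maps
can be taken among translation groupoids (`ev_inclDiagram_eq_iff`); full, because 2-cells descend
along essential equivalences, so that a 2-cell of spans is represented on any prescribed square over
the left legs, in particular on the equivariant weak fibre product (`inclCell_surjective`);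
essentially surjective, by a principal bundle (`exists_inclSpan_cell`). For a span from `G ⋉ X` to
`H ⋉ Y` with functor `F` on points, the pairs of a point `x` and an arrow out of `F x` form a set `X
× H` on which `G × H` acts. As `F` need not be smooth, the smooth structure is not the product one.
It is glued from the span: the points have generators `(h, g, k)` with `k` an object of the apex,
and generators related by an arrow of the apex agree. The projection to `X` is an equivariant
essential equivalence, there is an equivariant map to `Y`, and the apex maps to the new translation
groupoid compatibly with both legs. -/

/-! ## Manifolds from local data -/

namespace Mfd

theorem continuous {X Y : Mfd.{u}} (f : X ⟶ Y) : Continuous f := (contMDiff f).continuous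

/-- The manifold with one point. -/
noncomputable def point : Mfd.{u} where
  carrier := PUnit
  E := PUnit
  H := PUnit
  I := modelWithCornersSelf ℝ PUnit

/-- A constant map. -/
def const (T : Mfd.{u}) {X : Mfd.{u}} (x : X) : T ⟶ X := homMk (fun _ => x) contMDiff_const

/-- The manifold underlying a finite-dimensional vector space. -/
noncomputable def ofVectorSpace (V : Type u) [NormedAddCommGroup V] [NormedSpace ℝ V]
    [FiniteDimensional ℝ V] :
    Mfd.{u} where
  carrier := V
  E := V
  H := V
  I := modelWithCornersSelf ℝ V

/-- An open submanifold. -/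
noncomputable def restrict (X : Mfd.{u}) (U : TopologicalSpace.Opens X) : Mfd.{u} where
  carrier := U
  E := X.E
  H := X.H
  I := X.I

/-- The inclusion of an open submanifold. -/
noncomputable def incl {X : Mfd.{u}} (U : TopologicalSpace.Opens X) : X.restrict U ⟶ X :=
  ⟨Subtype.val, (contMDiff_subtype_val : ContMDiff X.I X.I ∞ (Subtype.val : U → X))⟩

/-- Restriction of the codomain of a smooth map to an open submanifold. -/
noncomputable def corestrict {T X : Mfd.{u}} (U : TopologicalSpace.Opens X) (f : T ⟶ X)
    (h : ∀ t, f t ∈ U) : T ⟶ X.restrict U :=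
  ⟨fun t => ⟨f t, h t⟩, (ContMDiff.subtypeVal_comp_iff (I := T.I) (I' := X.I) U
    (fun t => (⟨f t, h t⟩ : U))).1 (contMDiff f)⟩

/-- A map which is smooth on an open subset, as a morphism from the open submanifold. -/
noncomputable def ofContMDiffOn {X Y : Mfd.{u}} (U : TopologicalSpace.Opens X) (f : X → Y)
    (h : ContMDiffOn X.I Y.I ∞ f U) : X.restrict U ⟶ Y :=
  ⟨fun x => f x.1, h.comp_contMDiff
    (contMDiff_subtype_val : ContMDiff X.I X.I ∞ (Subtype.val : U → X)) fun x => x.2⟩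

/-- Smoothness is a local property. -/
theorem contMDiff_of_local {X Y : Mfd.{u}} (f : X → Y)
    (h : ∀ x, ∃ (U : TopologicalSpace.Opens X) (_ : x ∈ U) (g : X.restrict U ⟶ Y),
      ∀ u : X.restrict U, g u = f u.1) : ContMDiff X.I Y.I ∞ f := by
  intro x
  obtain ⟨U, hx, g, hg⟩ := h x
  refine (contMDiffAt_subtype_iff (U := U) (x := ⟨x, hx⟩)).1 ?_
  have h1 : (fun x : U => f x) = g.toFun := funext fun y => (hg y).symm
  rw [h1]
  exact g.smooth _

/-- Data presenting the set `Z`, lying over the manifold `M`, as a manifold locally diffeomorphic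
to `B`: partial bijections to `B` with smooth transition functions. -/
structure GlueData (B M : Mfd.{u}) (Z : Type u) where
  ι : Type u
  chart : ι → PartialEquiv Z B
  π : Z → M
  U : ι → TopologicalSpace.Opens M
  source_eq : ∀ i, (chart i).source = π ⁻¹' U i
  exists_mem : ∀ z, ∃ i, z ∈ (chart i).source
  open_target : ∀ i, IsOpen (chart i).target
  smooth_π : ∀ i, ContMDiffOn B.I M.I ∞ (fun b => π ((chart i).symm b)) (chart i).target
  smooth_transition : ∀ i j, ContMDiffOn B.I B.I ∞ (fun b => chart j ((chart i).symm b))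
    ((chart i).target ∩ (fun b => π ((chart i).symm b)) ⁻¹' U j)
  separated : ∀ z z', z ≠ z' → π z = π z' → ∃ i, z ∈ (chart i).source

namespace GlueData

variable {B M : Mfd.{u}} {Z : Type u} (D : GlueData B M Z)

theorem mem_source_iff (i : D.ι) (z : Z) : z ∈ (D.chart i).source ↔ D.π z ∈ D.U i := by
  rw [D.source_eq i]; rfl

theorem trans_source (i j : D.ι) : ((D.chart i).symm.trans (D.chart j)).source =
    (D.chart i).target ∩ (fun b => D.π ((D.chart i).symm b)) ⁻¹' D.U j := by
  ext b
  simp [PartialEquiv.trans_source, D.source_eq j]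

/-- The index of a chart at a point. -/
noncomputable def idx (z : Z) : D.ι := (D.exists_mem z).choose

theorem mem_idx (z : Z) : z ∈ (D.chart (D.idx z)).source := (D.exists_mem z).choose_spec

/-- The charts with values in `B`. -/
noncomputable def core : ChartedSpaceCore B Z where
  atlas := Set.range D.chart
  chartAt z := D.chart (D.idx z)
  mem_chart_source z := D.mem_idx z
  chart_mem_atlas z := ⟨_, rfl⟩
  open_source := by
    rintro _ _ ⟨i, rfl⟩ ⟨j, rfl⟩
    rw [D.trans_source]
    exact (D.smooth_π i).continuousOn.isOpen_inter_preimage (D.open_target i) (D.U j).2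
  continuousOn_toFun := by
    rintro _ _ ⟨i, rfl⟩ ⟨j, rfl⟩
    rw [D.trans_source]
    exact (D.smooth_transition i j).continuousOn

/-- The topology determined by the charts. -/
@[reducible]
noncomputable def topology : TopologicalSpace Z := D.core.toTopologicalSpace

/-- The charts as homeomorphisms. -/
noncomputable def homeo (i : D.ι) : @OpenPartialHomeomorph Z B D.topology _ :=
  D.core.openPartialHomeomorph (D.chart i) ⟨i, rfl⟩

/-- The charted space structure. -/
@[reducible]
noncomputable def chartedB : @ChartedSpace B _ Z D.topology := D.core.toChartedSpace

/-- The charted space structure with values in the model space of `B`. -/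
@[reducible]
noncomputable def charted : @ChartedSpace B.H _ Z D.topology :=
  letI := D.topology
  letI := D.chartedB
  ChartedSpace.comp B.H B Z

theorem continuous_π : @Continuous _ _ D.topology _ D.π := by
  let _ := D.topology
  rw [continuous_iff_continuousAt]
  intro z
  have hz := D.mem_idx z
  have h1 : ContinuousOn (fun y => D.π ((D.homeo (D.idx z)).symm (D.homeo (D.idx z) y)))
      (D.homeo (D.idx z)).source :=
    (D.smooth_π (D.idx z)).continuousOn.comp (D.homeo (D.idx z)).continuousOn
      (D.homeo (D.idx z)).mapsTo
  have h2 : ContinuousOn D.π (D.homeo (D.idx z)).source :=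
    h1.congr fun y hy => congrArg D.π ((D.homeo (D.idx z)).left_inv hy).symm
  exact h2.continuousAt ((D.homeo (D.idx z)).open_source.mem_nhds hz)

/-- Points with different images are separated in `M`. Points with the same image lie in a common
chart domain, since chart domains are preimages of subsets of `M`, and there they are separated in
`B`. -/
theorem t2 : @T2Space Z D.topology := by
  let _ := D.topology
  refine ⟨fun z z' hne => ?_⟩
  by_cases hπ : D.π z = D.π z'
  · obtain ⟨i, hi⟩ := D.separated z z' hne hπ
    have hi' : z' ∈ (D.chart i).source := by
      rw [D.mem_source_iff] at hi ⊢
      rwa [← hπ]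
    obtain ⟨s, t, hs, ht, hzs, hzt, hd⟩ := t2_separation
      (fun h => hne ((D.chart i).injOn hi hi' h) : D.chart i z ≠ D.chart i z')
    refine ⟨_, _, (D.homeo i).isOpen_inter_preimage hs, (D.homeo i).isOpen_inter_preimage ht,
      ⟨hi, hzs⟩, ⟨hi', hzt⟩, ?_⟩
    exact Set.disjoint_left.2 fun y hy hy' => Set.disjoint_left.1 hd hy.2 hy'.2
  · obtain ⟨s, t, hs, ht, hzs, hzt, hd⟩ := t2_separation hπ
    exact ⟨_, _, hs.preimage D.continuous_π, ht.preimage D.continuous_π, hzs, hzt,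
      hd.preimage _⟩

/-- The chart domains are preimages of open sets of `M`, so the Lindelöf property of `M` leaves
countably many of them, each second countable as it embeds in `B`. -/
theorem secondCountable : @SecondCountableTopology Z D.topology := by
  let _ := D.topology
  obtain ⟨T, hT, hU⟩ := TopologicalSpace.isOpen_iUnion_countable (fun i => (D.U i : Set M))
    fun i => (D.U i).2
  have := hT.to_subtype
  have hs : ∀ i : T, SecondCountableTopology (D.homeo i.1).source :=
    fun i => (D.homeo i.1).secondCountableTopology_source
  refine TopologicalSpace.secondCountableTopology_of_countable_cover
    (U := fun i : T => (D.homeo i.1).source) (fun i => (D.homeo i.1).open_source) ?_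
  refine Set.eq_univ_of_forall fun z => ?_
  obtain ⟨i, hi⟩ := D.exists_mem z
  rw [D.mem_source_iff] at hi
  have : D.π z ∈ ⋃ i ∈ T, (D.U i : Set M) := hU ▸ Set.mem_iUnion.2 ⟨i, hi⟩
  simp only [Set.mem_iUnion] at this
  obtain ⟨j, hj, hz⟩ := this
  exact Set.mem_iUnion.2 ⟨⟨j, hj⟩, (D.mem_source_iff j z).2 hz⟩

theorem mem_atlasB {e : @OpenPartialHomeomorph Z B D.topology _}
    (he : e ∈ @atlas B _ Z D.topology D.chartedB) : ∃ i, e = D.homeo i := by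
  obtain ⟨_, ⟨_, rfl⟩, _, ⟨⟨i, rfl⟩, rfl⟩, he⟩ := he
  exact ⟨i, he⟩

/-- An atlas chart is a glueing chart followed by a chart of `B`. A transition map is thus a
transition between glueing charts, smooth by hypothesis, between a chart of `B` and the inverse of
another. -/
theorem isManifold : @IsManifold ℝ _ B.E _ _ B.H _ B.I ∞ Z D.topology D.charted := by
  let _ := D.topology
  let _ := D.chartedB
  let _ := D.charted
  refine isManifold_of_contDiffOn B.I ∞ Z ?_
  rintro _ _ ⟨e, he, c, hc, rfl⟩ ⟨e', he', c', hc', rfl⟩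
  obtain ⟨i, rfl⟩ := D.mem_atlasB he
  obtain ⟨j, rfl⟩ := D.mem_atlasB he'
  rw [← contMDiffOn_iff_contDiffOn]
  have h1 : ContMDiffOn B.I B.I ∞ c c.source :=
    contMDiffOn_of_mem_maximalAtlas (IsManifold.subset_maximalAtlas hc)
  have h2 : ContMDiffOn B.I B.I ∞ c.symm c.target :=
    contMDiffOn_symm_of_mem_maximalAtlas (IsManifold.subset_maximalAtlas hc)
  have h1' : ContMDiffOn B.I B.I ∞ c' c'.source :=
    contMDiffOn_of_mem_maximalAtlas (IsManifold.subset_maximalAtlas hc')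
  have h3 : ContMDiffOn B.I B.I ∞ (c' ∘ (fun b => D.chart j ((D.chart i).symm b)) ∘ c.symm)
      (((D.homeo i).trans c).symm.trans ((D.homeo j).trans c')).source := by
    refine h1'.comp ((D.smooth_transition i j).comp (h2.mono ?_) ?_) ?_
    · rintro x ⟨hx, -⟩
      exact hx.1
    · rintro x ⟨hx, hx'⟩
      refine ⟨hx.2, ?_⟩
      exact (D.mem_source_iff j _).1 hx'.1
    · rintro x ⟨hx, hx'⟩
      exact hx'.2
  refine (B.I.contMDiff (n := ∞)).comp_contMDiffOn (h3.comp
    ((B.I.contMDiffOn_symm (n := ∞)).mono Set.inter_subset_right) ?_)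
  exact Set.inter_subset_left

/-- The manifold presented by the data. -/
noncomputable def mfd : Mfd.{u} :=
  letI := D.topology
  letI := D.charted
  haveI := D.isManifold
  haveI := D.t2
  haveI := D.secondCountable
  { carrier := Z
    E := B.E
    H := B.H
    I := B.I }

/-- The charts, as partial bijections from the manifold. -/
noncomputable def mchart (i : D.ι) : PartialEquiv D.mfd B := D.chart i

theorem isOpen_source (i : D.ι) : IsOpen (D.mchart i).source :=
  @OpenPartialHomeomorph.open_source Z B D.topology _ (D.homeo i)

/-- The preferred charts of the manifold, with values in the model space of `B`. -/
noncomputable def modelChart (z : D.mfd) : OpenPartialHomeomorph D.mfd B.H := chartAt D.mfd.H z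

theorem contMDiffAt_modelChart (z : D.mfd) : ContMDiffAt D.mfd.I B.I ∞ (D.modelChart z) z :=
  contMDiffAt_of_mem_maximalAtlas (I := D.mfd.I) (n := ∞)
    (IsManifold.chart_mem_maximalAtlas z) (mem_chart_source _ z)

theorem contMDiffAt_modelChart_symm (z : D.mfd) :
    ContMDiffAt B.I D.mfd.I ∞ (D.modelChart z).symm (D.modelChart z z) :=
  contMDiffAt_symm_of_mem_maximalAtlas (I := D.mfd.I) (n := ∞)
    (IsManifold.chart_mem_maximalAtlas z) (mem_chart_target _ z)

/-- The projection to `M` as a function on the manifold. -/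
def proj (z : D.mfd) : M := D.π z

/-- For the index selected at the point, the glueing chart is locally the preferred chart followed
by the inverse of a chart of `B`. Any other glueing chart differs from this one by a smooth
transition. -/
theorem smooth_chart (i : D.ι) :
    ContMDiffOn D.mfd.I B.I ∞ (D.mchart i) (D.mchart i).source := by
  intro z hz
  set j := D.idx z
  have hc : ContMDiffAt D.mfd.I B.I ∞ (D.modelChart z) z := D.contMDiffAt_modelChart z
  have hcs : ContMDiffOn B.I B.I ∞ (chartAt B.H (D.mchart j z)).symm
    (chartAt B.H (D.mchart j z)).target := contMDiffOn_chart_symm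
  have hzj : z ∈ (D.mchart j).source := D.mem_idx z
  have ht : chartAt B.H (D.mchart j z) (D.mchart j z) ∈ (chartAt B.H (D.mchart j z)).target :=
    mem_chart_target _ _
  have h1 : ContMDiffAt D.mfd.I B.I ∞
      ((chartAt B.H (D.mchart j z)).symm ∘ D.modelChart z) z :=
    ContMDiffAt.comp (I' := B.I) z
      (hcs.contMDiffAt ((chartAt B.H (D.mchart j z)).open_target.mem_nhds ht)) hc
  have hnear : ∀ᶠ y in nhds z, y ∈ (D.modelChart z).source :=
    (D.modelChart z).open_source.mem_nhds (mem_chart_source D.mfd.H z)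
  have h2 : ContMDiffAt D.mfd.I B.I ∞ (fun y : D.mfd => D.mchart j y) z := by
    refine h1.congr_of_eventuallyEq ?_
    filter_upwards [hnear] with y hy
    exact ((chartAt B.H (D.mchart j z)).left_inv hy.2).symm
  have h3 := (D.smooth_transition j i).contMDiffAt
    (x := D.mchart j z) ((D.trans_source j i ▸ D.core.open_source _ _ ⟨j, rfl⟩ ⟨i, rfl⟩).mem_nhds
    ⟨(D.mchart j).map_source hzj, by
      change D.proj ((D.mchart j).symm (D.mchart j z)) ∈ D.U i
      rw [(D.mchart j).left_inv hzj]
      exact (D.mem_source_iff i z).1 hz⟩)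
  have h4 := h3.comp z h2
  refine (h4.congr_of_eventuallyEq ?_).contMDiffWithinAt
  filter_upwards [hnear] with y hy
  have hy1 : y ∈ (D.mchart j).source := hy.1
  exact congrArg (D.mchart i) ((D.mchart j).left_inv hy1).symm

theorem smooth_chart_symm (i : D.ι) :
    ContMDiffOn B.I D.mfd.I ∞ (D.mchart i).symm (D.mchart i).target := by
  intro b hb
  set z : D.mfd := (D.mchart i).symm b
  set j := D.idx z
  have hzj : z ∈ (D.mchart j).source := D.mem_idx z
  have hcs : ContMDiffAt B.I D.mfd.I ∞ (D.modelChart z).symm (D.modelChart z z) :=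
    D.contMDiffAt_modelChart_symm z
  have hc : ContMDiffAt B.I B.I ∞ (chartAt B.H (D.mchart j z)) (D.mchart j z) :=
    contMDiffAt_of_mem_maximalAtlas
    (IsManifold.chart_mem_maximalAtlas _) (mem_chart_source _ _)
  have hopen := D.trans_source i j ▸ D.core.open_source _ _ ⟨i, rfl⟩ ⟨j, rfl⟩
  have hbj : b ∈ (D.mchart i).target ∩ (fun b => D.proj ((D.mchart i).symm b)) ⁻¹' D.U j :=
    ⟨hb, (D.mem_source_iff j z).1 hzj⟩
  have h3 := (D.smooth_transition i j).contMDiffAt (x := b) (hopen.mem_nhds hbj)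
  have h4 : ContMDiffAt B.I D.mfd.I ∞ ((D.modelChart z).symm ∘ (chartAt B.H (D.mchart j z)) ∘
      (fun b => D.mchart j ((D.mchart i).symm b))) b :=
    ContMDiffAt.comp (I' := B.I) b hcs (ContMDiffAt.comp (I' := B.I) b hc h3)
  refine (h4.congr_of_eventuallyEq ?_).contMDiffWithinAt
  have hsrc : ∀ᶠ b' in nhds b, D.mchart j ((D.mchart i).symm b') ∈
      (chartAt B.H (D.mchart j z)).source :=
    h3.continuousAt.eventually_mem ((chartAt B.H (D.mchart j z)).open_source.mem_nhds
      (mem_chart_source _ _))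
  filter_upwards [hopen.mem_nhds hbj, hsrc] with b' hb' hs
  change _ = (D.mchart j).symm ((chartAt B.H (D.mchart j z)).symm
    (chartAt B.H (D.mchart j z) (D.mchart j ((D.mchart i).symm b'))))
  rw [(chartAt B.H (D.mchart j z)).left_inv hs, (D.mchart j).left_inv]
  exact (D.mem_source_iff j _).2 hb'.2

theorem contMDiff_π : ContMDiff D.mfd.I M.I ∞ D.proj := by
  intro z
  have hz := D.mem_idx z
  have h1 : ContMDiffOn D.mfd.I M.I ∞
      (fun y : D.mfd => D.proj ((D.mchart (D.idx z)).symm (D.mchart (D.idx z) y)))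
      (D.mchart (D.idx z)).source :=
    (D.smooth_π (D.idx z)).comp (D.smooth_chart (D.idx z)) (D.mchart (D.idx z)).mapsTo
  exact (h1.congr fun y hy => by rw [(D.mchart (D.idx z)).left_inv hy]).contMDiffAt
    ((D.isOpen_source (D.idx z)).mem_nhds hz)

/-- Smoothness of a map into the glued manifold can be checked in the charts. -/
theorem contMDiff_of_charts {T : Mfd.{u}} (h : T → D.mfd) (hc : Continuous fun t => D.proj (h t))
    (hs : ∀ t, ∃ i, h t ∈ (D.mchart i).source ∧
      ContMDiffAt T.I B.I ∞ (fun t => D.mchart i (h t)) t) : ContMDiff T.I D.mfd.I ∞ h := by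
  intro t
  obtain ⟨i, hi, hsm⟩ := hs t
  have h1 := (D.smooth_chart_symm i).contMDiffAt
    ((D.open_target i).mem_nhds ((D.mchart i).map_source hi))
  refine (h1.comp t hsm).congr_of_eventuallyEq ?_
  have : ∀ᶠ t' in nhds t, D.proj (h t') ∈ D.U i :=
    hc.continuousAt.eventually_mem ((D.U i).2.mem_nhds ((D.mem_source_iff i _).1 hi))
  filter_upwards [this] with t' ht'
  exact ((D.mchart i).left_inv ((D.mem_source_iff i _).2 ht')).symm

end GlueData

end Mfd

/-! ## Submersions -/

/-- A smooth map with surjective derivative at a point is, near the point, a projection. -/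
theorem ContDiffOn.exists_straightening {E F K : Type*} [NormedAddCommGroup E] [NormedSpace ℝ E]
    [FiniteDimensional ℝ E] [NormedAddCommGroup F] [NormedSpace ℝ F] [FiniteDimensional ℝ F]
    [NormedAddCommGroup K] [NormedSpace ℝ K] [FiniteDimensional ℝ K]
    {f : E → F} {W : Set E} (hW : IsOpen W) (hf : ContDiffOn ℝ ∞ f W) {a : E} (ha : a ∈ W)
    (hs : Function.Surjective (fderiv ℝ f a))
    (hd : Module.finrank ℝ F + Module.finrank ℝ K = Module.finrank ℝ E) :
    ∃ (p : E →L[ℝ] K) (R : OpenPartialHomeomorph E (F × K)), a ∈ R.source ∧ R.source ⊆ W ∧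
      (∀ v, R v = (f v, p v)) ∧ ContDiffOn ℝ ∞ R.symm R.target := by
  have : CompleteSpace E := FiniteDimensional.complete ℝ E
  set A : E →ₗ[ℝ] F := (fderiv ℝ f a : E →ₗ[ℝ] F) with hA
  have hk : Module.finrank ℝ (LinearMap.ker A) = Module.finrank ℝ K := by
    have h1 := A.finrank_range_add_finrank_ker
    rw [LinearMap.range_eq_top.2 hs, finrank_top] at h1
    omega
  -- A linear retraction onto the kernel of the derivative, identified with `K` by dimension, gives
  -- coordinates complementary to `f`. The derivative of `(f, p)` at `a` is then bijective and the
  -- inverse function theorem applies.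
  obtain ⟨q, hq⟩ := (LinearMap.ker A).subtype.exists_leftInverse_of_injective
    (LinearMap.ker A).ker_subtype
  set p : E →L[ℝ] K := LinearMap.toContinuousLinearMap
    ((LinearEquiv.ofFinrankEq _ _ hk).toLinearMap ∘ₗ q) with hp
  set G : E → F × K := fun v => (f v, p v) with hG
  have hinj : Function.Injective (A.prod (p : E →ₗ[ℝ] K)) := by
    rw [← LinearMap.ker_eq_bot, LinearMap.ker_eq_bot']
    intro v hv
    have h1 : A v = 0 := congrArg Prod.fst hv
    have h2 : p v = 0 := congrArg Prod.snd hv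
    have h3 : q v = 0 := by
      simpa [hp] using h2
    have h4 := DFunLike.congr_fun hq ⟨v, h1⟩
    simp only [LinearMap.comp_apply, Submodule.subtype_apply, LinearMap.id_apply, h3] at h4
    exact (congrArg Subtype.val h4).symm
  have hfin : Module.finrank ℝ E = Module.finrank ℝ (F × K) := by
    rw [Module.finrank_prod, hd]
  set B : E ≃L[ℝ] F × K :=
    ((A.prod (p : E →ₗ[ℝ] K)).linearEquivOfInjective hinj hfin).toContinuousLinearEquiv with hB
  have hGs : ContDiffOn ℝ ∞ G W := hf.prodMk p.contDiff.contDiffOn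
  have hG' : HasFDerivAt G ((fderiv ℝ f a).prod p) a :=
    ((hf.contDiffAt (hW.mem_nhds ha)).differentiableAt (by simp)).hasFDerivAt.prodMk
      p.hasFDerivAt
  have hBG : (B : E →L[ℝ] F × K) = fderiv ℝ G a := by
    rw [hG'.fderiv]
    ext v <;> rfl
  have hstrict : HasStrictFDerivAt G (B : E →L[ℝ] F × K) a := by
    rw [hBG]
    exact (hGs.contDiffAt (hW.mem_nhds ha)).hasStrictFDerivAt (by simp)
  -- Restricting to points where the derivative of `G` is invertible makes the inverse smooth on the
  -- whole target, not only at the image of `a`.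
  set W₁ : Set E := W ∩ fderiv ℝ G ⁻¹' Set.range
    (ContinuousLinearEquiv.toContinuousLinearMap : (E ≃L[ℝ] F × K) → E →L[ℝ] F × K) with hW₁
  have hW₁o : IsOpen W₁ := (hGs.continuousOn_fderiv_of_isOpen hW (by simp)).isOpen_inter_preimage
    hW ContinuousLinearEquiv.isOpen
  set R := (hstrict.toOpenPartialHomeomorph G).restrOpen W₁ hW₁o with hR
  have hRG : ∀ v, R v = G v := fun v => rfl
  refine ⟨p, R, ⟨hstrict.mem_toOpenPartialHomeomorph_source, ha, B, hBG⟩,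
    fun v hv => hv.2.1, fun v => rfl, fun y hy => ?_⟩
  obtain ⟨-, hv, B', hB'⟩ := R.map_target hy
  have hc : ContDiffAt ℝ ∞ G (R.symm y) := hGs.contDiffAt (hW.mem_nhds hv)
  refine (R.contDiffAt_symm (f₀' := B') hy ?_ hc).contDiffWithinAt
  rw [hB']
  exact (hc.differentiableAt (by simp)).hasFDerivAt

namespace Mfd

/-- The first projection of a product. -/
def fst {X Y : Mfd.{u}} : X.prod Y ⟶ X := ⟨fun p => p.1, contMDiff_fst⟩

/-- The second projection of a product. -/
def snd {X Y : Mfd.{u}} : X.prod Y ⟶ Y := ⟨fun p => p.2, contMDiff_snd⟩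

@[simp] theorem fst_apply {X Y : Mfd.{u}} (p : X.prod Y) : (fst : X.prod Y ⟶ X) p = p.1 := rfl

@[simp] theorem snd_apply {X Y : Mfd.{u}} (p : X.prod Y) : (snd : X.prod Y ⟶ Y) p = p.2 := rfl

@[simp] theorem pair_apply {T X Y : Mfd.{u}} (f : T ⟶ X) (g : T ⟶ Y) (t : T) :
    pair f g t = (f t, g t) := rfl

@[simp] theorem prodMap_apply {X Y X' Y' : Mfd.{u}} (f : X ⟶ X') (g : Y ⟶ Y') (p : X.prod Y) :
    prodMap f g p = (f p.1, g p.2) := rfl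

/-- The differential of a smooth map is surjective everywhere. -/
def IsSubmersion {X Y : Mfd.{u}} (f : X ⟶ Y) : Prop :=
  ∀ x : X, Function.Surjective (mfderiv X.I Y.I f x)

/-- Near every point a submersion is isomorphic to a projection `Z × K ⟶ Z`. -/
theorem exists_local_triv {X Z : Mfd.{u}} (f : X ⟶ Z) (x₀ : X)
    (hs : Function.Surjective (mfderiv X.I Z.I f x₀)) (K : Type u) [NormedAddCommGroup K]
    [NormedSpace ℝ K] [FiniteDimensional ℝ K]
    (hd : Module.finrank ℝ Z.E + Module.finrank ℝ K = Module.finrank ℝ X.E) :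
    ∃ (U : TopologicalSpace.Opens X) (V : TopologicalSpace.Opens (Z × K))
      (π : X → K) (s : Z × K → X),
      x₀ ∈ U ∧ ContMDiffOn X.I (modelWithCornersSelf ℝ K) ∞ π U ∧
      ContMDiffOn (Z.I.prod (modelWithCornersSelf ℝ K)) X.I ∞ s V ∧
      (∀ x ∈ U, (f x, π x) ∈ V ∧ s (f x, π x) = x) ∧
      ∀ p ∈ V, s p ∈ U ∧ f (s p) = p.1 ∧ π (s p) = p.2 := by
  set cX := extChartAt X.I x₀ with hcX
  set cZ := extChartAt Z.I (f x₀) with hcZ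
  set g : X.E → Z.E := fun v => cZ (f (cX.symm v)) with hg
  set W : Set X.E := cX.target ∩ (fun v => f (cX.symm v)) ⁻¹' cZ.source with hW
  have hX : ContMDiffOn X.I (modelWithCornersSelf ℝ X.E) ∞ cX cX.source := by
    rw [hcX, extChartAt_source]; exact contMDiffOn_extChartAt
  have hZ : ContMDiffOn Z.I (modelWithCornersSelf ℝ Z.E) ∞ cZ cZ.source := by
    rw [hcZ, extChartAt_source]; exact contMDiffOn_extChartAt
  have hXs : ContMDiffOn (modelWithCornersSelf ℝ X.E) X.I ∞ cX.symm cX.target :=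
    contMDiffOn_extChartAt_symm x₀
  have hfX : ContMDiffOn (modelWithCornersSelf ℝ X.E) Z.I ∞ (fun v => f (cX.symm v)) cX.target :=
    (contMDiff f).comp_contMDiffOn hXs
  have hWo : IsOpen W := hfX.continuousOn.isOpen_inter_preimage (isOpen_extChartAt_target x₀)
    (isOpen_extChartAt_source _)
  have hgs : ContDiffOn ℝ ∞ g W := by
    rw [← contMDiffOn_iff_contDiffOn]
    exact hZ.comp (hfX.mono Set.inter_subset_left) Set.inter_subset_right
  have ha : cX x₀ ∈ W := by
    refine ⟨mem_extChartAt_target x₀, ?_⟩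
    change f (cX.symm (cX x₀)) ∈ cZ.source
    rw [hcX, extChartAt_to_inv]
    exact mem_extChartAt_source (I := Z.I) (f x₀)
  have hs' : Function.Surjective (fderiv ℝ g (cX x₀)) := by
    have h1 := MDifferentiableAt.mfderiv ((contMDiff f).contMDiffAt.mdifferentiableAt
      (x := x₀) (by simp))
    rw [X.I.range_eq_univ, fderivWithin_univ] at h1
    rw [h1] at hs
    exact hs
  obtain ⟨p, R, haR, hRW, hR, hRs⟩ := hgs.exists_straightening (K := K) hWo ha hs' hd
  have hVc : ContinuousOn (fun q : Z × K => (cZ q.1, q.2)) (Prod.fst ⁻¹' cZ.source) :=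
    (hZ.continuousOn.comp continuousOn_fst fun _ h => h).prodMk continuousOn_snd
  have hVo : IsOpen ((Prod.fst ⁻¹' cZ.source : Set (Z × K)) ∩
      (fun q : Z × K => (cZ q.1, q.2)) ⁻¹' R.target) :=
    hVc.isOpen_inter_preimage ((isOpen_extChartAt_source (I := Z.I) (f x₀)).preimage
      continuous_fst) R.open_target
  refine ⟨⟨cX.source ∩ cX ⁻¹' R.source, hX.continuousOn.isOpen_inter_preimage
      (isOpen_extChartAt_source _) R.open_source⟩, ⟨_, hVo⟩, fun x => p (cX x),
      fun q => cX.symm (R.symm (cZ q.1, q.2)),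
      ⟨mem_extChartAt_source (I := X.I) x₀, haR⟩, ?_, ?_, ?_, ?_⟩
  · exact p.contMDiff.comp_contMDiffOn (hX.mono Set.inter_subset_left)
  · refine hXs.comp ((contMDiffOn_iff_contDiffOn.2 hRs).comp
      (I := Z.I.prod (modelWithCornersSelf ℝ K)) (f := fun q : Z × K => (cZ q.1, q.2)) ?_ ?_) ?_
    · have h1 : ContMDiffOn (Z.I.prod (modelWithCornersSelf ℝ K)) (modelWithCornersSelf ℝ Z.E) ∞
          (fun q : Z × K => cZ q.1) (Prod.fst ⁻¹' cZ.source) :=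
        hZ.comp contMDiffOn_fst fun _ h => h
      exact (h1.prodMk_space contMDiffOn_snd).mono Set.inter_subset_left
    · exact Set.inter_subset_right
    · rintro q ⟨-, hq⟩
      exact (hRW (R.map_target hq)).1
  · rintro x ⟨hx, hxR⟩
    have h1 : (cZ (f x), p (cX x)) = R (cX x) := by
      rw [hR, hg]
      simp only [cX.left_inv hx]
    refine ⟨⟨?_, ?_⟩, ?_⟩
    · have := (hRW hxR).2
      simp only [Set.mem_preimage, cX.left_inv hx] at this
      exact this
    · change (cZ (f x), p (cX x)) ∈ R.target
      rw [h1]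
      exact R.map_source hxR
    · change cX.symm (R.symm (cZ (f x), p (cX x))) = x
      rw [h1, R.left_inv hxR, cX.left_inv hx]
  · rintro ⟨z, e⟩ ⟨hz, hq⟩
    have hz' : z ∈ cZ.source := hz
    have hq' : (cZ z, e) ∈ R.target := hq
    have h1 := R.map_target hq'
    have h2 := R.right_inv hq'
    have h3 := cX.right_inv (hRW h1).1
    rw [hR] at h2
    refine ⟨⟨cX.map_target (hRW h1).1, ?_⟩, ?_, ?_⟩
    · change cX (cX.symm (R.symm (cZ z, e))) ∈ R.source
      rw [h3]; exact h1
    · exact cZ.injOn (hRW h1).2 hz' (congrArg Prod.fst h2)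
    · change p (cX (cX.symm (R.symm (cZ z, e)))) = e
      rw [h3]
      exact congrArg Prod.snd h2

/-- There is a smooth local section through every point of the domain. -/
def HasLocalSections {X Y : Mfd.{u}} (f : X ⟶ Y) : Prop :=
  ∀ x : X, ∃ (U : TopologicalSpace.Opens Y) (h : f x ∈ U) (σ : Y.restrict U ⟶ X),
    σ ⟨f x, h⟩ = x ∧ ∀ u, f (σ u) = u.1

/-- A model for the fibres of a submersion. -/
abbrev Fibre (X Z : Mfd.{u}) : Type u :=
  EuclideanSpace ℝ (ULift.{u} (Fin (Module.finrank ℝ X.E - Module.finrank ℝ Z.E)))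

theorem IsSubmersion.finrank_add {X Z : Mfd.{u}} {f : X ⟶ Z} (hf : IsSubmersion f) (x : X) :
    Module.finrank ℝ Z.E + Module.finrank ℝ (Fibre X Z) = Module.finrank ℝ X.E := by
  have : Module.finrank ℝ Z.E ≤ Module.finrank ℝ X.E :=
    LinearMap.finrank_le_finrank_of_surjective
      (f := (show X.E →L[ℝ] Z.E from mfderiv X.I Z.I f x).toLinearMap) (hf x)
  rw [finrank_euclideanSpace, Fintype.card_ulift, Fintype.card_fin]
  omega

/-- In a local trivialisation, freeze the fibre coordinate at its value at `x`. -/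
theorem IsSubmersion.hasLocalSections {X Z : Mfd.{u}} {f : X ⟶ Z} (hf : IsSubmersion f) :
    HasLocalSections f := by
  intro x
  obtain ⟨U, V, π, s, hx, hπ, hs, h1, h2⟩ :=
    exists_local_triv f x (hf x) (Fibre X Z) (hf.finrank_add x)
  have hc : ContMDiff Z.I (Z.I.prod (modelWithCornersSelf ℝ (Fibre X Z))) ∞
      (fun z : Z => (z, π x)) := contMDiff_id.prodMk contMDiff_const
  refine ⟨⟨(fun z : Z => (z, π x)) ⁻¹' V, V.2.preimage hc.continuous⟩, (h1 x hx).1,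
    ofContMDiffOn _ (fun z => s (z, π x)) (hs.comp hc.contMDiffOn fun _ h => h), (h1 x hx).2,
    fun u => (h2 _ u.2).2.1⟩

/-- The chain rule applied to `f ∘ σ = id`. With the converse, submersions can be handled through
their local sections, without derivatives. -/
theorem HasLocalSections.isSubmersion {X Z : Mfd.{u}} {f : X ⟶ Z} (hf : HasLocalSections f) :
    IsSubmersion f := by
  intro x
  obtain ⟨U, h, σ, hσ, hfσ⟩ := hf x
  classical
  -- The section lives on an open submanifold. Precomposing with a map `Z → U` that is the identity
  -- on `U`, with an arbitrary value elsewhere, allows derivatives to be taken on `Z` itself.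
  let r : Z → U := fun z => if hz : z ∈ U then ⟨z, hz⟩ else ⟨f x, h⟩
  have hr : ∀ z (hz : z ∈ U), r z = ⟨z, hz⟩ := fun z hz => dif_pos hz
  have hnear : ∀ᶠ z in nhds (f x), z ∈ U := U.2.mem_nhds h
  have hrs : ContMDiffAt Z.I Z.I ∞ r (f x) := by
    rw [← ContMDiffAt.subtypeVal_comp_iff]
    refine contMDiffAt_id.congr_of_eventuallyEq ?_
    filter_upwards [hnear] with z hz
    simp only [Function.comp, hr z hz, id]
  have hσs : ContMDiff Z.I X.I ∞ (fun u : U => σ u) := σ.smooth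
  have hσr : ContMDiffAt Z.I X.I ∞ (fun z => σ (r z)) (f x) :=
    ContMDiffAt.comp (f x) (hσs (r (f x))) hrs
  have hx : σ (r (f x)) = x := by rw [hr _ h]; exact hσ
  have h1 : MDifferentiableAt X.I Z.I f (σ (r (f x))) :=
    (contMDiff f).contMDiffAt.mdifferentiableAt (by simp)
  have h3 := mfderiv_comp (f x) h1 (hσr.mdifferentiableAt (by simp))
  have h4 : (f ∘ fun z => σ (r z)) =ᶠ[nhds (f x)] id := by
    filter_upwards [hnear] with z hz
    simp only [Function.comp, hr z hz, id]
    exact hfσ ⟨z, hz⟩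
  rw [h4.mfderiv_eq, mfderiv_id] at h3
  intro w
  have h5 : mfderiv X.I Z.I f (σ (r (f x))) (mfderiv Z.I X.I (fun z => σ (r z)) (f x) w) = w :=
    (DFunLike.congr_fun h3 w).symm
  -- The chain rule speaks of the derivative at `σ (r (f x))`. To move it to `x`, tangent vectors
  -- are regarded in the fixed model spaces.
  have key : ∀ y, y = x → (∃ v : X.E, (show X.E →L[ℝ] Z.E from mfderiv X.I Z.I f y) v = w) →
      ∃ v : X.E, (show X.E →L[ℝ] Z.E from mfderiv X.I Z.I f x) v = w := by
    rintro y rfl h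
    exact h
  exact key _ hx ⟨_, h5⟩

/-! ### Fibre products of manifolds along submersions -/

/-- A fibre product of manifolds, described by its points and by smooth families of points. -/
structure IsFibreProduct {P X Y Z : Mfd.{u}} (p : P ⟶ X) (q : P ⟶ Y) (f : X ⟶ Z) (g : Y ⟶ Z) :
    Prop where
  comm : ∀ t, f (p t) = g (q t)
  lift : ∀ {T : Mfd.{u}} (a : T ⟶ X) (b : T ⟶ Y), (∀ t, f (a t) = g (b t)) →
    ∃ c : T ⟶ P, (∀ t, p (c t) = a t) ∧ ∀ t, q (c t) = b t
  ext : ∀ t t', p t = p t' → q t = q t' → t = t'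

theorem IsFibreProduct.isPullback {P X Y Z : Mfd.{u}} {p : P ⟶ X} {q : P ⟶ Y} {f : X ⟶ Z}
    {g : Y ⟶ Z} (h : IsFibreProduct p q f g) : IsPullback p q f g := by
  refine ⟨⟨hom_ext h.comm⟩, ⟨Limits.PullbackCone.IsLimit.mk _
    (fun s => (h.lift s.fst s.snd (DFunLike.congr_fun s.condition)).choose) ?_ ?_ ?_⟩⟩
  · exact fun s => hom_ext
      (h.lift s.fst s.snd (DFunLike.congr_fun s.condition)).choose_spec.1
  · exact fun s => hom_ext
      (h.lift s.fst s.snd (DFunLike.congr_fun s.condition)).choose_spec.2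
  · intro s m h1 h2
    have hs := (h.lift s.fst s.snd (DFunLike.congr_fun s.condition)).choose_spec
    refine hom_ext fun t => h.ext _ _ ?_ ?_
    · exact (DFunLike.congr_fun h1 t).trans (hs.1 t).symm
    · exact (DFunLike.congr_fun h2 t).trans (hs.2 t).symm

/-- Points of a manifold are maps from `point`, so uniqueness in the universal property separates
points. -/
theorem IsFibreProduct.of_isPullback {P X Y Z : Mfd.{u}} {p : P ⟶ X} {q : P ⟶ Y} {f : X ⟶ Z}
    {g : Y ⟶ Z} (h : IsPullback p q f g) : IsFibreProduct p q f g where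
  comm := DFunLike.congr_fun h.w
  lift a b hab := ⟨h.lift a b (hom_ext hab), DFunLike.congr_fun (h.lift_fst _ _ _),
    DFunLike.congr_fun (h.lift_snd _ _ _)⟩
  ext t t' h1 h2 := DFunLike.congr_fun (h.hom_ext (W := point) (k := const _ t)
    (l := const _ t') (hom_ext fun _ => h1) (hom_ext fun _ => h2)) PUnit.unit

theorem IsFibreProduct.exists_point {P X Y Z : Mfd.{u}} {p : P ⟶ X} {q : P ⟶ Y} {f : X ⟶ Z}
    {g : Y ⟶ Z} (h : IsFibreProduct p q f g) {x : X} {y : Y} (hxy : f x = g y) :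
    ∃ t, p t = x ∧ q t = y := by
  obtain ⟨c, h1, h2⟩ := h.lift (T := point) (const _ x) (const _ y) fun _ => hxy
  exact ⟨c PUnit.unit, h1 _, h2 _⟩

/-- A submersion is locally a projection near each point. -/
structure LocalTriv {X Z : Mfd.{u}} (f : X ⟶ Z) where
  U : TopologicalSpace.Opens X
  V : TopologicalSpace.Opens (Z × Fibre X Z)
  π : X → Fibre X Z
  s : Z × Fibre X Z → X
  smooth_π : ContMDiffOn X.I (modelWithCornersSelf ℝ (Fibre X Z)) ∞ π U
  smooth_s : ContMDiffOn (Z.I.prod (modelWithCornersSelf ℝ (Fibre X Z))) X.I ∞ s V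
  mem_V : ∀ x ∈ U, (f x, π x) ∈ V
  s_π : ∀ x ∈ U, s (f x, π x) = x
  mem_U : ∀ p ∈ V, s p ∈ U
  f_s : ∀ p ∈ V, f (s p) = p.1
  π_s : ∀ p ∈ V, π (s p) = p.2

theorem IsSubmersion.exists_localTriv {X Z : Mfd.{u}} {f : X ⟶ Z} (hf : IsSubmersion f) (x : X) :
    ∃ L : LocalTriv f, x ∈ L.U := by
  obtain ⟨U, V, π, s, hx, hπ, hs, h1, h2⟩ :=
    exists_local_triv f x (hf x) (Fibre X Z) (hf.finrank_add x)
  exact ⟨⟨U, V, π, s, hπ, hs, fun x h => (h1 x h).1, fun x h => (h1 x h).2, fun p h => (h2 p h).1,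
    fun p h => (h2 p h).2.1, fun p h => (h2 p h).2.2⟩, hx⟩

open Classical in
/-- The chart of a fibre product determined by a local trivialisation. -/
noncomputable def LocalTriv.fibreChart {X Y Z : Mfd.{u}} {f : X ⟶ Z} (L : LocalTriv f) (g : Y ⟶ Z)
    (z₀ : {p : X × Y // f p.1 = g p.2}) :
    PartialEquiv {p : X × Y // f p.1 = g p.2} (Fibre X Z × Y) where
  toFun z := (L.π z.1.1, z.1.2)
  -- `z₀` is only a default value off the target. Inside it, the local trivialisation recovers the
  -- first component from its image `g b.2` and its fibre coordinate.
  invFun b := if h : (g b.2, b.1) ∈ L.V then ⟨(L.s (g b.2, b.1), b.2), L.f_s _ h⟩ else z₀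
  source := {z | z.1.1 ∈ L.U}
  target := {b | (g b.2, b.1) ∈ L.V}
  map_source' z hz := by
    have := L.mem_V _ hz
    rw [z.2] at this
    exact this
  map_target' b hb := by
    have hb' : (g b.2, b.1) ∈ L.V := hb
    simp only [hb', dif_pos]
    exact L.mem_U _ hb'
  left_inv' z hz := by
    have h1 := L.mem_V _ hz
    have h2 := L.s_π _ hz
    rw [z.2] at h1 h2
    simp only [h1, dif_pos]
    exact Subtype.ext (Prod.ext h2 rfl)
  right_inv' b hb := by
    have hb' : (g b.2, b.1) ∈ L.V := hb
    simp only [hb', dif_pos]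
    exact Prod.ext (L.π_s _ hb') rfl

theorem LocalTriv.fibreChart_symm_val {X Y Z : Mfd.{u}} {f : X ⟶ Z} (L : LocalTriv f) (g : Y ⟶ Z)
    (z₀ : {p : X × Y // f p.1 = g p.2}) (b : Fibre X Z × Y) (h : (g b.2, b.1) ∈ L.V) :
    ((L.fibreChart g z₀).symm b).1 = (L.s (g b.2, b.1), b.2) :=
  congrArg Subtype.val (dif_pos h)

theorem LocalTriv.contMDiffOn_fibreChart_symm {X Y Z : Mfd.{u}} {f : X ⟶ Z} (L : LocalTriv f)
    (g : Y ⟶ Z) (z₀ : {p : X × Y // f p.1 = g p.2}) :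
    ContMDiffOn ((modelWithCornersSelf ℝ (Fibre X Z)).prod Y.I) (X.I.prod Y.I) ∞
      (fun b : Fibre X Z × Y => ((L.fibreChart g z₀).symm b).1) (L.fibreChart g z₀).target := by
  have h1 : ContMDiff ((modelWithCornersSelf ℝ (Fibre X Z)).prod Y.I)
      (Z.I.prod (modelWithCornersSelf ℝ (Fibre X Z))) ∞
      (fun b : Fibre X Z × Y => (g b.2, b.1)) :=
    ((contMDiff g).comp contMDiff_snd).prodMk contMDiff_fst
  refine ((L.smooth_s.comp h1.contMDiffOn fun b hb => hb).prodMk contMDiffOn_snd).congr ?_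
  intro b hb
  exact L.fibreChart_symm_val g z₀ b hb

/-- Charts for the fibre product of a submersion with another map. -/
noncomputable def fibreProductData {X Y Z : Mfd.{u}} {f : X ⟶ Z} (hf : IsSubmersion f)
    (g : Y ⟶ Z) : GlueData ((ofVectorSpace (Fibre X Z)).prod Y) (X.prod Y)
      {p : X × Y // f p.1 = g p.2} where
  ι := {p : X × Y // f p.1 = g p.2}
  chart i := (hf.exists_localTriv i.1.1).choose.fibreChart g i
  π := Subtype.val
  U i := ⟨(Prod.fst : X × Y → X) ⁻¹' (hf.exists_localTriv i.1.1).choose.U,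
    (hf.exists_localTriv i.1.1).choose.U.2.preimage continuous_fst⟩
  source_eq i := rfl
  exists_mem z := ⟨z, (hf.exists_localTriv z.1.1).choose_spec⟩
  open_target i := by
    have h1 : Continuous (fun b : Fibre X Z × Y => (g b.2, b.1)) :=
      ((continuous g).comp continuous_snd).prodMk continuous_fst
    exact (hf.exists_localTriv i.1.1).choose.V.2.preimage h1
  smooth_π i := (hf.exists_localTriv i.1.1).choose.contMDiffOn_fibreChart_symm g i
  smooth_transition i j := by
    have h1 := (hf.exists_localTriv i.1.1).choose.contMDiffOn_fibreChart_symm g i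
    have h2 : ContMDiffOn (X.I.prod Y.I) ((modelWithCornersSelf ℝ (Fibre X Z)).prod Y.I) ∞
        (fun p : X × Y => ((hf.exists_localTriv j.1.1).choose.π p.1, p.2))
        ((Prod.fst : X × Y → X) ⁻¹' (hf.exists_localTriv j.1.1).choose.U) :=
      ((hf.exists_localTriv j.1.1).choose.smooth_π.comp contMDiffOn_fst fun _ h => h).prodMk
        contMDiffOn_snd
    exact h2.comp (h1.mono Set.inter_subset_left) Set.inter_subset_right
  -- The projection to `X × Y` is injective, so there is nothing to separate.
  separated z z' h h' := (h (Subtype.ext h')).elim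

/-- The fibre product of a submersion with another smooth map exists. -/
theorem IsSubmersion.exists_fibreProduct {X Y Z : Mfd.{u}} {f : X ⟶ Z} (hf : IsSubmersion f)
    (g : Y ⟶ Z) : ∃ (P : Mfd.{u}) (p : P ⟶ X) (q : P ⟶ Y), IsFibreProduct p q f g := by
  let D := fibreProductData hf g
  refine ⟨D.mfd, homMk D.proj D.contMDiff_π ≫ fst, homMk D.proj D.contMDiff_π ≫ snd,
    ⟨?_, ?_, ?_⟩⟩
  · exact fun z : {p : X × Y // f p.1 = g p.2} => z.2
  · intro T a b hab
    let c : T → D.mfd := fun t => (⟨(a t, b t), hab t⟩ : {p : X × Y // f p.1 = g p.2})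
    refine ⟨homMk c (D.contMDiff_of_charts c ?_ fun t => ?_), fun t => rfl, fun t => rfl⟩
    · exact (continuous a).prodMk (continuous b)
    · obtain ⟨i, hi⟩ := D.exists_mem (c t)
      refine ⟨i, hi, ?_⟩
      have hL := (hf.exists_localTriv i.1.1).choose.smooth_π.contMDiffAt
        ((hf.exists_localTriv i.1.1).choose.U.2.mem_nhds hi)
      exact (hL.comp t (contMDiff a t)).prodMk (contMDiff b t)
  · exact fun z z' h1 h2 => Subtype.ext (Prod.ext h1 h2)

end Mfd

/-! ## Essential equivalences in terms of smooth families of points -/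

namespace Mfd

/-- An open neighbourhood in an open submanifold contains an open submanifold. -/
theorem exists_shrink {Y : Mfd.{u}} (U : TopologicalSpace.Opens Y)
    (W : TopologicalSpace.Opens (Y.restrict U)) (y : Y.restrict U) (hy : y ∈ W) :
    ∃ (U' : TopologicalSpace.Opens Y) (_ : y.1 ∈ U') (j : Y.restrict U' ⟶ Y.restrict U),
      (∀ u, (j u).1 = u.1) ∧ ∀ u, j u ∈ W := by
  have ho : IsOpen ((Subtype.val : U → Y) '' (W.1 : Set U)) :=
    U.2.isOpenMap_subtype_val _ W.2
  have hm : ∀ u : Y.restrict ⟨_, ho⟩, u.1 ∈ U := by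
    rintro ⟨_, u, -, rfl⟩
    exact u.2
  refine ⟨⟨_, ho⟩, ⟨y, hy, rfl⟩, corestrict U (incl _) hm, fun u => rfl, ?_⟩
  rintro ⟨_, u, hu, rfl⟩
  exact hu

theorem continuous_preimage_isOpen {X Y : Mfd.{u}} (f : X ⟶ Y) (U : TopologicalSpace.Opens Y) :
    IsOpen (f ⁻¹' (U : Set Y)) := U.2.preimage (continuous f)

theorem IsSubmersion.prodMap {X Y X' Y' : Mfd.{u}} {f : X ⟶ X'} {g : Y ⟶ Y'}
    (hf : IsSubmersion f) (hg : IsSubmersion g) : IsSubmersion (prodMap f g) := by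
  refine HasLocalSections.isSubmersion fun p => ?_
  obtain ⟨U, hU, σ, hσ, hfσ⟩ := hf.hasLocalSections p.1
  obtain ⟨V, hV, τ, hτ, hgτ⟩ := hg.hasLocalSections p.2
  let W : TopologicalSpace.Opens (X'.prod Y') := ⟨(U : Set X') ×ˢ (V : Set Y'), U.2.prod V.2⟩
  refine ⟨W, ⟨hU, hV⟩, pair (corestrict U (incl W ≫ fst) (fun w => w.2.1) ≫ σ)
    (corestrict V (incl W ≫ snd) (fun w => w.2.2) ≫ τ), Prod.ext hσ hτ, fun w => ?_⟩
  exact Prod.ext (hfσ _) (hgτ _)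

end Mfd

namespace LieGpd

open Mfd

/-- The composite of two smooth families of arrows. -/
def mulHom (G : LieGpd.{u}) {T : Mfd.{u}} (a b : T ⟶ G.arr) (h : ∀ t, G.src (a t) = G.tgt (b t)) :
    T ⟶ G.arr := homMk (fun t => G.comp (a t) (b t) (h t)) (G.smooth_comp T a b h)

@[simp] theorem mulHom_apply (G : LieGpd.{u}) {T : Mfd.{u}} (a b : T ⟶ G.arr)
    (h : ∀ t, G.src (a t) = G.tgt (b t)) (t : T) :
    G.mulHom a b h t = G.comp (a t) (b t) (h t) := rfl

theorem eq_of_comp_eq {G : LieGpd.{u}} {a b c : G.arr} (h : G.src a = G.tgt b)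
    (h' : G.src c = G.tgt b) (e : G.comp a b h = G.comp c b h') : a = c := by
  have h1 : G.comp (G.comp a b h) (G.inv b) (by simp) = G.comp (G.comp c b h') (G.inv b)
    (by simp) := G.comp_congr e rfl _
  rw [G.comp_assoc _ _ _ h (by simp), G.comp_assoc _ _ _ h' (by simp),
    G.comp_congr rfl (G.comp_inv b), G.comp_congr rfl (G.comp_inv b), comp_unit', comp_unit'] at h1
  exact h1

theorem comp_inv_cancel {G : LieGpd.{u}} (a b : G.arr) (h : G.src a = G.tgt (G.inv b))
    (h' : G.src (G.comp a (G.inv b) h) = G.tgt b) : G.comp (G.comp a (G.inv b) h) b h' = a := by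
  rw [G.comp_assoc _ _ _ h (by simp), G.comp_congr rfl (G.inv_comp b), comp_unit']

theorem inv_inv (G : LieGpd.{u}) (a : G.arr) : G.inv (G.inv a) = a := by
  have h1 : G.comp (G.inv (G.inv a)) (G.inv a) (by simp) = G.comp a (G.inv a) (by simp) := by
    rw [G.inv_comp, G.comp_inv, G.src_inv]
  exact eq_of_comp_eq _ _ h1

theorem arr_inv {G H : LieGpd.{u}} (φ : G ⟶ H) (a : G.arr) :
    Hom.arr φ (G.inv a) = H.inv (Hom.arr φ a) := by
  have h1 : H.comp (Hom.arr φ (G.inv a)) (Hom.arr φ a) (by simp) =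
      H.comp (H.inv (Hom.arr φ a)) (Hom.arr φ a) (by simp) := by
    rw [← Hom.arr_comp φ _ _ (by simp), G.inv_comp, H.inv_comp, Hom.arr_unit, Hom.src_arr]
  exact eq_of_comp_eq _ _ h1

theorem isSubmersion_src (G : LieGpd.{u}) : IsSubmersion G.src := G.src_submersion.2

/-- The target is the source after inversion, so local sections of the source, inverted, are local
sections of the target. -/
theorem isSubmersion_tgt (G : LieGpd.{u}) : IsSubmersion G.tgt := by
  refine HasLocalSections.isSubmersion fun a => ?_
  obtain ⟨U, hU, σ, hσ, hs⟩ := G.isSubmersion_src.hasLocalSections (G.inv a)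
  have hU' : G.tgt a ∈ U := by rw [← G.src_inv]; exact hU
  refine ⟨U, hU', σ ≫ G.inv, ?_, fun u => ?_⟩
  · have : (⟨G.tgt a, hU'⟩ : U) = ⟨G.src (G.inv a), hU⟩ := Subtype.ext (G.src_inv a).symm
    change G.inv (σ (⟨G.tgt a, hU'⟩ : U)) = a
    rw [this, hσ, inv_inv]
  · exact (G.tgt_inv _).trans (hs u)

/-- A homomorphism which is fully faithful, essentially surjective on points, and for which
the essential surjectivity can be solved smoothly near each solution. -/
structure IsLocEquiv {G H : LieGpd.{u}} (φ : G ⟶ H) : Prop where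
  lift : ∀ {T : Mfd.{u}} (x x' : T ⟶ G.obj) (h : T ⟶ H.arr),
    (∀ t, H.src (h t) = Hom.obj φ (x t)) → (∀ t, H.tgt (h t) = Hom.obj φ (x' t)) →
    ∃ k : T ⟶ G.arr, (∀ t, Hom.arr φ (k t) = h t) ∧ (∀ t, G.src (k t) = x t) ∧
      ∀ t, G.tgt (k t) = x' t
  faithful : ∀ k k' : G.arr, Hom.arr φ k = Hom.arr φ k' → G.src k = G.src k' → G.tgt k = G.tgt k' →
    k = k'
  surj : ∀ y : H.obj, ∃ (x : G.obj) (h : H.arr), H.src h = Hom.obj φ x ∧ H.tgt h = y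
  sec : ∀ (x : G.obj) (h : H.arr), H.src h = Hom.obj φ x → ∀ y₀, H.tgt h = y₀ →
    ∃ (U : TopologicalSpace.Opens H.obj) (hU : y₀ ∈ U) (σ : H.obj.restrict U ⟶ G.obj)
      (η : H.obj.restrict U ⟶ H.arr), (∀ u, H.src (η u) = Hom.obj φ (σ u)) ∧
      (∀ u, H.tgt (η u) = u.1) ∧ σ ⟨y₀, hU⟩ = x ∧ η ⟨y₀, hU⟩ = h

/-- `sec` is a local section of the surjective submersion in `essSurj`, split into its two
components. Together with the converse, this replaces pullback diagrams by conditions on smooth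
families, for which the closure properties are direct. -/
theorem IsEssEquiv.isLocEquiv {G H : LieGpd.{u}} {φ : G ⟶ H} (h : IsEssEquiv φ) :
    IsLocEquiv φ := by
  have hF := IsFibreProduct.of_isPullback h.fullyFaithful
  obtain ⟨P, p, q, hP, hs, hsub⟩ := h.essSurj
  have hP := IsFibreProduct.of_isPullback hP
  have hL := IsSubmersion.hasLocalSections (f := q ≫ H.tgt) hsub
  refine ⟨?_, ?_, ?_, ?_⟩
  · intro T x x' h h1 h2
    obtain ⟨c, hc1, hc2⟩ := hF.lift h (pair x x') fun t => Prod.ext (h1 t) (h2 t)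
    exact ⟨c, hc1, fun t => congrArg Prod.fst (hc2 t), fun t => congrArg Prod.snd (hc2 t)⟩
  · intro k k' h1 h2 h3
    exact hF.ext k k' h1 (Prod.ext h2 h3)
  · intro y
    obtain ⟨t, ht⟩ := hs y
    exact ⟨p t, q t, (hP.comm t).symm, ht⟩
  · rintro x h hx _ rfl
    obtain ⟨t, rfl, rfl⟩ := hP.exists_point hx.symm
    obtain ⟨U, hU, σ, hσ, hu⟩ := hL t
    refine ⟨U, hU, σ ≫ p, σ ≫ q, fun u => (hP.comm _).symm, hu, congrArg p hσ, congrArg q hσ⟩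

/-- The manifold required by `essSurj` exists because the source map is a submersion. Its map to
`H₀` is a submersion because `sec` supplies local sections through every point. -/
theorem IsLocEquiv.isEssEquiv {G H : LieGpd.{u}} {φ : G ⟶ H} (h : IsLocEquiv φ) :
    IsEssEquiv φ := by
  refine ⟨?_, IsFibreProduct.isPullback ⟨?_, ?_, ?_⟩⟩
  · obtain ⟨P, q, p, hP⟩ := H.isSubmersion_src.exists_fibreProduct (Hom.obj φ)
    refine ⟨P, p, q, hP.isPullback.flip, fun y => ?_, ?_⟩
    · obtain ⟨x, a, h1, h2⟩ := h.surj y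
      obtain ⟨t, h3, h4⟩ := hP.exists_point h1
      exact ⟨t, (congrArg H.tgt h3).trans h2⟩
    · refine HasLocalSections.isSubmersion fun t => ?_
      obtain ⟨U, hU, σ, η, h1, h2, h3, h4⟩ := h.sec (p t) (q t) (hP.comm t) _ rfl
      obtain ⟨c, hc1, hc2⟩ := hP.lift η σ h1
      refine ⟨U, hU, c, ?_, fun u => ?_⟩
      · exact hP.ext _ _ ((hc1 _).trans h4) ((hc2 _).trans h3)
      · exact (congrArg H.tgt (hc1 u)).trans (h2 u)
  · exact fun k => Prod.ext (Hom.src_arr φ k) (Hom.tgt_arr φ k)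
  · intro T a b hab
    obtain ⟨k, h1, h2, h3⟩ := h.lift (b ≫ fst) (b ≫ snd) a (fun t => congrArg Prod.fst (hab t))
      (fun t => congrArg Prod.snd (hab t))
    exact ⟨k, h1, fun t => Prod.ext (h2 t) (h3 t)⟩
  · exact fun k k' h1 h2 => h.faithful k k' h1 (congrArg Prod.fst h2) (congrArg Prod.snd h2)

theorem exists_tgt_section (G : LieGpd.{u}) (a : G.arr) (y : G.obj) (ha : G.tgt a = y) :
    ∃ (U : TopologicalSpace.Opens G.obj) (hU : y ∈ U) (η : G.obj.restrict U ⟶ G.arr),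
      η ⟨y, hU⟩ = a ∧ ∀ u, G.tgt (η u) = u.1 := by
  subst ha
  exact G.isSubmersion_tgt.hasLocalSections a

theorem IsLocEquiv.id (G : LieGpd.{u}) : IsLocEquiv (𝟙 G) where
  lift _ _ h h1 h2 := ⟨h, fun _ => rfl, h1, h2⟩
  faithful _ _ h _ _ := h
  surj y := ⟨y, G.unit y, G.src_unit y, G.tgt_unit y⟩
  sec x h hx y₀ hy := by
    obtain ⟨U, hU, η, h1, h2⟩ := G.exists_tgt_section h y₀ hy
    exact ⟨U, hU, η ≫ G.src, η, fun _ => rfl, h2, (congrArg G.src h1).trans hx, h1⟩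

theorem IsLocEquiv.comp {G H K : LieGpd.{u}} {φ : G ⟶ H} {ψ : H ⟶ K} (hφ : IsLocEquiv φ)
    (hψ : IsLocEquiv ψ) : IsLocEquiv (φ ≫ ψ) where
  lift x x' k h1 h2 := by
    obtain ⟨h, h3, h4, h5⟩ := hψ.lift (x ≫ Hom.obj φ) (x' ≫ Hom.obj φ) k h1 h2
    obtain ⟨g, h6, h7, h8⟩ := hφ.lift x x' h h4 h5
    exact ⟨g, fun t => (congrArg (Hom.arr ψ) (h6 t)).trans (h3 t), h7, h8⟩
  faithful k k' h1 h2 h3 := by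
    refine hφ.faithful k k' (hψ.faithful _ _ h1 ?_ ?_) h2 h3
    · rw [Hom.src_arr, Hom.src_arr, h2]
    · rw [Hom.tgt_arr, Hom.tgt_arr, h3]
  surj z := by
    obtain ⟨y, k, h1, h2⟩ := hψ.surj z
    obtain ⟨x, h, h3, h4⟩ := hφ.surj y
    have h5 : K.src k = K.tgt (Hom.arr ψ h) := by rw [h1, Hom.tgt_arr, h4]
    refine ⟨x, K.comp k (Hom.arr ψ h) h5, ?_, by rw [K.tgt_comp, h2]⟩
    rw [K.src_comp, Hom.src_arr, h3]
    rfl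
  sec x k hk z₀ hz := by
    obtain ⟨U, hU, σ, η, h1, h2, h3, h4⟩ := hψ.sec (Hom.obj φ x) k hk z₀ hz
    -- The local solution for `φ` is taken through a unit, so that multiplying its image by the
    -- solution for `ψ` gives exactly `k` at the base point.
    obtain ⟨V, hV, σ', η', h1', h2', h3', h4'⟩ := hφ.sec x (H.unit (Hom.obj φ x)) (H.src_unit _)
      (Hom.obj φ x) (H.tgt_unit _)
    obtain ⟨U', hU', j, hj, hjV⟩ := exists_shrink U ⟨_, continuous_preimage_isOpen σ V⟩ ⟨z₀, hU⟩
      (by change σ ⟨z₀, hU⟩ ∈ V; rw [h3]; exact hV)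
    let s : K.obj.restrict U' ⟶ H.obj.restrict V := corestrict V (j ≫ σ) hjV
    have hj0 : j ⟨z₀, hU'⟩ = ⟨z₀, hU⟩ := Subtype.ext (hj _)
    have hs0 : s ⟨z₀, hU'⟩ = ⟨Hom.obj φ x, hV⟩ := Subtype.ext ((congrArg σ hj0).trans h3)
    have hc : ∀ u, K.src ((j ≫ η) u) = K.tgt ((s ≫ η' ≫ Hom.arr ψ) u) := by
      intro u
      simp only [comp_apply, Hom.tgt_arr, h1, h2']
      rfl
    refine ⟨U', hU', s ≫ σ', K.mulHom (j ≫ η) (s ≫ η' ≫ Hom.arr ψ) hc, fun u => ?_, fun u => ?_,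
      ?_, ?_⟩
    · simp only [mulHom_apply, K.src_comp, comp_apply, Hom.src_arr, h1']
      rfl
    · simp only [mulHom_apply, K.tgt_comp, comp_apply, h2, hj]
    · exact (congrArg σ' hs0).trans h3'
    · refine (K.comp_congr (g' := k) (f' := K.unit (Hom.obj ψ (Hom.obj φ x)))
        ((congrArg η hj0).trans h4) ?_ _).trans (comp_unit' _ _ _ _)
      exact (congrArg (fun v => Hom.arr ψ (η' v)) hs0).trans
        ((congrArg (Hom.arr ψ) h4').trans (Hom.arr_unit ψ _))

/-- The inverse of a 2-cell. -/
def TwoCell.symm {G H : LieGpd.{u}} {φ ψ : G ⟶ H} (α : TwoCell φ ψ) : TwoCell ψ φ where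
  app := α.app ≫ H.inv
  src_app x := (H.src_inv _).trans (α.tgt_app x)
  tgt_app x := (H.tgt_inv _).trans (α.src_app x)
  natural g := by
    simp only [comp_apply]
    refine eq_of_comp_eq (b := α.app (G.src g)) (by simp) (by simp) ?_
    rw [H.comp_assoc _ _ _ (by simp) (by simp), H.comp_congr rfl (H.inv_comp _), comp_unit',
      H.comp_assoc _ _ _ (by simp) (by simp), H.comp_congr rfl (α.natural g),
      ← H.comp_assoc _ _ _ (by simp) (by simp), H.comp_congr (H.inv_comp _) rfl, unit_comp']

theorem TwoCell.vcomp_symm {G H : LieGpd.{u}} {φ ψ : G ⟶ H} (α : TwoCell φ ψ) :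
    α.vcomp α.symm = TwoCell.refl φ :=
  TwoCell.ext_app fun x => (H.inv_comp _).trans (congrArg H.unit (α.src_app x))

theorem TwoCell.symm_vcomp {G H : LieGpd.{u}} {φ ψ : G ⟶ H} (α : TwoCell φ ψ) :
    α.symm.vcomp α = TwoCell.refl ψ :=
  TwoCell.ext_app fun x => (H.comp_inv _).trans (congrArg H.unit (α.tgt_app x))

/-- Every 2-cell of Lie groupoids is invertible. -/
def TwoCell.iso {G H : LieGpd.{u}} {φ ψ : G ⟶ H} (α : φ ⟶ ψ) : φ ≅ ψ where
  hom := α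
  inv := TwoCell.symm α
  hom_inv_id := TwoCell.vcomp_symm α
  inv_hom_id := TwoCell.symm_vcomp α

end LieGpd

/-! ## Closure properties of essential equivalences and weak fibre products -/

namespace LieGpd

open Mfd

theorem eq_of_comp_eq_left {G : LieGpd.{u}} {a b c : G.arr} (h : G.src a = G.tgt b)
    (h' : G.src a = G.tgt c) (e : G.comp a b h = G.comp a c h') : b = c := by
  have h1 : G.comp (G.inv a) (G.comp a b h) (by simp) = G.comp (G.inv a) (G.comp a c h')
    (by simp) := G.comp_congr rfl e _
  rw [← G.comp_assoc _ _ _ (by simp) h, ← G.comp_assoc _ _ _ (by simp) h',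
    G.comp_congr (G.inv_comp a) rfl, G.comp_congr (G.inv_comp a) rfl, unit_comp', unit_comp'] at h1
  exact h1

theorem comp_inv_comp_cancel {G : LieGpd.{u}} (a b : G.arr) (h : G.src (G.inv a) = G.tgt b)
    (h' : G.src a = G.tgt (G.comp (G.inv a) b h)) : G.comp a (G.comp (G.inv a) b h) h' = b := by
  rw [← G.comp_assoc _ _ _ (by simp) h, G.comp_congr (G.comp_inv a) rfl, unit_comp']

theorem comp_comp_inv_cancel {G : LieGpd.{u}} (a b : G.arr) (h : G.src a = G.tgt b)
    (h' : G.src (G.comp a b h) = G.tgt (G.inv b)) : G.comp (G.comp a b h) (G.inv b) h' = a := by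
  rw [G.comp_assoc _ _ _ h (by simp), G.comp_congr rfl (G.comp_inv b), comp_unit']

/-- Every problem for `ψ` becomes one for `φ` on composing with the components of `α` or their
inverses, which vary smoothly. -/
theorem IsLocEquiv.of_twoCell {G H : LieGpd.{u}} {φ ψ : G ⟶ H} (hφ : IsLocEquiv φ)
    (α : TwoCell φ ψ) : IsLocEquiv ψ where
  lift x x' h h1 h2 := by
    obtain ⟨k, h3, h4, h5⟩ := hφ.lift x x' (H.mulHom (x' ≫ α.app ≫ H.inv)
      (H.mulHom h (x ≫ α.app) (fun t => by simp [h1])) (fun t => by simp [h2]))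
      (fun t => by simp) (fun t => by simp)
    refine ⟨k, fun t => ?_, h4, h5⟩
    refine eq_of_comp_eq (b := α.app (x t)) (by simp [h4]) (by simp [h1]) ?_
    have h6 := α.natural (k t)
    rw [H.comp_congr rfl (congrArg α.app (h4 t)), H.comp_congr (congrArg α.app (h5 t)) (h3 t)] at h6
    rw [h6]
    exact comp_inv_comp_cancel _ _ _ _
  faithful k k' h1 h2 h3 := by
    refine hφ.faithful k k' ?_ h2 h3
    have h4 := α.natural k
    have h5 := α.natural k'
    rw [H.comp_congr h1 (congrArg α.app h2), h5] at h4
    refine (eq_of_comp_eq_left (a := α.app (G.tgt k')) _ ?_ (h4.trans ?_)).symm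
    · simp [h3]
    · exact H.comp_congr (congrArg α.app h3) rfl _
  surj y := by
    obtain ⟨x, h, h1, h2⟩ := hφ.surj y
    exact ⟨x, H.comp h (H.inv (α.app x)) (by simp [h1]), by simp, by simp [h2]⟩
  sec x h hx y₀ hy := by
    obtain ⟨U, hU, σ, η, h1, h2, h3, h4⟩ := hφ.sec x (H.comp h (α.app x) (by simp [hx]))
      (by simp) y₀ (by simp [hy])
    refine ⟨U, hU, σ, H.mulHom η (σ ≫ α.app ≫ H.inv) (fun u => by simp [h1]),
      fun u => by simp, fun u => by simp [h2], h3, ?_⟩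
    exact (H.comp_congr h4 (congrArg (fun z => H.inv (α.app z)) h3) _).trans
      (comp_comp_inv_cancel _ _ _ _)

/-- An essential equivalence is fully faithful on 2-cells. -/
theorem IsLocEquiv.exists_twoCell {T G H : LieGpd.{u}} {w : G ⟶ H} (hw : IsLocEquiv w)
    {f g : T ⟶ G} (α : f ≫ w ⟶ g ≫ w) : ∃ η : f ⟶ g, η ▷ w = α := by
  -- The components of `α` are lifted as one smooth family parametrised by the objects of `T`.
  -- Naturality of the lift then follows from faithfulness.
  obtain ⟨k, h1, h2, h3⟩ := hw.lift (Hom.obj f) (Hom.obj g) (TwoCell.app α)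
    (TwoCell.src_app α) (TwoCell.tgt_app α)
  refine ⟨({ app := k, src_app := h2, tgt_app := h3, natural := fun a => ?_ } : TwoCell f g),
    TwoCell.ext_app h1⟩
  refine hw.faithful _ _ ?_ (by simp [h2]) (by simp [h3])
  rw [Hom.arr_comp, Hom.arr_comp, H.comp_congr rfl (h1 _), H.comp_congr (h1 _) rfl]
  exact TwoCell.natural α a

section WeakFibreProduct

variable {H K G P : LieGpd.{u}} {φ : H ⟶ G} {ψ : K ⟶ G} {ξ : P ⟶ H} {ζ : P ⟶ K}
  {θ : ξ ≫ φ ⟶ ζ ≫ ψ}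

theorem IsWeakFibreProduct.exists_family (h : IsWeakFibreProduct θ) {T : Mfd.{u}} (y : T ⟶ H.obj)
    (g : T ⟶ G.arr) (z : T ⟶ K.obj) (hs : ∀ t, G.src (g t) = Hom.obj φ (y t))
    (ht : ∀ t, G.tgt (g t) = Hom.obj ψ (z t)) : ∃ c : T ⟶ P.obj, (∀ t, Hom.obj ξ (c t) = y t) ∧
      (∀ t, TwoCell.app θ (c t) = g t) ∧ ∀ t, Hom.obj ζ (c t) = z t := by
  obtain ⟨c, ⟨h1, h2, h3⟩, -⟩ := h.obj T y g z (hom_ext hs) (hom_ext ht)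
  exact ⟨c, DFunLike.congr_fun h1, DFunLike.congr_fun h2, DFunLike.congr_fun h3⟩

theorem IsWeakFibreProduct.obj_ext (h : IsWeakFibreProduct θ) {c c' : P.obj}
    (h1 : Hom.obj ξ c = Hom.obj ξ c') (h2 : TwoCell.app θ c = TwoCell.app θ c')
    (h3 : Hom.obj ζ c = Hom.obj ζ c') : c = c' := by
  obtain ⟨d, -, hd⟩ := h.obj point (const _ (Hom.obj ξ c)) (const _ (TwoCell.app θ c))
    (const _ (Hom.obj ζ c)) (hom_ext fun _ => TwoCell.src_app θ c)
    (hom_ext fun _ => TwoCell.tgt_app θ c)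
  have e1 := hd (const _ c) ⟨rfl, rfl, rfl⟩
  have e2 := hd (const _ c') ⟨hom_ext fun _ => h1.symm, hom_ext fun _ => h2.symm,
    hom_ext fun _ => h3.symm⟩
  exact DFunLike.congr_fun (e1.trans e2.symm) PUnit.unit

theorem IsWeakFibreProduct.exists_point (h : IsWeakFibreProduct θ) (y : H.obj) (g : G.arr)
    (z : K.obj) (hs : G.src g = Hom.obj φ y) (ht : G.tgt g = Hom.obj ψ z) :
    ∃ c : P.obj, Hom.obj ξ c = y ∧ TwoCell.app θ c = g ∧ Hom.obj ζ c = z := by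
  obtain ⟨c, h1, h2, h3⟩ := h.exists_family (T := point) (const _ y) (const _ g) (const _ z)
    (fun _ => hs) (fun _ => ht)
  exact ⟨c PUnit.unit, h1 _, h2 _, h3 _⟩

theorem IsWeakFibreProduct.arr_ext (h : IsWeakFibreProduct θ) {a a' : P.arr}
    (h1 : P.src a = P.src a') (h2 : P.tgt a = P.tgt a') (h3 : Hom.arr ξ a = Hom.arr ξ a')
    (h4 : Hom.arr ζ a = Hom.arr ζ a') : a = a' := by
  obtain ⟨d, -, hd⟩ := h.arr point (const _ (P.src a)) (const _ (P.tgt a))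
    (const _ (Hom.arr ξ a)) (const _ (Hom.arr ζ a)) (hom_ext fun _ => Hom.src_arr ξ a)
    (hom_ext fun _ => Hom.tgt_arr ξ a) (hom_ext fun _ => Hom.src_arr ζ a)
    (hom_ext fun _ => Hom.tgt_arr ζ a) (fun _ => (TwoCell.natural θ a).symm)
  have e1 := hd (const _ a) ⟨rfl, rfl, rfl, rfl⟩
  have e2 := hd (const _ a') ⟨hom_ext fun _ => h1.symm, hom_ext fun _ => h2.symm,
    hom_ext fun _ => h3.symm, hom_ext fun _ => h4.symm⟩
  exact DFunLike.congr_fun (e1.trans e2.symm) PUnit.unit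

/-- The pullback of an essential equivalence along an arbitrary homomorphism is an essential
equivalence. -/
theorem IsWeakFibreProduct.isLocEquiv (h : IsWeakFibreProduct θ) (hψ : IsLocEquiv ψ) :
    IsLocEquiv ξ where
  lift {T} c c' a h1 h2 := by
    have e1 : ∀ t, G.src ((c' ≫ TwoCell.app θ) t) = G.tgt ((a ≫ Hom.arr φ) t) := fun t =>
      (TwoCell.src_app θ _).trans (((congrArg (Hom.obj φ) (h2 t)).symm).trans
        (Hom.tgt_arr φ _).symm)
    have e2 : ∀ t, G.src (G.mulHom (c' ≫ TwoCell.app θ) (a ≫ Hom.arr φ) e1 t) =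
        G.tgt ((c ≫ TwoCell.app θ ≫ G.inv) t) := fun t =>
      (G.src_comp _ _ _).trans ((Hom.src_arr φ _).trans ((congrArg (Hom.obj φ) (h1 t)).trans
        ((TwoCell.src_app θ _).symm.trans (G.tgt_inv _).symm)))
    -- The image under `ψ` of the missing component in `K` is forced to be `θ(c') φ(a) θ(c)⁻¹`. Full
    -- faithfulness of `ψ` lifts it smoothly.
    obtain ⟨k, h3, h4, h5⟩ := hψ.lift (c ≫ Hom.obj ζ) (c' ≫ Hom.obj ζ)
      (G.mulHom (G.mulHom (c' ≫ TwoCell.app θ) (a ≫ Hom.arr φ) e1) (c ≫ TwoCell.app θ ≫ G.inv) e2)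
      (fun t => (G.src_comp _ _ _).trans ((G.src_inv _).trans (TwoCell.tgt_app θ _)))
      (fun t => (G.tgt_comp _ _ _).trans ((G.tgt_comp _ _ _).trans (TwoCell.tgt_app θ _)))
    obtain ⟨b, ⟨h6, h7, h8, h9⟩, -⟩ := h.arr T c c' a k (hom_ext h1) (hom_ext h2) (hom_ext h4)
      (hom_ext h5) (fun t => by
        rw [G.comp_congr (h3 t) rfl]
        exact (comp_inv_cancel _ _ _ _).symm)
    exact ⟨b, DFunLike.congr_fun h8, DFunLike.congr_fun h6, DFunLike.congr_fun h7⟩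
  faithful a a' h1 h2 h3 := by
    refine h.arr_ext h2 h3 h1 (hψ.faithful _ _ ?_ ?_ ?_)
    · have n1 := TwoCell.natural θ a
      have n2 := TwoCell.natural θ a'
      have n3 := n1.trans ((G.comp_congr (congrArg (TwoCell.app θ) h3) (congrArg (Hom.arr φ) h1 :
        Hom.arr (ξ ≫ φ) a = Hom.arr (ξ ≫ φ) a') _).trans n2.symm)
      refine eq_of_comp_eq (b := TwoCell.app θ (P.src a')) ?_ ?_ (Eq.trans ?_ n3)
      · exact (Hom.src_arr ψ _).trans (((congrArg (Hom.obj ψ) (Hom.src_arr ζ a)).trans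
          (congrArg (fun x => Hom.obj ψ (Hom.obj ζ x)) h2)).trans (TwoCell.tgt_app θ _).symm)
      · exact (Hom.src_arr ψ _).trans ((congrArg (Hom.obj ψ) (Hom.src_arr ζ a')).trans
          (TwoCell.tgt_app θ _).symm)
      · exact G.comp_congr rfl (congrArg (TwoCell.app θ) h2.symm) _
    · rw [Hom.src_arr, Hom.src_arr, h2]
    · rw [Hom.tgt_arr, Hom.tgt_arr, h3]
  surj x := by
    obtain ⟨z, g, h1, h2⟩ := hψ.surj (Hom.obj φ x)
    obtain ⟨c, h3, -, -⟩ := h.exists_point x (G.inv g) z (by simp [h2]) (by simp [h1])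
    exact ⟨c, H.unit x, by simp [h3], by simp⟩
  sec c a hc y₀ hy := by
    obtain ⟨U, hU, η, hη, ht⟩ := H.exists_tgt_section a y₀ hy
    -- The local section `η` of the target of `H` fixes the `H`-component. Its image in `G` is then
    -- reached from `ψ` by a local solution through the inverse of `θ c`, and inverting that
    -- solution gives the middle component of a family of objects of `P`.
    obtain ⟨V, hV, σ', η', h1', h2', h3', h4'⟩ := hψ.sec (Hom.obj ζ c) (G.inv (TwoCell.app θ c))
      ((G.src_inv _).trans (TwoCell.tgt_app θ c)) (Hom.obj φ (Hom.obj ξ c))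
      ((G.tgt_inv _).trans (TwoCell.src_app θ c))
    let v : H.obj.restrict U ⟶ G.obj := η ≫ H.src ≫ Hom.obj φ
    have hv : v ⟨y₀, hU⟩ = Hom.obj φ (Hom.obj ξ c) :=
      congrArg (Hom.obj φ) ((congrArg H.src hη).trans hc)
    obtain ⟨U', hU', j, hj, hjV⟩ := exists_shrink U ⟨_, continuous_preimage_isOpen v V⟩ ⟨y₀, hU⟩
      (by change v ⟨y₀, hU⟩ ∈ V; rw [hv]; exact hV)
    let s : H.obj.restrict U' ⟶ G.obj.restrict V := corestrict V (j ≫ v) hjV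
    have hj0 : j ⟨y₀, hU'⟩ = ⟨y₀, hU⟩ := Subtype.ext (hj _)
    have hs0 : s ⟨y₀, hU'⟩ = ⟨Hom.obj φ (Hom.obj ξ c), hV⟩ :=
      Subtype.ext ((congrArg v hj0).trans hv)
    obtain ⟨d, hd1, hd2, hd3⟩ := h.exists_family (j ≫ η ≫ H.src) (s ≫ η' ≫ G.inv) (s ≫ σ')
      (fun t => (G.src_inv _).trans (h2' _)) (fun t => (G.tgt_inv _).trans (h1' _))
    refine ⟨U', hU', d, j ≫ η, fun t => (hd1 t).symm, fun t => (ht _).trans (hj t), ?_,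
      (congrArg η hj0).trans hη⟩
    refine h.obj_ext ?_ ?_ ?_
    · exact (hd1 _).trans ((congrArg (fun x => H.src (η x)) hj0).trans
        ((congrArg H.src hη).trans hc))
    · exact (hd2 _).trans ((congrArg (fun x => G.inv (η' x)) hs0).trans
        ((congrArg G.inv h4').trans (inv_inv _ _)))
    · exact (hd3 _).trans ((congrArg σ' hs0).trans h3')

end WeakFibreProduct

/-- The manifold of objects of a weak fibre product. -/
structure WeakFibreObj {H K G : LieGpd.{u}} (φ : H ⟶ G) (ψ : K ⟶ G) where
  P : Mfd.{u}
  y : P ⟶ H.obj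
  g : P ⟶ G.arr
  z : P ⟶ K.obj
  src_g : ∀ c, G.src (g c) = Hom.obj φ (y c)
  tgt_g : ∀ c, G.tgt (g c) = Hom.obj ψ (z c)
  ext : ∀ c c', y c = y c' → g c = g c' → z c = z c' → c = c'
  exists_lift : ∀ {T : Mfd.{u}} (a : T ⟶ H.obj) (b : T ⟶ G.arr) (e : T ⟶ K.obj),
    (∀ t, G.src (b t) = Hom.obj φ (a t)) → (∀ t, G.tgt (b t) = Hom.obj ψ (e t)) →
    ∃ c : T ⟶ P, (∀ t, y (c t) = a t) ∧ (∀ t, g (c t) = b t) ∧ ∀ t, z (c t) = e t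

/-- Triples are built in two stages: pairs of an object of `K` and an arrow out of its image form a
manifold submerging onto `G₀` by the target, and this submersion is pulled back along `φ`. The
arrows there start at `ψ`, hence the inversion. -/
theorem IsEssEquiv.nonempty_weakFibreObj {H K G : LieGpd.{u}} (φ : H ⟶ G) {ψ : K ⟶ G}
    (hψ : IsEssEquiv ψ) : Nonempty (WeakFibreObj φ ψ) := by
  obtain ⟨Q, p, q, hQ, -, hsub⟩ := hψ.essSurj
  have hQ := IsFibreProduct.of_isPullback hQ
  obtain ⟨P, a, b, hP⟩ := IsSubmersion.exists_fibreProduct (f := q ≫ G.tgt) hsub (Hom.obj φ)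
  refine ⟨⟨P, b, a ≫ q ≫ G.inv, a ≫ p, fun c => ?_, fun c => ?_, fun c c' h1 h2 h3 => ?_, ?_⟩⟩
  · exact (G.src_inv _).trans (hP.comm c)
  · exact (G.tgt_inv _).trans (hQ.comm _).symm
  · refine hP.ext _ _ (hQ.ext _ _ h3 ?_) h1
    have := congrArg G.inv h2
    simpa only [comp_apply, inv_inv] using this
  · intro T y g z h1 h2
    obtain ⟨r, hr1, hr2⟩ := hQ.lift z (g ≫ G.inv) fun t => ((G.src_inv _).trans (h2 t)).symm
    obtain ⟨c, hc1, hc2⟩ := hP.lift r y fun t => by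
      change G.tgt (q (r t)) = _
      rw [hr2]
      exact (G.tgt_inv _).trans (h1 t)
    refine ⟨c, hc2, fun t => ?_, fun t => ?_⟩
    · change G.inv (q (a (c t))) = _
      rw [hc1, hr2]
      exact inv_inv _ _
    · change p (a (c t)) = _
      rw [hc1, hr1]

/-- The manifold of arrows of a weak fibre product. -/
structure WeakFibreArr {H K G : LieGpd.{u}} {φ : H ⟶ G} {ψ : K ⟶ G} (D : WeakFibreObj φ ψ) where
  A : Mfd.{u}
  h : A ⟶ H.arr
  k : A ⟶ K.arr
  s : A ⟶ D.P
  t : A ⟶ D.P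
  src_h : ∀ a, H.src (h a) = D.y (s a)
  tgt_h : ∀ a, H.tgt (h a) = D.y (t a)
  src_k : ∀ a, K.src (k a) = D.z (s a)
  tgt_k : ∀ a, K.tgt (k a) = D.z (t a)
  comm : ∀ a, G.comp (D.g (t a)) (Hom.arr φ (h a)) (by rw [D.src_g, Hom.tgt_arr, tgt_h]) =
    G.comp (Hom.arr ψ (k a)) (D.g (s a)) (by rw [D.tgt_g, Hom.src_arr, src_k])
  ext : ∀ a a', h a = h a' → k a = k a' → s a = s a' → a = a'
  submersion : IsSubmersion s
  exists_lift : ∀ {T : Mfd.{u}} (h' : T ⟶ H.arr) (k' : T ⟶ K.arr) (s' t' : T ⟶ D.P)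
    (_ : ∀ x, H.src (h' x) = D.y (s' x)) (h2 : ∀ x, H.tgt (h' x) = D.y (t' x))
    (h3 : ∀ x, K.src (k' x) = D.z (s' x)) (_ : ∀ x, K.tgt (k' x) = D.z (t' x)),
    (∀ x, G.comp (D.g (t' x)) (Hom.arr φ (h' x)) (by rw [D.src_g, Hom.tgt_arr, h2]) =
      G.comp (Hom.arr ψ (k' x)) (D.g (s' x)) (by rw [D.tgt_g, Hom.src_arr, h3])) →
    ∃ c : T ⟶ A, (∀ x, h (c x) = h' x) ∧ (∀ x, k (c x) = k' x) ∧ (∀ x, s (c x) = s' x) ∧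
      ∀ x, t (c x) = t' x

/-- An arrow is determined by its source object and one arrow of `H` and one of `K` out of its
components. The arrows thus form the pullback of the submersion `src × src`, and the source map
inherits local sections. -/
theorem WeakFibreObj.nonempty_arr {H K G : LieGpd.{u}} {φ : H ⟶ G} {ψ : K ⟶ G}
    (D : WeakFibreObj φ ψ) : Nonempty (WeakFibreArr D) := by
  obtain ⟨A, a, s, hA⟩ := (H.isSubmersion_src.prodMap K.isSubmersion_src).exists_fibreProduct
    (pair D.y D.z)
  have hs : ∀ x, H.src (a x).1 = D.y (s x) := fun x => congrArg Prod.fst (hA.comm x)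
  have ks : ∀ x, K.src (a x).2 = D.z (s x) := fun x => congrArg Prod.snd (hA.comm x)
  have e1 : ∀ x, G.src ((a ≫ snd ≫ Hom.arr ψ) x) = G.tgt ((s ≫ D.g) x) := fun x => by
    simp [ks, D.tgt_g]
  have e2 : ∀ x, G.src (G.mulHom (a ≫ snd ≫ Hom.arr ψ) (s ≫ D.g) e1 x) =
      G.tgt ((a ≫ fst ≫ Hom.arr φ ≫ G.inv) x) := fun x => by simp [hs, D.src_g]
  -- The commuting square forces the middle component of the target object to be `ψ(k) g φ(h)⁻¹`.
  obtain ⟨t, h1, h2, h3⟩ := D.exists_lift (a ≫ fst ≫ H.tgt) (G.mulHom _ _ e2) (a ≫ snd ≫ K.tgt)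
    (fun x => by simp) (fun x => by simp)
  refine ⟨⟨A, a ≫ fst, a ≫ snd, s, t, hs, fun x => (h1 x).symm, ks, fun x => (h3 x).symm,
    fun x => ?_, fun x x' i1 i2 i3 => hA.ext _ _ (Prod.ext i1 i2) i3, ?_, ?_⟩⟩
  · rw [G.comp_congr (h2 x) rfl]
    exact comp_inv_cancel _ _ _ _
  · refine HasLocalSections.isSubmersion fun x => ?_
    obtain ⟨U, hU, σ, hσ, hu⟩ :=
      (H.isSubmersion_src.prodMap K.isSubmersion_src).hasLocalSections (a x)
    have hW : IsOpen ((pair D.y D.z) ⁻¹' (U : Set (H.obj.prod K.obj))) :=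
      continuous_preimage_isOpen _ U
    have hx : s x ∈ (⟨_, hW⟩ : TopologicalSpace.Opens D.P) := by
      change pair D.y D.z (s x) ∈ U
      rw [← hA.comm]
      exact hU
    let r : D.P.restrict ⟨_, hW⟩ ⟶ (H.obj.prod K.obj).restrict U :=
      corestrict U (incl _ ≫ pair D.y D.z) fun w => w.2
    obtain ⟨c, hc1, hc2⟩ := hA.lift (r ≫ σ) (incl _) fun w => hu (r w)
    refine ⟨⟨_, hW⟩, hx, c, hA.ext _ _ ((hc1 _).trans ?_) (hc2 _), hc2⟩
    have hr : r ⟨s x, hx⟩ = ⟨_, hU⟩ := Subtype.ext (hA.comm x).symm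
    exact (congrArg σ hr).trans hσ
  · intro T h' k' s' t' i1 i2 i3 i4 i5
    obtain ⟨c, hc1, hc2⟩ := hA.lift (pair h' k') s' fun x => Prod.ext (i1 x) (i3 x)
    have hc3 : ∀ x, (a (c x)).1 = h' x := fun x => congrArg Prod.fst (hc1 x)
    have hc4 : ∀ x, (a (c x)).2 = k' x := fun x => congrArg Prod.snd (hc1 x)
    refine ⟨c, hc3, hc4, hc2, fun x => D.ext _ _ ?_ ?_ ?_⟩
    · rw [h1, ← i2, ← hc3]; rfl
    · rw [h2]
      refine eq_of_comp_eq (b := Hom.arr φ (h' x)) ?_ ?_ (Eq.trans ?_ (i5 x).symm)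
      · simp [hc3]
      · rw [D.src_g, Hom.tgt_arr, i2]
      · refine (G.comp_congr rfl (congrArg (Hom.arr φ) (hc3 x).symm) _).trans
          ((comp_inv_cancel _ _ _ ?_).trans ?_)
        · simp
        · exact G.comp_congr (congrArg (Hom.arr ψ) (hc4 x)) (congrArg D.g (hc2 x)) _
    · rw [h3, ← i4, ← hc4]; rfl

end LieGpd

/-! ## Existence of weak fibre products -/

namespace LieGpd

open Mfd

/-- Pasting of two commutative squares of arrows. -/
theorem comp_square {G : LieGpd.{u}} {g g' g'' p p' q q' : G.arr}
    (h1 : G.src g' = G.tgt p) (h2 : G.src q = G.tgt g) (h3 : G.src g'' = G.tgt p')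
    (h4 : G.src q' = G.tgt g') (e : G.comp g' p h1 = G.comp q g h2)
    (e' : G.comp g'' p' h3 = G.comp q' g' h4) (h5 : G.src p' = G.tgt p) (h6 : G.src q' = G.tgt q)
    (h7 : G.src g'' = G.tgt (G.comp p' p h5)) (h8 : G.src (G.comp q' q h6) = G.tgt g) :
    G.comp g'' (G.comp p' p h5) h7 = G.comp (G.comp q' q h6) g h8 := by
  rw [← G.comp_assoc _ _ _ h3 h5, G.comp_congr e' rfl, G.comp_assoc _ _ _ h4 h1,
    G.comp_congr rfl e, ← G.comp_assoc _ _ _ h6 h2]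

theorem inv_square {G : LieGpd.{u}} {g g' p q : G.arr}
    (h1 : G.src g' = G.tgt p) (h2 : G.src q = G.tgt g) (e : G.comp g' p h1 = G.comp q g h2)
    (h3 : G.src g = G.tgt (G.inv p)) (h4 : G.src (G.inv q) = G.tgt g') :
    G.comp g (G.inv p) h3 = G.comp (G.inv q) g' h4 := by
  have h5 : G.src g = G.src p := h3.trans (G.tgt_inv p)
  refine eq_of_comp_eq (b := p) (by simp) (by simp [h1]) ?_
  rw [comp_inv_cancel, G.comp_assoc _ _ _ h4 h1, G.comp_congr rfl e,
    ← G.comp_assoc _ _ _ (by simp) h2, G.comp_congr (G.inv_comp q) rfl, unit_comp']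

/-- Weak fibre products along essential equivalences exist. -/
theorem WeakFibreArr.exists_weakFibreProduct {H K G : LieGpd.{u}} {φ : H ⟶ G} {ψ : K ⟶ G}
    {D : WeakFibreObj φ ψ} (R : WeakFibreArr D) :
    ∃ (P : LieGpd.{u}) (ξ : P ⟶ H) (κ : P ⟶ K) (θ : ξ ≫ φ ⟶ κ ≫ ψ), IsWeakFibreProduct θ := by
  obtain ⟨e, e1, e2, e3, e4⟩ := R.exists_lift (D.y ≫ H.unit) (D.z ≫ K.unit) (𝟙 _) (𝟙 _)
    (fun x => by simp) (fun x => by simp) (fun x => by simp) (fun x => by simp)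
    (fun x => by
      refine (G.comp_congr rfl (Hom.arr_unit φ _) _).trans ((comp_unit' _ _ _ ?_).trans ?_)
      · exact (D.src_g x).trans (G.tgt_unit _).symm
      · refine (((G.comp_congr (Hom.arr_unit ψ _) rfl _).trans (unit_comp' _ _ _ ?_))).symm
        exact (G.src_unit _).trans (D.tgt_g x).symm)
  obtain ⟨i, i1, i2, i3, i4⟩ := R.exists_lift (R.h ≫ H.inv) (R.k ≫ K.inv) R.t R.s
    (fun x => by simp [R.tgt_h]) (fun x => by simp [R.src_h]) (fun x => by simp [R.tgt_k])
    (fun x => by simp [R.src_k])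
    (fun x => by
      refine (G.comp_congr rfl (arr_inv φ _) _).trans ((inv_square _ _ (R.comm x) ?_ ?_).trans ?_)
      · simp [D.src_g, R.src_h]
      · simp [D.tgt_g, R.tgt_k]
      · exact G.comp_congr (arr_inv ψ _).symm rfl _)
  have hc : ∀ {T : Mfd.{u}} (b a : T ⟶ R.A) (q : ∀ x, R.s (b x) = R.t (a x)), ∃ c : T ⟶ R.A,
      (∀ x, R.h (c x) = H.comp (R.h (b x)) (R.h (a x)) (by rw [R.src_h, R.tgt_h, q])) ∧
      (∀ x, R.k (c x) = K.comp (R.k (b x)) (R.k (a x)) (by rw [R.src_k, R.tgt_k, q])) ∧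
      (∀ x, R.s (c x) = R.s (a x)) ∧ ∀ x, R.t (c x) = R.t (b x) := by
    intro T b a q
    refine R.exists_lift
      (H.mulHom (b ≫ R.h) (a ≫ R.h) fun x => by simp [R.src_h, R.tgt_h, q])
      (K.mulHom (b ≫ R.k) (a ≫ R.k) fun x => by simp [R.src_k, R.tgt_k, q]) (a ≫ R.s) (b ≫ R.t)
      (fun x => by simp [R.src_h]) (fun x => by simp [R.tgt_h]) (fun x => by simp [R.src_k])
      (fun x => by simp [R.tgt_k]) (fun x => ?_)
    have p1 : G.src (Hom.arr φ (R.h (b x))) = G.tgt (Hom.arr φ (R.h (a x))) := by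
      rw [Hom.src_arr, Hom.tgt_arr, R.src_h, R.tgt_h, q]
    have p2 : G.src (Hom.arr ψ (R.k (b x))) = G.tgt (Hom.arr ψ (R.k (a x))) := by
      rw [Hom.src_arr, Hom.tgt_arr, R.src_k, R.tgt_k, q]
    have p3 : G.src (D.g (R.t (b x))) = G.tgt (G.comp _ _ p1) := by
      rw [G.tgt_comp, D.src_g, Hom.tgt_arr, R.tgt_h]
    have p4 : G.src (G.comp _ _ p2) = G.tgt (D.g (R.s (a x))) := by
      rw [G.src_comp, D.tgt_g, Hom.src_arr, R.src_k]
    have p5 : G.src (Hom.arr ψ (R.k (b x))) = G.tgt (D.g (R.t (a x))) := by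
      rw [D.tgt_g, Hom.src_arr, R.src_k, q]
    have key := comp_square _ _ _ p5 (R.comm (a x))
      ((R.comm (b x)).trans (G.comp_congr rfl (congrArg D.g (q x)) _)) p1 p2 p3 p4
    exact (G.comp_congr rfl (Hom.arr_comp φ _ _ _) _).trans
      (key.trans (G.comp_congr (Hom.arr_comp ψ _ _ _).symm rfl _))
  -- Composition is chosen pointwise from one-point families. Its smoothness comes back from `hc`: a
  -- smooth family of composites has the same components, and these determine the arrow.
  have hp : ∀ (b a : R.A) (q : R.s b = R.t a), ∃ c : R.A,
      R.h c = H.comp (R.h b) (R.h a) (by rw [R.src_h, R.tgt_h, q]) ∧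
      R.k c = K.comp (R.k b) (R.k a) (by rw [R.src_k, R.tgt_k, q]) ∧
      R.s c = R.s a ∧ R.t c = R.t b := by
    intro b a q
    obtain ⟨c, h1, h2, h3, h4⟩ := hc (T := point) (const _ b) (const _ a) fun _ => q
    exact ⟨c PUnit.unit, h1 _, h2 _, h3 _, h4 _⟩
  choose m m1 m2 m3 m4 using hp
  have ext' : ∀ {a a' : R.A}, R.h a = R.h a' → R.k a = R.k a' → R.s a = R.s a' → a = a' :=
    fun {a a'} => R.ext a a'
  let P : LieGpd.{u} :=
    { obj := D.P
      arr := R.A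
      src := R.s
      tgt := R.t
      unit := e
      inv := i
      comp := m
      smooth_comp := fun T a b h => by
        obtain ⟨c, c1, c2, c3, c4⟩ := hc a b h
        have : (fun x => m (a x) (b x) (h x)) = c := funext fun x =>
          ext' ((m1 _ _ _).trans (c1 x).symm) ((m2 _ _ _).trans (c2 x).symm)
            ((m3 _ _ _).trans (c3 x).symm)
        rw [this]
        exact contMDiff c
      src_unit := e3
      tgt_unit := e4
      src_inv := i3
      tgt_inv := i4
      src_comp := m3
      tgt_comp := m4
      comp_unit := fun a => by
        refine ext' ?_ ?_ ((m3 _ _ _).trans (e3 _))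
        · rw [m1, H.comp_congr rfl (e1 _)]
          exact comp_unit' _ _ _ _
        · rw [m2, K.comp_congr rfl (e2 _)]
          exact comp_unit' _ _ _ _
      unit_comp := fun a => by
        refine ext' ?_ ?_ (m3 _ _ _)
        · rw [m1, H.comp_congr (e1 _) rfl]
          exact unit_comp' _ _ _ _
        · rw [m2, K.comp_congr (e2 _) rfl]
          exact unit_comp' _ _ _ _
      comp_assoc := fun a b c h1 h2 => by
        refine ext' ?_ ?_ (by rw [m3, m3, m3])
        · exact (m1 _ _ _).trans ((H.comp_congr (m1 _ _ _) rfl _).trans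
            ((H.comp_assoc _ _ _ _ _).trans
              ((m1 _ _ _).trans (H.comp_congr rfl (m1 _ _ _) _)).symm))
        · exact (m2 _ _ _).trans ((K.comp_congr (m2 _ _ _) rfl _).trans
            ((K.comp_assoc _ _ _ _ _).trans
              ((m2 _ _ _).trans (K.comp_congr rfl (m2 _ _ _) _)).symm))
      inv_comp := fun a => by
        refine ext' ?_ ?_ ((m3 _ _ _).trans (e3 _).symm)
        · rw [m1, H.comp_congr (i1 _) rfl, e1]
          exact (H.inv_comp _).trans (congrArg H.unit (R.src_h a))
        · rw [m2, K.comp_congr (i2 _) rfl, e2]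
          exact (K.inv_comp _).trans (congrArg K.unit (R.src_k a))
      comp_inv := fun a => by
        refine ext' ?_ ?_ ((m3 _ _ _).trans ((i3 _).trans (e3 _).symm))
        · rw [m1, H.comp_congr rfl (i1 _), e1]
          exact (H.comp_inv _).trans (congrArg H.unit (R.tgt_h a))
        · rw [m2, K.comp_congr rfl (i2 _), e2]
          exact (K.comp_inv _).trans (congrArg K.unit (R.tgt_k a))
      src_submersion := ⟨fun x => ⟨e x, e3 x⟩, R.submersion⟩ }
  let ξ : P ⟶ H := (⟨D.y, R.h, R.src_h, R.tgt_h, e1, m1⟩ : Hom P H)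
  let κ : P ⟶ K := (⟨D.z, R.k, R.src_k, R.tgt_k, e2, m2⟩ : Hom P K)
  let θ : ξ ≫ φ ⟶ κ ≫ ψ := (⟨D.g, D.src_g, D.tgt_g, fun a => (R.comm a).symm⟩ :
    TwoCell (ξ ≫ φ) (κ ≫ ψ))
  refine ⟨P, ξ, κ, θ, ⟨?_, ?_⟩⟩
  · intro T y g z h1 h2
    obtain ⟨c, c1, c2, c3⟩ := D.exists_lift y g z (DFunLike.congr_fun h1) (DFunLike.congr_fun h2)
    refine ⟨c, ⟨hom_ext c1, hom_ext c2, hom_ext c3⟩, ?_⟩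
    rintro c' ⟨h3, h4, h5⟩
    exact hom_ext fun t => D.ext _ _ ((DFunLike.congr_fun h3 t).trans (c1 t).symm)
      ((DFunLike.congr_fun h4 t).trans (c2 t).symm) ((DFunLike.congr_fun h5 t).trans (c3 t).symm)
  · intro T c c' h k h1 h2 h3 h4 h5
    obtain ⟨a, a1, a2, a3, a4⟩ := R.exists_lift h k c c' (DFunLike.congr_fun h1)
      (DFunLike.congr_fun h2) (DFunLike.congr_fun h3) (DFunLike.congr_fun h4) h5
    refine ⟨a, ⟨hom_ext a3, hom_ext a4, hom_ext a1, hom_ext a2⟩, ?_⟩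
    rintro a' ⟨h6, h7, h8, h9⟩
    exact hom_ext fun t => R.ext _ _ ((DFunLike.congr_fun h8 t).trans (a1 t).symm)
      ((DFunLike.congr_fun h9 t).trans (a2 t).symm) ((DFunLike.congr_fun h6 t).trans (a3 t).symm)

/-- Weak fibre products along essential equivalences exist. -/
theorem IsEssEquiv.exists_weakFibreProduct {H K G : LieGpd.{u}} (φ : H ⟶ G) {ψ : K ⟶ G}
    (hψ : IsEssEquiv ψ) :
    ∃ (P : LieGpd.{u}) (ξ : P ⟶ H) (κ : P ⟶ K) (θ : ξ ≫ φ ⟶ κ ≫ ψ), IsWeakFibreProduct θ := by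
  obtain ⟨D⟩ := hψ.nonempty_weakFibreObj φ
  obtain ⟨R⟩ := D.nonempty_arr
  exact R.exists_weakFibreProduct

end LieGpd

/-! ### Weak fibre products of equivariant maps -/

namespace TransGpd

open Mfd LieGpd

instance (A B : TransGpd.{u}) : Group (A.grp.prod B.grp) :=
  inferInstanceAs (Group (A.grp × B.grp))

instance (A B : TransGpd.{u}) : LieGroup (A.grp.prod B.grp).I ∞ (A.grp.prod B.grp) :=
  inferInstanceAs (LieGroup (A.grp.I.prod B.grp.I) ∞ (A.grp × B.grp))

theorem Hom.map_one {A B : TransGpd.{u}} (f : A ⟶ B) : Hom.grp f 1 = 1 := by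
  have h := Hom.map_mul f 1 1
  rw [mul_one] at h
  exact left_eq_mul.mp h

section

variable {A B C : TransGpd.{u}} {φ : A ⟶ C} {ψ : B ⟶ C}
  (D : WeakFibreObj (Hom.toLieGpd φ) (Hom.toLieGpd ψ))

/-- The first projection of a weak fibre product of equivariant maps. -/
noncomputable def fibreFst : D.P ⟶ A.space := D.y

/-- The second projection of a weak fibre product of equivariant maps. -/
noncomputable def fibreSnd : D.P ⟶ B.space := D.z

/-- The group component of the 2-cell of a weak fibre product of equivariant maps. -/
noncomputable def fibreGrp : D.P ⟶ C.grp := D.g ≫ fst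

theorem fibreGrp_smul (c : D.P) :
    fibreGrp D c • Hom.space φ (fibreFst D c) = Hom.space ψ (fibreSnd D c) := by
  have hs : (D.g c).2 = Hom.space φ (fibreFst D c) := D.src_g c
  have ht : (D.g c).1 • (D.g c).2 = Hom.space ψ (fibreSnd D c) := D.tgt_g c
  rw [← ht, ← hs]
  rfl

/-- In the weak fibre product of equivariant maps, two group elements determine an arrow. -/
theorem exists_weakFibre_action {T : Mfd.{u}} (a : T ⟶ A.grp) (b : T ⟶ B.grp) (c : T ⟶ D.P) :
    ∃ c' : T ⟶ D.P, (∀ t, fibreFst D (c' t) = a t • fibreFst D (c t)) ∧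
      (∀ t, fibreGrp D (c' t) = Hom.grp ψ (b t) * fibreGrp D (c t) * (Hom.grp φ (a t))⁻¹) ∧
      ∀ t, fibreSnd D (c' t) = b t • fibreSnd D (c t) := by
  let m : T ⟶ C.grp := homMk
    (fun t => Hom.grp ψ (b t) * fibreGrp D (c t) * (Hom.grp φ (a t))⁻¹) (by
      have h1 := contMDiff (b ≫ Hom.grp ψ)
      have h2 := contMDiff (c ≫ fibreGrp D)
      have h3 := contMDiff (a ≫ Hom.grp φ)
      exact (h1.mul h2).mul ((contMDiff_inv C.grp.I ∞).comp h3))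
  let y' : T ⟶ A.space := homMk (fun t => a t • fibreFst D (c t))
    (contMDiff_smul.comp ((contMDiff a).prodMk (contMDiff (c ≫ fibreFst D))))
  let z' : T ⟶ B.space := homMk (fun t => b t • fibreSnd D (c t))
    (contMDiff_smul.comp ((contMDiff b).prodMk (contMDiff (c ≫ fibreSnd D))))
  obtain ⟨c', h1, h2, h3⟩ := D.exists_lift y' (pair m (y' ≫ Hom.space φ)) z' (fun t => rfl)
    (fun t => by
      change (Hom.grp ψ (b t) * fibreGrp D (c t) * (Hom.grp φ (a t))⁻¹) •
        Hom.space φ (a t • fibreFst D (c t)) = Hom.space ψ (b t • fibreSnd D (c t))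
      rw [Hom.map_smul, Hom.map_smul, mul_smul, inv_smul_smul, mul_smul, fibreGrp_smul])
  exact ⟨c', h1, fun t => congrArg Prod.fst (h2 t), h3⟩

theorem weakFibre_ext {c c' : D.P} (h1 : fibreFst D c = fibreFst D c')
    (h2 : fibreGrp D c = fibreGrp D c') (h3 : fibreSnd D c = fibreSnd D c') : c = c' := by
  refine D.ext _ _ h1 (Prod.ext h2 ?_) h3
  have hs : ∀ x, (D.g x).2 = Hom.space φ (fibreFst D x) := D.src_g
  rw [hs, hs, h1]

end

/-- The weak fibre product of equivariant maps is a translation groupoid. -/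
theorem exists_weakFibreProduct {A B C : TransGpd.{u}} (φ : A ⟶ C) {ψ : B ⟶ C}
    (hψ : IsEssEquiv (Hom.toLieGpd ψ)) :
    ∃ (P : TransGpd.{u}) (ξ : P ⟶ A) (κ : P ⟶ B) (θ : ξ ≫ φ ≅ κ ≫ ψ),
      IsWeakFibreProduct (H := A.toLieGpd) (K := B.toLieGpd) (G := C.toLieGpd) (P := P.toLieGpd)
        (φ := Hom.toLieGpd φ) (ψ := Hom.toLieGpd ψ) (ξ := Hom.toLieGpd ξ) (ζ := Hom.toLieGpd κ)
        θ.hom := by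
  obtain ⟨D⟩ := hψ.nonempty_weakFibreObj (Hom.toLieGpd φ)
  -- Applied to the universal family of group pairs and points, this yields one smooth map `(a, b) •
  -- (y, m, z) = (a y, ψ(b) m φ(a)⁻¹, b z)`, which is the action.
  obtain ⟨act, a1, a2, a3⟩ := exists_weakFibre_action D
    (T := (A.grp.prod B.grp).prod D.P) (fst ≫ fst) (fst ≫ snd) snd
  have hs : ∀ x, (D.g x).2 = Hom.space φ (D.y x) := D.src_g
  let _ : MulAction (A.grp.prod B.grp) D.P :=
    { smul := fun γ c => act (γ, c)
      one_smul := fun c => by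
        refine weakFibre_ext D ((a1 _).trans (one_smul _ _)) ((a2 _).trans ?_)
          ((a3 _).trans (one_smul _ _))
        change Hom.grp ψ 1 * fibreGrp D c * (Hom.grp φ 1)⁻¹ = fibreGrp D c
        rw [Hom.map_one, Hom.map_one, one_mul, inv_one, mul_one]
      mul_smul := fun γ γ' c => by
        refine weakFibre_ext D ?_ ?_ ?_
        · refine (a1 _).trans ((mul_smul _ _ _).trans ?_)
          exact ((a1 _).trans (congrArg (γ.1 • ·) (a1 _))).symm
        · refine (a2 _).trans (Eq.trans ?_ ((a2 _).trans (congrArg (fun x =>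
            Hom.grp ψ γ.2 * x * (Hom.grp φ γ.1)⁻¹) (a2 _))).symm)
          change Hom.grp ψ (γ.2 * γ'.2) * fibreGrp D c * (Hom.grp φ (γ.1 * γ'.1))⁻¹ =
            Hom.grp ψ γ.2 * (Hom.grp ψ γ'.2 * fibreGrp D c * (Hom.grp φ γ'.1)⁻¹) *
              (Hom.grp φ γ.1)⁻¹
          rw [Hom.map_mul, Hom.map_mul, mul_inv_rev]
          simp only [mul_assoc]
        · refine (a3 _).trans ((mul_smul _ _ _).trans ?_)
          exact ((a3 _).trans (congrArg (γ.2 • ·) (a3 _))).symm }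
  let _ : ContMDiffSMul (A.grp.prod B.grp).I D.P.I ∞ (A.grp.prod B.grp) D.P := ⟨contMDiff act⟩
  -- In a translation groupoid an arrow out of a given object is a group element. An arrow of the
  -- weak fibre product therefore amounts to its source object and a pair of group elements.
  let P : TransGpd.{u} := { grp := A.grp.prod B.grp, space := D.P }
  let ξ : P ⟶ A := (⟨fst, D.y, fun _ _ => rfl, fun γ c => a1 (γ, c)⟩ : Hom P A)
  let κ : P ⟶ B := (⟨snd, D.z, fun _ _ => rfl, fun γ c => a3 (γ, c)⟩ : Hom P B)
  let θ : TwoCell (G := P.toLieGpd) (H := C.toLieGpd) (Hom.toLieGpd (ξ ≫ φ))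
      (Hom.toLieGpd (κ ≫ ψ)) :=
    { app := D.g
      src_app := D.src_g
      tgt_app := D.tgt_g
      natural := fun p => by
        refine Prod.ext ?_ ?_
        · change Hom.grp ψ p.1.2 * fibreGrp D p.2 = fibreGrp D (act p) * Hom.grp φ p.1.1
          exact (inv_mul_cancel_right _ _).symm.trans (congrArg (· * Hom.grp φ p.1.1) (a2 p).symm)
        · exact hs p.2 }
  refine ⟨P, ξ, κ, ⟨θ, TwoCell.symm θ, TwoCell.vcomp_symm θ, TwoCell.symm_vcomp θ⟩, ⟨?_, ?_⟩⟩
  · intro T y g z h1 h2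
    obtain ⟨c, c1, c2, c3⟩ := D.exists_lift y g z (DFunLike.congr_fun h1) (DFunLike.congr_fun h2)
    refine ⟨c, ⟨hom_ext c1, hom_ext c2, hom_ext c3⟩, ?_⟩
    rintro c' ⟨h3, h4, h5⟩
    exact hom_ext fun t => D.ext _ _ ((DFunLike.congr_fun h3 t).trans (c1 t).symm)
      ((DFunLike.congr_fun h4 t).trans (c2 t).symm) ((DFunLike.congr_fun h5 t).trans (c3 t).symm)
  · intro T c c' h k h1 h2 h3 h4 h5
    have h1' : ∀ t, (h t).2 = fibreFst D (c t) := DFunLike.congr_fun h1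
    have h2' : ∀ t, (h t).1 • (h t).2 = fibreFst D (c' t) := DFunLike.congr_fun h2
    have h3' : ∀ t, (k t).2 = fibreSnd D (c t) := DFunLike.congr_fun h3
    have h4' : ∀ t, (k t).1 • (k t).2 = fibreSnd D (c' t) := DFunLike.congr_fun h4
    have h5' : ∀ t, fibreGrp D (c' t) * Hom.grp φ (h t).1 =
        Hom.grp ψ (k t).1 * fibreGrp D (c t) :=
      fun t => congrArg Prod.fst (h5 t)
    refine ⟨pair (pair (h ≫ fst) (k ≫ fst)) c, ⟨rfl, hom_ext fun t => ?_, hom_ext fun t => ?_,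
      hom_ext fun t => ?_⟩, ?_⟩
    · refine weakFibre_ext D ((a1 _).trans ?_) ((a2 _).trans ?_) ((a3 _).trans ?_)
      · exact (congrArg ((h t).1 • ·) (h1' t).symm).trans (h2' t)
      · exact mul_inv_eq_of_eq_mul (h5' t).symm
      · exact (congrArg ((k t).1 • ·) (h3' t).symm).trans (h4' t)
    · exact Prod.ext rfl (h1' t).symm
    · exact Prod.ext rfl (h3' t).symm
    · rintro a ⟨h6, h7, h8, h9⟩
      refine hom_ext fun t => Prod.ext (Prod.ext ?_ ?_) (DFunLike.congr_fun h6 t)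
      · have e := congrArg Prod.fst (DFunLike.congr_fun h8 t)
        exact e
      · have e := congrArg Prod.fst (DFunLike.congr_fun h9 t)
        exact e

end TransGpd

/-! ## Existence of composites of diagrams -/

namespace Fractions

/-- The properties of a class of 1-cells used to compose spans and diagrams, in a bicategory with
invertible 2-cells. -/
structure Calculus {C : Type u} [Bicategory.{w, v} C] (W : OneCellClass C) : Prop where
  id_mem : ∀ X : C, W (𝟙 X)
  comp_mem : ∀ {X Y Z : C} {f : X ⟶ Y} {g : Y ⟶ Z}, W f → W g → W (f ≫ g)
  of_iso : ∀ {X Y : C} {f g : X ⟶ Y}, (f ≅ g) → W f → W g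
  exists_square : ∀ {H K G : C} (φ : H ⟶ G) {ψ : K ⟶ G}, W ψ →
    ∃ (P : C) (ξ : P ⟶ H) (κ : P ⟶ K), Nonempty (ξ ≫ φ ≅ κ ≫ ψ) ∧ W ξ
  exists_lift : ∀ {T G H : C} {f : G ⟶ H}, W f → ∀ {a b : T ⟶ G} (α : a ≫ f ≅ b ≫ f),
    ∃ η : a ≅ b, η.hom ▷ f = α.hom
  isIso : ∀ {X Y : C} {f g : X ⟶ Y} (α : f ⟶ g), IsIso α

namespace Calculus

variable {C : Type u} [Bicategory.{w, v} C] {W : OneCellClass C} (h : Calculus W)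
include h

/-- A square over the two maps to `X` is turned into `η` by lifting along `S.left`. Then `η'` is the
lift along `S'.left` of the 2-cell that the required equation prescribes. Comparing diagrams is
thereby reduced to their right halves. -/
theorem exists_overlap_of_square {X Y : C} {S S' : Span W X Y} {P : C} {f : P ⟶ S.apex}
    {f' : P ⟶ S'.apex} (α : f ≫ S.left ≅ f' ≫ S'.left) (hf : W (f ≫ S.left)) (e : Diagram S S') :
    ∃ (N : C) (s : N ⟶ P) (s' : N ⟶ e.apex) (η : s ≫ f ≅ s' ≫ e.ν) (η' : s ≫ f' ≅ s' ≫ e.ν'),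
      W s ∧ W (s ≫ f ≫ S.left) ∧ W (s' ≫ e.ν' ≫ S'.left) ∧
      (α_ _ _ _).hom ≫ s ◁ α.hom ≫ (α_ _ _ _).inv ≫ η'.hom ▷ S'.left =
        η.hom ▷ S.left ≫ (α_ _ _ _).hom ≫ s' ◁ e.α₁.hom ≫ (α_ _ _ _).inv := by
  obtain ⟨N, s, s', ⟨θ⟩, hs⟩ := h.exists_square (f ≫ S.left) e.mem
  obtain ⟨η, -⟩ := h.exists_lift S.mem (α_ s f S.left ≪≫ θ ≪≫ (α_ s' e.ν S.left).symm)
  let A := α_ s f S.left ≪≫ whiskerLeftIso s α ≪≫ (α_ s f' S'.left).symm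
  let B := whiskerRightIso η S.left ≪≫ α_ s' e.ν S.left ≪≫ whiskerLeftIso s' e.α₁ ≪≫
    (α_ s' e.ν' S'.left).symm
  obtain ⟨η', h2⟩ := h.exists_lift S'.mem (A.symm ≪≫ B)
  have hm : W (s ≫ f ≫ S.left) := h.comp_mem hs hf
  refine ⟨N, s, s', η, η', hs, hm, h.of_iso (θ ≪≫ whiskerLeftIso s' e.α₁) hm, ?_⟩
  have h3 : A.hom ≫ η'.hom ▷ S'.left = B.hom := by
    rw [h2]
    exact A.hom_inv_id_assoc _
  simpa only [A, B, Iso.trans_hom, Iso.symm_hom, whiskerLeftIso_hom, whiskerRightIso_hom,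
    Category.assoc] using h3

theorem exists_overlap {X Y : C} {S S' : Span W X Y} (d e : Diagram S S') :
    ∃ (N : C) (s : N ⟶ d.apex) (s' : N ⟶ e.apex)
      (η : s ≫ d.ν ≅ s' ≫ e.ν) (η' : s ≫ d.ν' ≅ s' ≫ e.ν'),
      W (s ≫ d.ν ≫ S.left) ∧ W (s' ≫ e.ν' ≫ S'.left) ∧
      (α_ _ _ _).hom ≫ s ◁ d.α₁.hom ≫ (α_ _ _ _).inv ≫ η'.hom ▷ S'.left =
        η.hom ▷ S.left ≫ (α_ _ _ _).hom ≫ s' ◁ e.α₁.hom ≫ (α_ _ _ _).inv := by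
  obtain ⟨N, s, s', η, η', -, h'⟩ := h.exists_overlap_of_square d.α₁ d.mem e
  exact ⟨N, s, s', η, η', h'⟩

theorem exists_vcomposite {X Y : C} {S S' S'' : Span W X Y} (d : Diagram S S')
    (e : Diagram S' S'') : Nonempty (VComposite d e) := by
  obtain ⟨N, r, r', ⟨θ⟩, hr⟩ := h.exists_square (d.ν' ≫ S'.left) e.mem
  obtain ⟨σ, -⟩ := h.exists_lift S'.mem (α_ r d.ν' S'.left ≪≫ θ ≪≫ (α_ r' e.ν S'.left).symm)
  have hm : W ((r ≫ d.ν) ≫ S.left) := h.of_iso (α_ _ _ _).symm (h.comp_mem hr d.mem)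
  exact ⟨⟨N, r, r', σ, hm, h.of_iso (α_ _ _ _ ≪≫ whiskerLeftIso r d.α₁ ≪≫ θ ≪≫
    whiskerLeftIso r' e.α₁ ≪≫ (α_ _ _ _).symm) hm⟩⟩

/-- Four squares produce a common refinement, and all 2-cells but the last are lifts along left
legs. The last, `τ'`, is solved for from the compatibility equation, which is possible because the
other 2-cells in it are invertible. -/
theorem exists_hcomposite {X Y Z : C} {S S' : Span W X Y} {T T' : Span W Y Z}
    (d : Diagram S S') (e : Diagram T T') (c : Filler S T) (c' : Filler S' T') :
    Nonempty (HComposite d e c c') := by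
  obtain ⟨N₁, n₁, r₁, ⟨θ₁⟩, h₁⟩ := h.exists_square (c.p ≫ S.left) d.mem
  obtain ⟨N₂, m₂, r', ⟨θ₂⟩, h₂⟩ := h.exists_square ((n₁ ≫ c.q) ≫ T.left) e.mem
  obtain ⟨N, m, n', ⟨θ₃⟩, h₃⟩ := h.exists_square ((r₁ ≫ d.ν') ≫ S'.left) c'.mem
  obtain ⟨M, p, q, ⟨θ₄⟩, h₄⟩ := h.exists_square m h₂
  obtain ⟨σ, -⟩ := h.exists_lift S.mem (α_ n₁ c.p S.left ≪≫ θ₁ ≪≫ (α_ r₁ d.ν S.left).symm)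
  obtain ⟨τ, -⟩ := h.exists_lift T.mem (α_ m₂ (n₁ ≫ c.q) T.left ≪≫ θ₂ ≪≫
    (α_ r' e.ν T.left).symm)
  obtain ⟨σ', -⟩ := h.exists_lift S'.mem (α_ m (r₁ ≫ d.ν') S'.left ≪≫ θ₃ ≪≫
    (α_ n' c'.p S'.left).symm)
  have hm : W ((p ≫ m ≫ n₁) ≫ c.p ≫ S.left) :=
    h.comp_mem (h.comp_mem h₄ (h.comp_mem h₃ h₁)) c.mem
  let σ₁ : (p ≫ m ≫ n₁) ≫ c.p ≅ (p ≫ m ≫ r₁) ≫ d.ν :=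
    α_ _ _ _ ≪≫ whiskerLeftIso p (α_ _ _ _ ≪≫ whiskerLeftIso m σ ≪≫ (α_ _ _ _).symm) ≪≫
      (α_ _ _ _).symm
  let σ₂ : (p ≫ m ≫ r₁) ≫ d.ν' ≅ (p ≫ n') ≫ c'.p :=
    α_ _ _ _ ≪≫ whiskerLeftIso p (α_ _ _ _ ≪≫ σ') ≪≫ (α_ _ _ _).symm
  let τ₁ : (p ≫ m ≫ n₁) ≫ c.q ≅ (q ≫ r') ≫ e.ν :=
    α_ _ _ _ ≪≫ whiskerLeftIso p (α_ _ _ _) ≪≫ (α_ _ _ _).symm ≪≫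
      whiskerRightIso θ₄ (n₁ ≫ c.q) ≪≫ α_ _ _ _ ≪≫ whiskerLeftIso q τ ≪≫ (α_ _ _ _).symm
  have := h.isIso d.α₂
  let A := whiskerRightIso σ₁ S.right ≪≫ α_ _ _ _ ≪≫ whiskerLeftIso (p ≫ m ≫ r₁) (asIso d.α₂) ≪≫
    (α_ _ _ _).symm ≪≫ whiskerRightIso σ₂ S'.right ≪≫ α_ _ _ _ ≪≫ whiskerLeftIso (p ≫ n') c'.θ
  let B := α_ _ _ _ ≪≫ whiskerLeftIso (p ≫ m ≫ n₁) c.θ ≪≫ (α_ _ _ _).symm ≪≫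
    whiskerRightIso τ₁ T.left ≪≫ α_ _ _ _ ≪≫ whiskerLeftIso (q ≫ r') e.α₁ ≪≫ (α_ _ _ _).symm
  obtain ⟨τ', h5⟩ := h.exists_lift T'.mem (B.symm ≪≫ A ≪≫ (α_ _ _ _).symm)
  refine ⟨⟨M, p ≫ m ≫ n₁, p ≫ n', p ≫ m ≫ r₁, q ≫ r', σ₁, σ₂, τ₁, τ'.hom, ?_, hm,
    h.of_iso ?_ hm⟩⟩
  · have h6 : A.hom = B.hom ≫ τ'.hom ▷ T'.left ≫ (α_ _ _ _).hom := by
      rw [h5]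
      simp only [Iso.trans_hom, Iso.symm_hom, Category.assoc, Iso.inv_hom_id, Category.comp_id,
        Iso.hom_inv_id_assoc]
    simpa only [A, B, Iso.trans_hom, Iso.symm_hom, whiskerLeftIso_hom, whiskerRightIso_hom,
      Category.assoc, asIso_hom] using h6
  · exact (α_ _ _ _).symm ≪≫ whiskerRightIso σ₁ S.left ≪≫ α_ _ _ _ ≪≫ whiskerLeftIso _ d.α₁ ≪≫
      (α_ _ _ _).symm ≪≫ whiskerRightIso σ₂ S'.left ≪≫ α_ _ _ _

/-- One square over `X` suffices. The 2-cells `ρ`, `τ`, `κ` are lifted in turn along the left legs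
of `S`, `T`, `R`, the last two as solutions of the two compatibility equations. -/
theorem exists_assocComparison {X Y Z V : C} {S : Span W X Y} {T : Span W Y Z} {R : Span W Z V}
    {c : Filler S T} {c' : Filler T R} (a : Filler c.span R) (a' : Filler S c'.span) :
    Nonempty (AssocComparison a a') := by
  obtain ⟨N, n, n', ⟨θ⟩, hn⟩ := h.exists_square (a.p ≫ c.p ≫ S.left) a'.mem
  obtain ⟨ρ, -⟩ := h.exists_lift S.mem (f := S.left) (a := n ≫ a.p ≫ c.p) (b := n' ≫ a'.p)
    (α_ _ _ _ ≪≫ whiskerLeftIso n (α_ _ _ _) ≪≫ θ ≪≫ (α_ _ _ _).symm)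
  let ϑ : a.p ≫ c.q ≫ T.right ≅ a.q ≫ R.left := a.θ
  let ϑ' : a'.p ≫ S.right ≅ a'.q ≫ c'.p ≫ T.left := a'.θ
  let A := whiskerRightIso ρ S.right ≪≫ α_ _ _ _ ≪≫ whiskerLeftIso n' ϑ'
  let A' : (n ≫ a.p ≫ c.p) ≫ S.right ≅ (n ≫ a.p ≫ c.q) ≫ T.left := α_ _ _ _ ≪≫
    whiskerLeftIso n (α_ _ _ _) ≪≫ whiskerLeftIso n (whiskerLeftIso a.p c.θ) ≪≫
    whiskerLeftIso n (α_ _ _ _).symm ≪≫ (α_ _ _ _).symm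
  let A'' : (n' ≫ a'.q ≫ c'.p) ≫ T.left ≅ n' ≫ a'.q ≫ c'.p ≫ T.left := α_ _ _ _ ≪≫
    whiskerLeftIso n' (α_ a'.q c'.p T.left)
  obtain ⟨τ, h1⟩ := h.exists_lift T.mem (f := T.left) (a := n ≫ a.p ≫ c.q)
    (b := n' ≫ a'.q ≫ c'.p) (A'.symm ≪≫ A ≪≫ A''.symm)
  let B := whiskerRightIso τ T.right ≪≫ α_ _ _ _ ≪≫ whiskerLeftIso n' (α_ _ _ _) ≪≫
    whiskerLeftIso n' (whiskerLeftIso a'.q c'.θ) ≪≫ whiskerLeftIso n' (α_ _ _ _).symm ≪≫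
    (α_ _ _ _).symm
  let B' : (n ≫ a.p ≫ c.q) ≫ T.right ≅ (n ≫ a.q) ≫ R.left := α_ _ _ _ ≪≫
    whiskerLeftIso n (α_ a.p c.q T.right) ≪≫ whiskerLeftIso n ϑ ≪≫ (α_ _ _ _).symm
  obtain ⟨κ, h2⟩ := h.exists_lift R.mem (f := R.left) (a := n ≫ a.q) (b := n' ≫ a'.q ≫ c'.q)
    (B'.symm ≪≫ B)
  have hm : W (n ≫ a.p ≫ c.p ≫ S.left) := h.comp_mem hn a.mem
  refine ⟨⟨N, n, n', ρ, τ, κ, ?_, ?_, hm, h.of_iso θ hm⟩⟩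
  · have h3 : A.hom = A'.hom ≫ τ.hom ▷ T.left ≫ A''.hom := by
      rw [h1]
      simp only [Iso.trans_hom, Iso.symm_hom, Category.assoc, Iso.inv_hom_id, Category.comp_id,
        Iso.hom_inv_id_assoc]
    simp only [A, A', A'', Iso.trans_hom, Iso.symm_hom, whiskerLeftIso_hom, whiskerRightIso_hom,
      Category.assoc] at h3
    exact h3
  · have h3 : B.hom = B'.hom ≫ κ.hom ▷ R.left := by
      rw [h2]
      exact (B'.hom_inv_id_assoc _).symm
    simp only [B, B', Iso.trans_hom, Iso.symm_hom, whiskerLeftIso_hom, whiskerRightIso_hom,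
      Category.assoc] at h3
    exact h3

end Calculus

end Fractions

theorem LieGpd.calculus : Fractions.Calculus lieW.{u} where
  id_mem X := (IsLocEquiv.id X).isEssEquiv
  comp_mem h h' := (h.isLocEquiv.comp h'.isLocEquiv).isEssEquiv
  of_iso α h := (h.isLocEquiv.of_twoCell α.hom).isEssEquiv
  exists_square φ _ h := by
    obtain ⟨P, ξ, κ, θ, hP⟩ := h.exists_weakFibreProduct φ
    exact ⟨P, ξ, κ, ⟨TwoCell.iso θ⟩, (hP.isLocEquiv h.isLocEquiv).isEssEquiv⟩
  exists_lift h _ _ α := by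
    obtain ⟨η, hη⟩ := h.isLocEquiv.exists_twoCell α.hom
    exact ⟨TwoCell.iso η, hη⟩
  isIso α := (TwoCell.iso α).isIso_hom

theorem TransGpd.isIso {A B : TransGpd.{u}} {f g : A ⟶ B} (α : f ⟶ g) : IsIso α :=
  ⟨LieGpd.TwoCell.symm α, LieGpd.TwoCell.vcomp_symm α, LieGpd.TwoCell.symm_vcomp α⟩

/-- Equivariant maps have the same 2-cells as the underlying homomorphisms, so only squares need a
new argument, namely the equivariant weak fibre product. -/
theorem TransGpd.calculus : Fractions.Calculus eqW.{u} where
  id_mem A := LieGpd.calculus.id_mem A.toLieGpd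
  comp_mem h h' := LieGpd.calculus.comp_mem h h'
  of_iso α h := LieGpd.calculus.of_iso (inclIso α) h
  exists_square φ _ h := by
    obtain ⟨P, ξ, κ, θ, hP⟩ := exists_weakFibreProduct φ h
    exact ⟨P, ξ, κ, ⟨θ⟩, (hP.isLocEquiv h.isLocEquiv).isEssEquiv⟩
  exists_lift h a b α := by
    obtain ⟨η, hη⟩ := h.isLocEquiv.exists_twoCell (f := Hom.toLieGpd a) (g := Hom.toLieGpd b)
      (inclIso α).hom
    have := TransGpd.isIso (f := a) (g := b) η
    exact ⟨asIso (X := a) (Y := b) η, hη⟩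
  isIso α := TransGpd.isIso α

/-! ## Pointwise evaluation of spans and diagrams -/

namespace Fractions

section EvalSquare

variable {X Y Z : Type u} [Category.{v} X] [Category.{v} Y] [Category.{v} Z]

/-- Extension of a natural transformation along an equivalence of categories. -/
noncomputable def extend (E : X ⥤ Y) [E.IsEquivalence] {F F' : Y ⥤ Z} (τ : E ⋙ F ⟶ E ⋙ F') :
    F ⟶ F' :=
  Functor.whiskerRight E.asEquivalence.counitInv F ≫ Functor.whiskerLeft E.inv τ ≫
    Functor.whiskerRight E.asEquivalence.counit F'

/-- By the triangle identities the counit at `E.obj x` is the image of the unit, and naturality of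
`τ` cancels it. -/
theorem extend_app (E : X ⥤ Y) [E.IsEquivalence] {F F' : Y ⥤ Z} (τ : E ⋙ F ⟶ E ⋙ F') (x : X) :
    (extend E τ).app (E.obj x) = τ.app x := by
  have h1 : E.asEquivalence.counit.app (E.obj x) = E.map (E.asEquivalence.unitInv.app x) :=
    E.asEquivalence.counit_app_functor x
  have h2 : E.asEquivalence.counitInv.app (E.obj x) = E.map (E.asEquivalence.unit.app x) :=
    E.asEquivalence.counitInv_app_functor x
  have h3 := τ.naturality (E.asEquivalence.unitInv.app x)
  have h4 : E.map (E.asEquivalence.unit.app x) ≫ E.map (E.asEquivalence.unitInv.app x) = 𝟙 _ := by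
    rw [← E.map_comp]
    exact (congrArg E.map (E.asEquivalence.unitIso.hom_inv_id_app x)).trans (E.map_id _)
  change F.map (E.asEquivalence.counitInv.app (E.obj x)) ≫ τ.app (E.inv.obj (E.obj x)) ≫
    F'.map (E.asEquivalence.counit.app (E.obj x)) = τ.app x
  rw [h1, h2]
  change F.map (E.map (E.asEquivalence.unit.app x)) ≫ τ.app (E.inv.obj (E.obj x)) ≫
    (E ⋙ F').map (E.asEquivalence.unitInv.app x) = τ.app x
  refine (congrArg (F.map (E.map (E.asEquivalence.unit.app x)) ≫ ·) h3.symm).trans ?_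
  change F.map _ ≫ F.map _ ≫ _ = _
  rw [← Category.assoc, ← F.map_comp]
  exact (congrArg (F.map · ≫ τ.app x) h4).trans (by rw [F.map_id]; exact Category.id_comp _)

theorem natTrans_ext_of_essSurj (E : X ⥤ Y) [E.EssSurj] {F F' : Y ⥤ Z} {τ τ' : F ⟶ F'}
    (h : ∀ x, τ.app (E.obj x) = τ'.app (E.obj x)) : τ = τ' := by
  ext y
  have h1 := τ.naturality (E.objObjPreimageIso y).hom
  have h2 := τ'.naturality (E.objObjPreimageIso y).hom
  rw [h, ← h2] at h1
  exact (cancel_epi _).1 h1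

/-- The natural transformation `τ` is given by `f` on `X` and `g` on `Y`, with respect to `u` and
`u'`. -/
def EvalSquare {F F' : X ⥤ Y} (τ : F ⟶ F') {x x' : X} {y y' : Y} (a : y ⟶ F.obj x)
    (a' : y' ⟶ F'.obj x') (f : x ⟶ x') (g : y ⟶ y') : Prop :=
  a ≫ τ.app x ≫ F'.map f = g ≫ a'

namespace EvalSquare

variable {F F' F'' : X ⥤ Y} {τ : F ⟶ F'} {τ' : F' ⟶ F''} {x x' x'' : X} {y y' y'' : Y}
  {a : y ⟶ F.obj x} {a' : y' ⟶ F'.obj x'} {a'' : y'' ⟶ F''.obj x''} {f : x ⟶ x'} {f' : x' ⟶ x''}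
  {g : y ⟶ y'} {g' : y' ⟶ y''}

theorem comp (h : EvalSquare τ a a' f g) (h' : EvalSquare τ' a' a'' f' g') :
    EvalSquare (τ ≫ τ') a a'' (f ≫ f') (g ≫ g') := by
  unfold EvalSquare at *
  rw [NatTrans.comp_app, Functor.map_comp, Category.assoc, Category.assoc, ← h', ← reassoc_of% h,
    τ'.naturality_assoc]

theorem id (a : y ⟶ F.obj x) : EvalSquare (𝟙 F) a a (𝟙 x) (𝟙 y) := by
  simp [EvalSquare]

theorem congr {f₁ : x ⟶ x'} {g₁ : y ⟶ y'} (h : EvalSquare τ a a' f g) (hf : f = f₁)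
    (hg : g = g₁) : EvalSquare τ a a' f₁ g₁ := hf ▸ hg ▸ h

theorem app_eq [IsIso a] {τ₁ τ₂ : F ⟶ F'} [IsIso f] (h : EvalSquare τ₁ a a' f g)
    (h' : EvalSquare τ₂ a a' f g) : τ₁.app x = τ₂.app x := by
  unfold EvalSquare at *
  rw [← h', cancel_epi, cancel_mono] at h
  exact h

theorem symm {e : F ≅ F'} (f : x ≅ x') (g : y ≅ y') (h : EvalSquare e.hom a a' f.hom g.hom) :
    EvalSquare e.inv a' a f.inv g.inv := by
  unfold EvalSquare at *
  rw [← cancel_epi g.hom, ← reassoc_of% h, ← e.inv.naturality, ← Functor.map_comp_assoc,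
    f.hom_inv_id]
  simp

/-- For a composite functor the comparison maps pass through the middle category. There `hp` matches
the output of the first square with the input of the second. -/
theorem hcomp {G G' : Y ⥤ Z} {σ : G ⟶ G'} {b b' : Y} {z z' : Z} {c : z ⟶ G.obj b}
    {c' : z' ⟶ G'.obj b'} {k : b ⟶ b'} {l : z ⟶ z'} (h : EvalSquare τ a a' f g)
    (h' : EvalSquare σ c c' k l) (p : b ⟶ y) (p' : b' ⟶ y') (hp : p ≫ g = k ≫ p') :
    EvalSquare (τ ◫ σ) (F := F ⋙ G) (F' := F' ⋙ G') (c ≫ G.map (p ≫ a)) (c' ≫ G'.map (p' ≫ a'))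
      f l := by
  unfold EvalSquare at *
  rw [← reassoc_of% h', ← G'.map_comp, ← reassoc_of% hp, ← h, NatTrans.hcomp_app]
  simp

end EvalSquare

end EvalSquare

end Fractions

/-! ### Groupoids of points -/

namespace LieGpd

/-- The points of a Lie groupoid. -/
def Pt (G : LieGpd.{u}) : Type u := G.obj

instance (G : LieGpd.{u}) : Category.{u} G.Pt where
  Hom x y := {g : G.arr // G.src g = x ∧ G.tgt g = y}
  id x := ⟨G.unit x, G.src_unit x, G.tgt_unit x⟩
  comp f g := ⟨G.comp g.1 f.1 (g.2.1.trans f.2.2.symm), (G.src_comp _ _ _).trans f.2.1,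
    (G.tgt_comp _ _ _).trans g.2.2⟩
  id_comp _ := Subtype.ext (comp_unit' _ _ _ _)
  comp_id _ := Subtype.ext (unit_comp' _ _ _ _)
  assoc _ _ _ := Subtype.ext (G.comp_assoc _ _ _ _ _).symm

instance (G : LieGpd.{u}) : Groupoid.{u} G.Pt where
  inv f := ⟨G.inv f.1, (G.src_inv _).trans f.2.2, (G.tgt_inv _).trans f.2.1⟩
  inv_comp f := Subtype.ext ((G.comp_inv _).trans (congrArg G.unit f.2.2))
  comp_inv f := Subtype.ext ((G.inv_comp _).trans (congrArg G.unit f.2.1))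

instance {C : Type v} [Category.{w} C] {G : LieGpd.{u}} {F F' : C ⥤ G.Pt} (τ : F ⟶ F') : IsIso τ :=
  have : ∀ x, IsIso (τ.app x) := fun _ => inferInstance
  NatIso.isIso_of_isIso_app τ

/-- The functor underlying a homomorphism of Lie groupoids. -/
def fn {G H : LieGpd.{u}} (φ : G ⟶ H) : G.Pt ⥤ H.Pt where
  obj x := Hom.obj φ x
  map g := ⟨Hom.arr φ g.1, (Hom.src_arr φ _).trans (congrArg (Hom.obj φ) g.2.1),
    (Hom.tgt_arr φ _).trans (congrArg (Hom.obj φ) g.2.2)⟩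
  map_id x := Subtype.ext (Hom.arr_unit φ x)
  map_comp f g := Subtype.ext (Hom.arr_comp φ g.1 f.1 _)

/-- The natural transformation underlying a 2-cell. -/
def nt {G H : LieGpd.{u}} {φ ψ : G ⟶ H} (α : φ ⟶ ψ) : fn φ ⟶ fn ψ where
  app x := ⟨TwoCell.app α x, TwoCell.src_app α x, TwoCell.tgt_app α x⟩
  naturality := by
    rintro _ _ ⟨g, rfl, rfl⟩
    exact Subtype.ext (TwoCell.natural α g).symm

/-- The natural isomorphism underlying an invertible 2-cell. -/
def ntIso {G H : LieGpd.{u}} {φ ψ : G ⟶ H} (α : φ ≅ ψ) : fn φ ≅ fn ψ where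
  hom := nt α.hom
  inv := nt α.inv
  hom_inv_id := congrArg nt α.hom_inv_id
  inv_hom_id := congrArg nt α.inv_hom_id

theorem nt_ext {G H : LieGpd.{u}} {φ ψ : G ⟶ H} {α β : φ ⟶ ψ}
    (h : ∀ x, (nt α).app x = (nt β).app x) : α = β :=
  TwoCell.ext_app fun x => congrArg Subtype.val (h x)

/-- The value at a point of a 2-cell between composites. -/
def nt₂ {G H H' K : LieGpd.{u}} {φ : G ⟶ H} {ψ : H ⟶ K} {φ' : G ⟶ H'} {ψ' : H' ⟶ K}
    (α : φ ≫ ψ ⟶ φ' ≫ ψ') (x : G.Pt) :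
    (fn ψ).obj ((fn φ).obj x) ⟶ (fn ψ').obj ((fn φ').obj x) := (nt α).app x

theorem nt₂_inv_hom {G H H' K : LieGpd.{u}} {φ : G ⟶ H} {ψ : H ⟶ K} {φ' : G ⟶ H'} {ψ' : H' ⟶ K}
    (α : φ ≫ ψ ≅ φ' ≫ ψ') (x : G.Pt) : nt₂ α.inv x ≫ nt₂ α.hom x = 𝟙 _ :=
  (ntIso α).inv_hom_id_app x

theorem nt₂_hom_inv {G H H' K : LieGpd.{u}} {φ : G ⟶ H} {ψ : H ⟶ K} {φ' : G ⟶ H'} {ψ' : H' ⟶ K}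
    (α : φ ≫ ψ ≅ φ' ≫ ψ') (x : G.Pt) : nt₂ α.hom x ≫ nt₂ α.inv x = 𝟙 _ :=
  (ntIso α).hom_inv_id_app x

/-- Fullness is the lifting property for families over the one-point manifold. -/
theorem IsEssEquiv.isEquivalence_fn {G H : LieGpd.{u}} {φ : G ⟶ H} (h : IsEssEquiv φ) :
    (fn φ).IsEquivalence where
  faithful := ⟨fun {x y f g} e => Subtype.ext (h.isLocEquiv.faithful _ _ (congrArg Subtype.val e)
    (f.2.1.trans g.2.1.symm) (f.2.2.trans g.2.2.symm))⟩
  full := ⟨fun {x y} f => by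
    obtain ⟨k, h1, h2, h3⟩ := h.isLocEquiv.lift (T := Mfd.point) (Mfd.const _ x) (Mfd.const _ y)
      (Mfd.const _ f.1) (fun _ => f.2.1) (fun _ => f.2.2)
    exact ⟨⟨k PUnit.unit, h2 _, h3 _⟩, Subtype.ext (h1 _)⟩⟩
  essSurj := ⟨fun y => by
    obtain ⟨x, k, h1, h2⟩ := h.isLocEquiv.surj y
    exact ⟨x, ⟨Groupoid.isoEquivHom _ _ |>.symm ⟨k, h1, h2⟩⟩⟩⟩

end LieGpd

/-! ### Spans as functors and diagrams as natural transformations -/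

namespace Fractions

open LieGpd

section

variable {X Y Z V : LieGpd.{u}}

instance (S : Span lieW X Y) : (fn S.left).IsEquivalence := IsEssEquiv.isEquivalence_fn S.mem

/-- The functor between categories of points given by a span. -/
noncomputable def Span.func (S : Span lieW X Y) : X.Pt ⥤ Y.Pt := (fn S.left).inv ⋙ fn S.right

/-- The right leg of a span is isomorphic to the composite of the left leg and the associated
functor. -/
noncomputable def Span.funcIso (S : Span lieW X Y) : fn S.right ≅ fn S.left ⋙ S.func :=
  Functor.isoWhiskerRight (fn S.left).asEquivalence.unitIso (fn S.right)

/-- The value of `Span.funcIso` at a point. -/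
noncomputable def Span.cmp (S : Span lieW X Y) (k : S.apex.Pt) :
    (fn S.right).obj k ⟶ S.func.obj ((fn S.left).obj k) := S.funcIso.hom.app k

theorem Span.cmp_naturality (S : Span lieW X Y) {k k' : S.apex.Pt} (f : k ⟶ k') :
    (fn S.right).map f ≫ S.cmp k' = S.cmp k ≫ S.func.map ((fn S.left).map f) :=
  S.funcIso.hom.naturality f

theorem Span.evalSquare_id (S : Span lieW X Y) {k k' : S.apex.Pt} (f : k ⟶ k') :
    EvalSquare (𝟙 S.func) (S.cmp k) (S.cmp k') ((fn S.left).map f) ((fn S.right).map f) := by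
  unfold EvalSquare
  rw [NatTrans.id_app, Category.id_comp, S.cmp_naturality]

theorem Diagram.isEquivalence_fn {S S' : Span lieW X Y} (d : Diagram S S') :
    (fn (d.ν ≫ S.left)).IsEquivalence := IsEssEquiv.isEquivalence_fn d.mem

/-- The natural transformation given by a diagram. -/
noncomputable def Diagram.ev {S S' : Span lieW X Y} (d : Diagram S S') : S.func ⟶ S'.func :=
  have := d.isEquivalence_fn
  extend (fn (d.ν ≫ S.left)) (F := S.func) (F' := S'.func)
    (show fn d.ν ⋙ fn S.left ⋙ S.func ⟶ fn d.ν ⋙ fn S.left ⋙ S'.func from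
      Functor.whiskerLeft (fn d.ν) S.funcIso.inv ≫ (show fn d.ν ⋙ fn S.right ⟶ fn d.ν' ⋙ fn S'.right
        from nt d.α₂) ≫ Functor.whiskerLeft (fn d.ν') S'.funcIso.hom ≫
        (show fn d.ν' ⋙ fn S'.left ⋙ S'.func ⟶ fn d.ν ⋙ fn S.left ⋙ S'.func from
          Functor.whiskerRight (nt d.α₁.inv) S'.func))

theorem Diagram.evalSquare {S S' : Span lieW X Y} (d : Diagram S S') (l : d.apex.Pt) :
    EvalSquare d.ev (S.cmp ((fn d.ν).obj l)) (S'.cmp ((fn d.ν').obj l)) (nt₂ d.α₁.hom l)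
      (nt₂ d.α₂ l) := by
  have := d.isEquivalence_fn
  have h1 : d.ev.app ((fn S.left).obj ((fn d.ν).obj l)) = S.funcIso.inv.app ((fn d.ν).obj l) ≫
      nt₂ d.α₂ l ≫ S'.cmp ((fn d.ν').obj l) ≫ S'.func.map (nt₂ d.α₁.inv l) :=
    extend_app (fn (d.ν ≫ S.left)) (F := S.func) (F' := S'.func) _ l
  unfold EvalSquare
  rw [h1, Category.assoc, Category.assoc, Category.assoc, ← Functor.map_comp, nt₂_inv_hom,
    CategoryTheory.Functor.map_id, Category.comp_id]
  exact S.funcIso.hom_inv_id_app_assoc _ _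

/-- The functor `d.ν ≫ S.left` is essentially surjective on points, and the square at `l` determines
the component there. Evaluations of pasted diagrams are computed by exhibiting such squares. -/
theorem Diagram.ev_eq {S S' : Span lieW X Y} (d : Diagram S S') {τ : S.func ⟶ S'.func}
    (h : ∀ l, EvalSquare τ (S.cmp ((fn d.ν).obj l)) (S'.cmp ((fn d.ν').obj l)) (nt₂ d.α₁.hom l)
      (nt₂ d.α₂ l)) : d.ev = τ := by
  have := d.isEquivalence_fn
  exact natTrans_ext_of_essSurj (fn (d.ν ≫ S.left)) fun l => (d.evalSquare l).app_eq (h l)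

theorem Diagram.ev_id (S : Span lieW X Y) : (Diagram.id S).ev = 𝟙 _ :=
  Diagram.ev_eq _ fun l => EvalSquare.id (S.cmp l)

theorem Diagram.Rel.ev_eq {S S' : Span lieW X Y} {d e : Diagram S S'} (h : Diagram.Rel d e) :
    d.ev = e.ev := by
  obtain ⟨N, s, s', η, η', h1, -, h3, h4⟩ := h
  have : (fn (s ≫ d.ν ≫ S.left)).IsEquivalence := IsEssEquiv.isEquivalence_fn h1
  refine natTrans_ext_of_essSurj (fn (s ≫ d.ν ≫ S.left)) fun n => ?_
  have e1 := (d.evalSquare ((fn s).obj n)).comp (S'.evalSquare_id (nt₂ η'.hom n))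
  have e2 := (S.evalSquare_id (nt₂ η.hom n)).comp (e.evalSquare ((fn s').obj n))
  have h3' := congrArg (fun α => (nt α).app n) h3
  have h4' := congrArg (fun α => (nt α).app n) h4
  -- At a point, associators are identities and whiskering is either substitution or application of
  -- a functor.
  change 𝟙 _ ≫ nt₂ d.α₁.hom ((fn s).obj n) ≫ 𝟙 _ ≫ (fn S'.left).map (nt₂ η'.hom n) =
    (fn S.left).map (nt₂ η.hom n) ≫ 𝟙 _ ≫ nt₂ e.α₁.hom ((fn s').obj n) ≫ 𝟙 _ at h3'
  change 𝟙 _ ≫ nt₂ d.α₂ ((fn s).obj n) ≫ 𝟙 _ ≫ (fn S'.right).map (nt₂ η'.hom n) =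
    (fn S.right).map (nt₂ η.hom n) ≫ 𝟙 _ ≫ nt₂ e.α₂ ((fn s').obj n) ≫ 𝟙 _ at h4'
  simp only [Category.id_comp, Category.comp_id] at h3' h4' e1 e2
  rw [h3', h4'] at e1
  exact e1.app_eq e2

/-- The heart of faithfulness: at each point both sides, composed with the invertible `S'.cmp`, are
the same expression in the evaluation and in the left pasting. 2-cells of Lie groupoids are
determined by their values at points. -/
theorem Diagram.pasting_eq {S S' : Span lieW X Y} {d e : Diagram S S'} (h : d.ev = e.ev)
    {N : LieGpd.{u}} {s : N ⟶ d.apex} {s' : N ⟶ e.apex} {η : s ≫ d.ν ≅ s' ≫ e.ν}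
    {η' : s ≫ d.ν' ≅ s' ≫ e.ν'}
    (h3 : (α_ _ _ _).hom ≫ s ◁ d.α₁.hom ≫ (α_ _ _ _).inv ≫ η'.hom ▷ S'.left =
      η.hom ▷ S.left ≫ (α_ _ _ _).hom ≫ s' ◁ e.α₁.hom ≫ (α_ _ _ _).inv) :
    (α_ _ _ _).hom ≫ s ◁ d.α₂ ≫ (α_ _ _ _).inv ≫ η'.hom ▷ S'.right =
      η.hom ▷ S.right ≫ (α_ _ _ _).hom ≫ s' ◁ e.α₂ ≫ (α_ _ _ _).inv := by
  refine nt_ext fun n => ?_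
  have e1 := (d.evalSquare ((fn s).obj n)).comp (S'.evalSquare_id (nt₂ η'.hom n))
  have e2 := (S.evalSquare_id (nt₂ η.hom n)).comp (e.evalSquare ((fn s').obj n))
  have h3' := congrArg (fun α => (nt α).app n) h3
  change 𝟙 _ ≫ nt₂ d.α₁.hom ((fn s).obj n) ≫ 𝟙 _ ≫ (fn S'.left).map (nt₂ η'.hom n) =
    (fn S.left).map (nt₂ η.hom n) ≫ 𝟙 _ ≫ nt₂ e.α₁.hom ((fn s').obj n) ≫ 𝟙 _ at h3'
  change 𝟙 _ ≫ nt₂ d.α₂ ((fn s).obj n) ≫ 𝟙 _ ≫ (fn S'.right).map (nt₂ η'.hom n) =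
    (fn S.right).map (nt₂ η.hom n) ≫ 𝟙 _ ≫ nt₂ e.α₂ ((fn s').obj n) ≫ 𝟙 _
  simp only [Category.id_comp, Category.comp_id] at h3' e1 e2 ⊢
  rw [h3', h] at e1
  unfold EvalSquare at e1 e2
  exact (cancel_mono (S'.cmp _)).1 (e1.symm.trans e2)

theorem Diagram.rel_of_ev_eq {S S' : Span lieW X Y} {d e : Diagram S S'} (h : d.ev = e.ev) :
    Diagram.Rel d e := by
  obtain ⟨N, s, s', η, η', h1, h2, h3⟩ := LieGpd.calculus.exists_overlap d e
  exact ⟨N, s, s', η, η', h1, h2, h3, Diagram.pasting_eq h h3⟩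

/-- The squares of `d`, of the connecting 2-cell `σ` over the identity, and of `e` are pasted one
after another. -/
theorem Diagram.ev_vcomp {S S' S'' : Span lieW X Y} {d : Diagram S S'} {e : Diagram S' S''}
    (N : VComposite d e) : N.diagram.ev = d.ev ≫ e.ev := by
  refine N.diagram.ev_eq fun l => ?_
  have e1 := ((d.evalSquare ((fn N.r).obj l)).comp (S'.evalSquare_id (nt₂ N.σ.hom l))).comp
    (e.evalSquare ((fn N.r').obj l))
  have h1 : nt₂ d.α₁.hom ((fn N.r).obj l) ≫ (fn S'.left).map (nt₂ N.σ.hom l) ≫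
      nt₂ e.α₁.hom ((fn N.r').obj l) = 𝟙 _ ≫ nt₂ d.α₁.hom ((fn N.r).obj l) ≫ 𝟙 _ ≫
        (fn S'.left).map (nt₂ N.σ.hom l) ≫ 𝟙 _ ≫ nt₂ e.α₁.hom ((fn N.r').obj l) ≫ 𝟙 _ := by
    simp only [Category.id_comp, Category.comp_id]
  have h2 : nt₂ d.α₂ ((fn N.r).obj l) ≫ (fn S'.right).map (nt₂ N.σ.hom l) ≫
      nt₂ e.α₂ ((fn N.r').obj l) = 𝟙 _ ≫ nt₂ d.α₂ ((fn N.r).obj l) ≫ 𝟙 _ ≫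
        (fn S'.right).map (nt₂ N.σ.hom l) ≫ 𝟙 _ ≫ nt₂ e.α₂ ((fn N.r').obj l) ≫ 𝟙 _ := by
    simp only [Category.id_comp, Category.comp_id]
  simp only [Category.assoc, Category.id_comp] at e1
  rw [h1, h2] at e1
  exact e1

/-- The diagram obtained by exchanging the two spans, for a 2-cell `β` inverse to `d.α₂`. -/
def Diagram.inverse {C : Type w} [Bicategory.{u, v} C] {W : OneCellClass C} {X Y : C}
    {S S' : Span W X Y} (d : Diagram S S') (β : d.ν' ≫ S'.right ⟶ d.ν ≫ S.right) :
    Diagram S' S where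
  apex := d.apex
  ν := d.ν'
  ν' := d.ν
  α₁ := d.α₁.symm
  α₂ := β
  mem := d.mem'
  mem' := d.mem

theorem Diagram.ev_inverse {S S' : Span lieW X Y} (d : Diagram S S')
    {β : d.ν' ≫ S'.right ⟶ d.ν ≫ S.right} (h : d.α₂ ≫ β = 𝟙 _) (h' : β ≫ d.α₂ = 𝟙 _) :
    (d.inverse β).ev = CategoryTheory.inv d.ev := by
  let e : d.ν ≫ S.right ≅ d.ν' ≫ S'.right := ⟨d.α₂, β, h, h'⟩
  refine (d.inverse β).ev_eq fun l => ?_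
  exact (EvalSquare.symm (e := asIso d.ev)
    ⟨nt₂ d.α₁.hom l, nt₂ d.α₁.inv l, nt₂_hom_inv _ _, nt₂_inv_hom _ _⟩
    ⟨nt₂ e.hom l, nt₂ e.inv l, nt₂_hom_inv _ _, nt₂_inv_hom _ _⟩ (d.evalSquare l) :)

/-- The functor given by a composite span is the composite of the functors. -/
noncomputable def Filler.mu {S : Span lieW X Y} {T : Span lieW Y Z} (c : Filler S T) :
    c.span.func ≅ S.func ⋙ T.func :=
  asIso (extend (fn c.span.left) (F := c.span.func) (F' := S.func ⋙ T.func)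
    (c.span.funcIso.inv ≫ (show fn c.q ⋙ fn T.right ⟶ fn c.p ⋙ fn S.left ⋙ S.func ⋙ T.func from
      Functor.whiskerLeft (fn c.q) T.funcIso.hom ≫
      (show fn c.q ⋙ fn T.left ⋙ T.func ⟶ fn c.p ⋙ fn S.right ⋙ T.func from
        Functor.whiskerRight (nt c.θ.inv) T.func) ≫
      Functor.whiskerLeft (fn c.p) (Functor.whiskerRight S.funcIso.hom T.func))))

/-- The value of `Span.funcIso` at a point, for a composite span. -/
noncomputable def Filler.cmp {S : Span lieW X Y} {T : Span lieW Y Z} (c : Filler S T)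
    (k : c.apex.Pt) : (fn T.right).obj ((fn c.q).obj k) ⟶
      c.span.func.obj ((fn S.left).obj ((fn c.p).obj k)) := c.span.cmp k

theorem Filler.evalSquare {S : Span lieW X Y} {T : Span lieW Y Z} (c : Filler S T)
    (k : c.apex.Pt) :
    EvalSquare c.mu.hom (c.cmp k) (F' := S.func ⋙ T.func)
      (T.cmp ((fn c.q).obj k) ≫ T.func.map (nt₂ c.θ.inv k ≫ S.cmp ((fn c.p).obj k)))
      (𝟙 _) (𝟙 _) := by
  have h1 : c.mu.hom.app ((fn S.left).obj ((fn c.p).obj k)) = c.span.funcIso.inv.app k ≫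
      T.cmp ((fn c.q).obj k) ≫ T.func.map (nt₂ c.θ.inv k) ≫ T.func.map (S.cmp ((fn c.p).obj k)) :=
    extend_app (fn c.span.left) (F := c.span.func) (F' := S.func ⋙ T.func) _ k
  have h2 : c.cmp k ≫ c.mu.hom.app ((fn S.left).obj ((fn c.p).obj k)) =
      T.cmp ((fn c.q).obj k) ≫ T.func.map (nt₂ c.θ.inv k) ≫ T.func.map (S.cmp ((fn c.p).obj k)) :=
    (congrArg (c.cmp k ≫ ·) h1).trans (c.span.funcIso.hom_inv_id_app_assoc _ _)
  unfold EvalSquare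
  rw [CategoryTheory.Functor.map_id, Category.comp_id, Category.id_comp, Functor.map_comp]
  exact h2

theorem Filler.evalSquare_symm {S : Span lieW X Y} {T : Span lieW Y Z} (c : Filler S T)
    (k : c.apex.Pt) :
    EvalSquare c.mu.inv (F := S.func ⋙ T.func)
      (T.cmp ((fn c.q).obj k) ≫ T.func.map (nt₂ c.θ.inv k ≫ S.cmp ((fn c.p).obj k))) (c.cmp k)
      (𝟙 _) (𝟙 _) :=
  EvalSquare.symm (Iso.refl _) (Iso.refl _) (c.evalSquare k)

/-- The squares along `S` and along `T` are pasted separately and then combined by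
`EvalSquare.hcomp`. The matching condition in the middle is `compat`, rearranged by inverting the
filling 2-cells. -/
theorem Diagram.ev_hcomp {S S' : Span lieW X Y} {T T' : Span lieW Y Z} {d : Diagram S S'}
    {e : Diagram T T'} {c : Filler S T} {c' : Filler S' T'} (N : HComposite d e c c') :
    N.diagram.ev = c.mu.hom ≫ (d.ev ◫ e.ev) ≫ c'.mu.inv := by
  refine N.diagram.ev_eq fun l => ?_
  have hc := congrArg (fun α => (nt α).app l) N.compat
  change (fn S.right).map (nt₂ N.σ.hom l) ≫ 𝟙 _ ≫ nt₂ d.α₂ ((fn N.r).obj l) ≫ 𝟙 _ ≫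
      (fn S'.right).map (nt₂ N.σ'.hom l) ≫ 𝟙 _ ≫ nt₂ c'.θ.hom ((fn N.n').obj l) =
    𝟙 _ ≫ nt₂ c.θ.hom ((fn N.n).obj l) ≫ 𝟙 _ ≫ (fn T.left).map (nt₂ N.τ.hom l) ≫ 𝟙 _ ≫
      nt₂ e.α₁.hom ((fn N.r').obj l) ≫ 𝟙 _ ≫ (fn T'.left).map (nt₂ N.τ' l) ≫ 𝟙 _ at hc
  simp only [Category.id_comp, Category.comp_id] at hc
  have e1 := ((S.evalSquare_id (nt₂ N.σ.hom l)).comp (d.evalSquare ((fn N.r).obj l))).comp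
    (S'.evalSquare_id (nt₂ N.σ'.hom l))
  have e2 := ((T.evalSquare_id (nt₂ N.τ.hom l)).comp (e.evalSquare ((fn N.r').obj l))).comp
    (T'.evalSquare_id (nt₂ N.τ' l))
  have e3 := e1.hcomp e2 (nt₂ c.θ.inv ((fn N.n).obj l)) (nt₂ c'.θ.inv ((fn N.n').obj l)) (by
    rw [← cancel_mono (nt₂ c'.θ.hom ((fn N.n').obj l))]
    simp only [Category.assoc, hc, nt₂_inv_hom, Category.comp_id]
    rw [← Category.assoc, nt₂_inv_hom, Category.id_comp])
  have e4 := ((c.evalSquare ((fn N.n).obj l)).comp e3).comp (c'.evalSquare_symm ((fn N.n').obj l))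
  have h1 : (fn S.left).map (nt₂ N.σ.hom l) ≫ nt₂ d.α₁.hom ((fn N.r).obj l) ≫
      (fn S'.left).map (nt₂ N.σ'.hom l) = 𝟙 _ ≫ (fn S.left).map (nt₂ N.σ.hom l) ≫ 𝟙 _ ≫
        nt₂ d.α₁.hom ((fn N.r).obj l) ≫ 𝟙 _ ≫ (fn S'.left).map (nt₂ N.σ'.hom l) ≫ 𝟙 _ := by
    simp only [Category.id_comp, Category.comp_id]
  have h2 : (fn T.right).map (nt₂ N.τ.hom l) ≫ nt₂ e.α₂ ((fn N.r').obj l) ≫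
      (fn T'.right).map (nt₂ N.τ' l) = 𝟙 _ ≫ (fn T.right).map (nt₂ N.τ.hom l) ≫ 𝟙 _ ≫
        nt₂ e.α₂ ((fn N.r').obj l) ≫ 𝟙 _ ≫ (fn T'.right).map (nt₂ N.τ' l) ≫ 𝟙 _ := by
    simp only [Category.id_comp, Category.comp_id]
  simp only [Category.assoc, Category.id_comp, Category.comp_id] at e4
  rw [h1, h2] at e4
  exact e4

/-- The squares of `ρ`, `τ` and `κ` are combined by two uses of `EvalSquare.hcomp`, whose matching
conditions are the two compatibility equations. -/
theorem Diagram.ev_assoc {S : Span lieW X Y} {T : Span lieW Y Z} {R : Span lieW Z V}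
    {c : Filler S T} {c' : Filler T R} {a : Filler c.span R} {a' : Filler S c'.span}
    (N : AssocComparison a a') :
    N.diagram.ev = a.mu.hom ≫ Functor.whiskerRight c.mu.hom R.func ≫
      Functor.whiskerLeft S.func c'.mu.inv ≫ a'.mu.inv := by
  refine N.diagram.ev_eq fun l => ?_
  let s := (fn c.p).obj ((fn a.p).obj ((fn N.n).obj l))
  let s' := (fn a'.p).obj ((fn N.n').obj l)
  let t := (fn c.q).obj ((fn a.p).obj ((fn N.n).obj l))
  let t' := (fn c'.p).obj ((fn a'.q).obj ((fn N.n').obj l))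
  let r := (fn a.q).obj ((fn N.n).obj l)
  let r' := (fn c'.q).obj ((fn a'.q).obj ((fn N.n').obj l))
  let ρ : s ⟶ s' := (nt N.ρ.hom).app l
  let τ : t ⟶ t' := (nt N.τ.hom).app l
  let κ : r ⟶ r' := (nt N.κ.hom).app l
  let θc : (fn S.right).obj s ≅ (fn T.left).obj t := (ntIso c.θ).app _
  let θc' : (fn T.right).obj t' ≅ (fn R.left).obj r' := (ntIso c'.θ).app _
  let θa : (fn T.right).obj t ≅ (fn R.left).obj r := (ntIso a.θ).app _
  let θa' : (fn S.right).obj s' ≅ (fn T.left).obj t' := (ntIso a'.θ).app _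
  have h1 : (fn S.right).map ρ ≫ 𝟙 _ ≫ θa'.hom = 𝟙 _ ≫ 𝟙 _ ≫ θc.hom ≫ 𝟙 _ ≫ 𝟙 _ ≫
      (fn T.left).map τ ≫ 𝟙 _ ≫ 𝟙 _ := congrArg (fun α => (nt α).app l) N.compat₁
  have h2 : (fn T.right).map τ ≫ 𝟙 _ ≫ 𝟙 _ ≫ θc'.hom ≫ 𝟙 _ ≫ 𝟙 _ = 𝟙 _ ≫ 𝟙 _ ≫ θa.hom ≫ 𝟙 _ ≫
      (fn R.left).map κ := congrArg (fun α => (nt α).app l) N.compat₂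
  simp only [Category.id_comp, Category.comp_id] at h1 h2
  have e1 := (S.evalSquare_id ρ).hcomp (T.evalSquare_id τ) θc.inv θa'.inv (by
    rw [Iso.inv_comp_eq, ← Category.assoc, Iso.eq_comp_inv, h1])
  have e2 := e1.hcomp (R.evalSquare_id κ) θa.inv θc'.inv (by
    rw [Iso.inv_comp_eq, ← Category.assoc, Iso.eq_comp_inv, h2])
  have e3 : EvalSquare a.mu.hom (F' := c.span.func ⋙ R.func) (x := (fn S.left).obj s)
    (x' := (fn S.left).obj s) (a.cmp ((fn N.n).obj l))
    (R.cmp r ≫ R.func.map (θa.inv ≫ c.cmp ((fn a.p).obj ((fn N.n).obj l)))) (𝟙 _) (𝟙 _) :=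
    a.evalSquare _
  have e4 := (c.evalSquare ((fn a.p).obj ((fn N.n).obj l))).hcomp (EvalSquare.id (R.cmp r)) θa.inv
    θa.inv (by rw [Category.comp_id, Category.id_comp])
  have e5 := (EvalSquare.id (S.cmp s')).hcomp
    (c'.evalSquare_symm ((fn a'.q).obj ((fn N.n').obj l))) θa'.inv θa'.inv
    (by rw [Category.comp_id, Category.id_comp])
  have e6 : EvalSquare a'.mu.inv (F := S.func ⋙ c'.span.func) (x := (fn S.left).obj s')
    (x' := (fn S.left).obj s') (c'.cmp ((fn a'.q).obj ((fn N.n').obj l)) ≫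
      c'.span.func.map (θa'.inv ≫ S.cmp s')) (a'.cmp ((fn N.n').obj l)) (𝟙 _) (𝟙 _) :=
    a'.evalSquare_symm _
  have e7 : (R.cmp r' ≫ R.func.map (nt₂ c'.θ.inv ((fn a'.q).obj ((fn N.n').obj l)) ≫ T.cmp t')) ≫
      (T.func ⋙ R.func).map (θa'.inv ≫ S.cmp s') =
      R.cmp r' ≫ R.func.map (θc'.inv ≫ T.cmp t' ≫ T.func.map (θa'.inv ≫ S.cmp s')) := by
    rw [Category.assoc, Functor.comp_map, ← R.func.map_comp, Category.assoc]
    rfl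
  have e8 := ((e3.comp e4).comp e2).comp ((e7 ▸ e5).comp e6)
  have e9 : a.mu.hom ≫ Functor.whiskerRight c.mu.hom R.func ≫
      Functor.whiskerLeft S.func c'.mu.inv ≫ a'.mu.inv = ((a.mu.hom ≫ (c.mu.hom ◫ 𝟙 R.func)) ≫
        ((𝟙 S.func ◫ 𝟙 T.func) ◫ 𝟙 R.func)) ≫ (show (S.func ⋙ T.func) ⋙ R.func ⟶ S.func ⋙
          c'.span.func from 𝟙 S.func ◫ c'.mu.inv) ≫ a'.mu.inv := by
    ext x
    simp
  rw [e9]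
  have h3 : ((𝟙 _ ≫ 𝟙 _) ≫ (fn S.left).map ρ) ≫ 𝟙 _ ≫ 𝟙 _ =
      𝟙 _ ≫ 𝟙 _ ≫ (fn S.left).map ρ ≫ 𝟙 _ := by
    simp only [Category.id_comp, Category.comp_id]
  have h4 : ((𝟙 _ ≫ 𝟙 _) ≫ (fn R.right).map κ) ≫ 𝟙 _ ≫ 𝟙 _ =
      𝟙 _ ≫ (fn R.right).map κ ≫ 𝟙 _ ≫ 𝟙 _ := by
    simp only [Category.id_comp, Category.comp_id]
  exact e8.congr h3 h4

/-- The functor given by an identity span is the identity. -/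
noncomputable def Span.iota (h : lieW (𝟙 X)) : (Span.id X h).func ≅ 𝟭 X.Pt :=
  (Span.id X h).funcIso.symm

theorem Span.cmp_iota (h : lieW (𝟙 X)) (x : X.Pt) :
    (show x ⟶ (Span.id X h).func.obj x from (Span.id X h).cmp x) ≫ (Span.iota h).hom.app x = 𝟙 x :=
  (Span.id X h).funcIso.hom_inv_id_app x

theorem Diagram.ev_leftUnit {h : lieW (𝟙 X)} {S : Span lieW X Y} (c : Filler (Span.id X h) S)
    {d : Diagram c.span S} {h1 h2} (hd : d = ⟨c.apex, 𝟙 _, c.q, λ_ _ ≪≫ c.θ, (λ_ _).hom, h1, h2⟩) :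
    d.ev = c.mu.hom ≫ Functor.whiskerRight (Span.iota h).hom S.func := by
  subst hd
  refine Diagram.ev_eq _ fun k => ?_
  let p : X.Pt := (fn c.p).obj k
  let θ : p ≅ (fn S.left).obj ((fn c.q).obj k) := (ntIso c.θ).app k
  let r : p ⟶ (Span.id X h).func.obj p := (Span.id X h).cmp p
  have e1 : EvalSquare c.mu.hom (x := p) (x' := p) (F' := (Span.id X h).func ⋙ S.func) (c.cmp k)
    (S.cmp ((fn c.q).obj k) ≫ S.func.map (θ.inv ≫ r)) (𝟙 _) (𝟙 _) := c.evalSquare k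
  have e2 : r ≫ (Span.iota h).hom.app p = 𝟙 p := Span.cmp_iota h p
  have e3 : EvalSquare (F := (Span.id X h).func ⋙ S.func) (F' := S.func)
      (Functor.whiskerRight (Span.iota h).hom S.func) (S.cmp ((fn c.q).obj k) ≫
        S.func.map (θ.inv ≫ r)) (S.cmp ((fn c.q).obj k)) θ.hom (𝟙 _) := by
    unfold EvalSquare
    change (S.cmp ((fn c.q).obj k) ≫ S.func.map (θ.inv ≫ r)) ≫
      S.func.map ((Span.iota h).hom.app p) ≫ S.func.map θ.hom = 𝟙 _ ≫ S.cmp ((fn c.q).obj k)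
    rw [Category.assoc, ← S.func.map_comp, ← S.func.map_comp, Category.assoc, reassoc_of% e2,
      θ.inv_hom_id, S.func.map_id, Category.comp_id, Category.id_comp]
  have e4 := e1.comp e3
  rw [Category.id_comp (𝟙 _)] at e4
  exact e4

theorem Diagram.ev_rightUnit {h : lieW (𝟙 Y)} {S : Span lieW X Y} (c : Filler S (Span.id Y h))
    {d : Diagram c.span S} {h1 h2}
    (hd : d = ⟨c.apex, 𝟙 _, c.p, λ_ _, (λ_ _).hom ≫ c.θ.inv, h1, h2⟩) :
    d.ev = c.mu.hom ≫ Functor.whiskerLeft S.func (Span.iota h).hom := by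
  subst hd
  refine Diagram.ev_eq _ fun k => ?_
  let q : Y.Pt := (fn c.q).obj k
  let s := (fn c.p).obj k
  let θ : (fn S.right).obj s ≅ q := (ntIso c.θ).app k
  let r : q ⟶ (Span.id Y h).func.obj q := (Span.id Y h).cmp q
  have e1 : EvalSquare c.mu.hom (F' := S.func ⋙ (Span.id Y h).func) (c.cmp k)
    (r ≫ (Span.id Y h).func.map (θ.inv ≫ S.cmp s)) (𝟙 _) (𝟙 _) := c.evalSquare k
  have e2 : r ≫ (Span.iota h).hom.app q = 𝟙 q := Span.cmp_iota h q
  have e3 : EvalSquare (F := S.func ⋙ (Span.id Y h).func) (F' := S.func)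
      (Functor.whiskerLeft S.func (Span.iota h).hom) (r ≫ (Span.id Y h).func.map (θ.inv ≫ S.cmp s))
      (S.cmp s) (𝟙 _) θ.inv := by
    unfold EvalSquare
    rw [S.func.map_id, Category.comp_id, Functor.whiskerLeft_app, Category.assoc,
      (Span.iota h).hom.naturality, reassoc_of% e2]
    rfl
  have e4 := e1.comp e3
  rw [Category.id_comp (𝟙 _)] at e4
  exact e4

end

end Fractions

/-! ## Bicategories of fractions from evaluations -/

namespace Fractions

universe t

/-- A component may be moved along an isomorphism of its argument. This absorbs the failure of spans
to compose strictly as functors. -/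
theorem comp_app_comp {A : Type*} [Category* A] {B : Type*} [Category* B] {F F' : A ⥤ B}
    (τ : F ⟶ F')
    {y y' : A} (i : y ≅ y') {z z' : B} (m : z ⟶ F.obj y) (n : F'.obj y ⟶ z') :
    m ≫ τ.app y ≫ n = m ≫ F.map i.hom ≫ τ.app y' ≫ F'.map i.inv ≫ n := by
  rw [τ.naturality_assoc, ← F'.map_comp_assoc, i.hom_inv_id, F'.map_id, Category.id_comp]

/-- A faithful realization of spans as functors and of diagrams as natural transformations,
compatible with all the operations of a bicategory of fractions. -/
structure Realization {C : Type u} [Bicategory.{w, v} C] [Bicategory.Strict C]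
    (W : OneCellClass C) where
  Pt : C → Type t
  [cat : ∀ X, Category.{t} (Pt X)]
  fn : ∀ {X Y : C}, Span W X Y → Pt X ⥤ Pt Y
  ev : ∀ {X Y : C} {S S' : Span W X Y}, Diagram S S' → (fn S ⟶ fn S')
  ev_eq_iff : ∀ {X Y : C} {S S' : Span W X Y} (d e : Diagram S S'), ev d = ev e ↔ Diagram.Rel d e
  id_mem : ∀ X : C, W (𝟙 X)
  fill : ∀ {X Y Z : C} (S : Span W X Y) (T : Span W Y Z), Filler S T
  mu : ∀ {X Y Z : C} (S : Span W X Y) (T : Span W Y Z), fn (fill S T).span ≅ fn S ⋙ fn T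
  iota : ∀ X : C, fn (Span.id X (id_mem X)) ≅ 𝟭 (Pt X)
  ev_id : ∀ {X Y : C} (S : Span W X Y), ev (Diagram.id S) = 𝟙 (fn S)
  exists_inv : ∀ {X Y : C} {S S' : Span W X Y} (d : Diagram S S'),
    ∃ d' : Diagram S' S, ev d ≫ ev d' = 𝟙 _ ∧ ev d' ≫ ev d = 𝟙 _
  exists_v : ∀ {X Y : C} {S S' S'' : Span W X Y} (d : Diagram S S') (e : Diagram S' S''),
    Nonempty (VComposite d e)
  ev_v : ∀ {X Y : C} {S S' S'' : Span W X Y} {d : Diagram S S'} {e : Diagram S' S''}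
    (N : VComposite d e), ev N.diagram = ev d ≫ ev e
  exists_h : ∀ {X Y Z : C} {S S' : Span W X Y} {T T' : Span W Y Z} (d : Diagram S S')
    (e : Diagram T T'), Nonempty (HComposite d e (fill S T) (fill S' T'))
  ev_h : ∀ {X Y Z : C} {S S' : Span W X Y} {T T' : Span W Y Z} {d : Diagram S S'}
    {e : Diagram T T'} (N : HComposite d e (fill S T) (fill S' T')),
    ev N.diagram = (mu S T).hom ≫ (ev d ◫ ev e) ≫ (mu S' T').inv
  exists_a : ∀ {X Y Z V : C} (S : Span W X Y) (T : Span W Y Z) (R : Span W Z V),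
    Nonempty (AssocComparison (fill (fill S T).span R) (fill S (fill T R).span))
  ev_a : ∀ {X Y Z V : C} {S : Span W X Y} {T : Span W Y Z} {R : Span W Z V}
    (N : AssocComparison (fill (fill S T).span R) (fill S (fill T R).span)),
    ev N.diagram = (mu (fill S T).span R).hom ≫ Functor.whiskerRight (mu S T).hom (fn R) ≫
      Functor.whiskerLeft (fn S) (mu T R).inv ≫ (mu S (fill T R).span).inv
  ev_left : ∀ {X Y : C} (S : Span W X Y), ∃ h h', ev (S := (fill (Span.id X (id_mem X)) S).span)
    (S' := S) ⟨(fill (Span.id X (id_mem X)) S).apex, 𝟙 _, (fill (Span.id X (id_mem X)) S).q,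
      λ_ _ ≪≫ (fill (Span.id X (id_mem X)) S).θ, (λ_ _).hom, h, h'⟩ =
      (mu _ _).hom ≫ Functor.whiskerRight (iota X).hom (fn S)
  ev_right : ∀ {X Y : C} (S : Span W X Y), ∃ h h', ev (S := (fill S (Span.id Y (id_mem Y))).span)
    (S' := S) ⟨(fill S (Span.id Y (id_mem Y))).apex, 𝟙 _, (fill S (Span.id Y (id_mem Y))).p,
      λ_ _, (λ_ _).hom ≫ (fill S (Span.id Y (id_mem Y))).θ.inv, h, h'⟩ =
      (mu _ _).hom ≫ Functor.whiskerLeft (fn S) (iota Y).hom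

attribute [instance] Realization.cat

namespace Realization

variable {C : Type u} [Bicategory.{w, v} C] [Bicategory.Strict C] {W : OneCellClass C}
  (M : Realization.{u, w, v, t} W)

/-- The natural transformation given by a 2-cell between spans. -/
def evC {X Y : C} {S S' : Span W X Y} : Cell S S' → (M.fn S ⟶ M.fn S') :=
  Quot.lift M.ev fun d e h => (M.ev_eq_iff d e).2 h

theorem evC_injective {X Y : C} {S S' : Span W X Y} {a b : Cell S S'} (h : M.evC a = M.evC b) :
    a = b := by
  induction a using Quot.inductionOn with | _ d
  induction b using Quot.inductionOn with | _ e
  exact Quot.sound ((M.ev_eq_iff d e).1 h)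

theorem exists_symm {X Y : C} {S S' : Span W X Y} (a : Cell S S') :
    ∃ b : Cell S' S, M.evC a ≫ M.evC b = 𝟙 _ ∧ M.evC b ≫ M.evC a = 𝟙 _ := by
  induction a using Quot.inductionOn with | _ d
  obtain ⟨d', h⟩ := M.exists_inv d
  exact ⟨Cell.mk d', h⟩

/-- The inverse of a 2-cell. -/
noncomputable def symm {X Y : C} {S S' : Span W X Y} (a : Cell S S') : Cell S' S :=
  (M.exists_symm a).choose

theorem evC_comp_symm {X Y : C} {S S' : Span W X Y} (a : Cell S S') :
    M.evC a ≫ M.evC (M.symm a) = 𝟙 _ := (M.exists_symm a).choose_spec.1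

theorem evC_symm_comp {X Y : C} {S S' : Span W X Y} (a : Cell S S') :
    M.evC (M.symm a) ≫ M.evC a = 𝟙 _ := (M.exists_symm a).choose_spec.2

theorem exists_vcomp {X Y : C} {S S' S'' : Span W X Y} (a : Cell S S') (b : Cell S' S'') :
    ∃ c : Cell S S'', M.evC c = M.evC a ≫ M.evC b := by
  induction a using Quot.inductionOn with | _ d
  induction b using Quot.inductionOn with | _ e
  obtain ⟨N⟩ := M.exists_v d e
  exact ⟨Cell.mk N.diagram, M.ev_v N⟩

/-- Vertical composition of 2-cells. -/
noncomputable def vcomp {X Y : C} {S S' S'' : Span W X Y} (a : Cell S S') (b : Cell S' S'') :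
    Cell S S'' := (M.exists_vcomp a b).choose

theorem evC_vcomp {X Y : C} {S S' S'' : Span W X Y} (a : Cell S S') (b : Cell S' S'') :
    M.evC (M.vcomp a b) = M.evC a ≫ M.evC b := (M.exists_vcomp a b).choose_spec

theorem exists_hcomp {X Y Z : C} {S S' : Span W X Y} {T T' : Span W Y Z} (a : Cell S S')
    (b : Cell T T') : ∃ c : Cell (M.fill S T).span (M.fill S' T').span,
      M.evC c = (M.mu S T).hom ≫ (M.evC a ◫ M.evC b) ≫ (M.mu S' T').inv := by
  induction a using Quot.inductionOn with | _ d
  induction b using Quot.inductionOn with | _ e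
  obtain ⟨N⟩ := M.exists_h d e
  exact ⟨Cell.mk N.diagram, M.ev_h N⟩

/-- Horizontal composition of 2-cells. -/
noncomputable def hcomp {X Y Z : C} {S S' : Span W X Y} {T T' : Span W Y Z} (a : Cell S S')
    (b : Cell T T') : Cell (M.fill S T).span (M.fill S' T').span := (M.exists_hcomp a b).choose

theorem evC_hcomp {X Y Z : C} {S S' : Span W X Y} {T T' : Span W Y Z} (a : Cell S S')
    (b : Cell T T') :
    M.evC (M.hcomp a b) = (M.mu S T).hom ≫ (M.evC a ◫ M.evC b) ≫ (M.mu S' T').inv :=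
  (M.exists_hcomp a b).choose_spec

theorem evC_id {X Y : C} (S : Span W X Y) : M.evC (Cell.mk (Diagram.id S)) = 𝟙 _ := M.ev_id S

/-- The associator. -/
noncomputable def assoc {X Y Z V : C} (S : Span W X Y) (T : Span W Y Z) (R : Span W Z V) :
    Cell (M.fill (M.fill S T).span R).span (M.fill S (M.fill T R).span).span :=
  Cell.mk (M.exists_a S T R).some.diagram

theorem evC_assoc {X Y Z V : C} (S : Span W X Y) (T : Span W Y Z) (R : Span W Z V) :
    M.evC (M.assoc S T R) = (M.mu (M.fill S T).span R).hom ≫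
      Functor.whiskerRight (M.mu S T).hom (M.fn R) ≫
      Functor.whiskerLeft (M.fn S) (M.mu T R).inv ≫ (M.mu S (M.fill T R).span).inv := M.ev_a _

theorem evC_symm_eq {X Y : C} {S S' : Span W X Y} (a : Cell S S') (τ : M.fn S' ⟶ M.fn S)
    (h : M.evC a ≫ τ = 𝟙 _) : M.evC (M.symm a) = τ := by
  have h1 := congrArg (M.evC (M.symm a) ≫ ·) h
  simp only [← Category.assoc, evC_symm_comp, Category.id_comp, Category.comp_id] at h1
  exact h1.symm

theorem evC_symm_assoc {X Y Z V : C} (S : Span W X Y) (T : Span W Y Z) (R : Span W Z V) :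
    M.evC (M.symm (M.assoc S T R)) = (M.mu S (M.fill T R).span).hom ≫
      Functor.whiskerLeft (M.fn S) (M.mu T R).hom ≫
      Functor.whiskerRight (M.mu S T).inv (M.fn R) ≫ (M.mu (M.fill S T).span R).inv := by
  refine M.evC_symm_eq _ _ ?_
  rw [evC_assoc]
  ext x
  simp [← Functor.map_comp_assoc]

/-- The left unitor. -/
noncomputable def leftUnit {X Y : C} (S : Span W X Y) :
    Cell (M.fill (Span.id X (M.id_mem X)) S).span S :=
  Cell.mk ⟨(M.fill (Span.id X (M.id_mem X)) S).apex, 𝟙 _, (M.fill (Span.id X (M.id_mem X)) S).q,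
      λ_ _ ≪≫ (M.fill (Span.id X (M.id_mem X)) S).θ, (λ_ _).hom, (M.ev_left S).choose,
      (M.ev_left S).choose_spec.choose⟩

theorem evC_leftUnit {X Y : C} (S : Span W X Y) : M.evC (M.leftUnit S) =
    (M.mu _ _).hom ≫ Functor.whiskerRight (M.iota X).hom (M.fn S) :=
  (M.ev_left S).choose_spec.choose_spec

theorem evC_symm_leftUnit {X Y : C} (S : Span W X Y) : M.evC (M.symm (M.leftUnit S)) =
    (show M.fn S ⟶ M.fn (Span.id X (M.id_mem X)) ⋙ M.fn S from
      Functor.whiskerRight (M.iota X).inv (M.fn S)) ≫ (M.mu _ _).inv := by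
  refine M.evC_symm_eq _ _ ?_
  rw [evC_leftUnit]
  ext x
  simp [← Functor.map_comp_assoc]

/-- The right unitor. -/
noncomputable def rightUnit {X Y : C} (S : Span W X Y) :
    Cell (M.fill S (Span.id Y (M.id_mem Y))).span S :=
  Cell.mk ⟨(M.fill S (Span.id Y (M.id_mem Y))).apex, 𝟙 _, (M.fill S (Span.id Y (M.id_mem Y))).p,
      λ_ _, (λ_ _).hom ≫ (M.fill S (Span.id Y (M.id_mem Y))).θ.inv, (M.ev_right S).choose,
      (M.ev_right S).choose_spec.choose⟩

theorem evC_rightUnit {X Y : C} (S : Span W X Y) : M.evC (M.rightUnit S) =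
    (M.mu _ _).hom ≫ Functor.whiskerLeft (M.fn S) (M.iota Y).hom :=
  (M.ev_right S).choose_spec.choose_spec

theorem evC_symm_rightUnit {X Y : C} (S : Span W X Y) : M.evC (M.symm (M.rightUnit S)) =
    (show M.fn S ⟶ M.fn S ⋙ M.fn (Span.id Y (M.id_mem Y)) from
      Functor.whiskerLeft (M.fn S) (M.iota Y).inv) ≫ (M.mu _ _).inv := by
  refine M.evC_symm_eq _ _ ?_
  rw [evC_rightUnit]
  ext x
  simp

/-- The bicategory of fractions determined by a realization. -/
noncomputable def fractionBicategory : FractionBicategory W where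
  id_mem := M.id_mem
  fill := M.fill
  vcomp a b := M.vcomp a b
  -- Here and below an equation of 2-cells is proved by evaluating both sides, where it becomes an
  -- identity of natural transformations.
  vcomp_mk d e N := M.evC_injective ((M.evC_vcomp _ _).trans (M.ev_v N).symm)
  exists_vcomposite := M.exists_v
  whiskerL S _ _ b := M.hcomp (Cell.mk (Diagram.id S)) b
  whiskerL_mk S _ _ e N := M.evC_injective ((M.evC_hcomp _ _).trans (M.ev_h N).symm)
  exists_whiskerL S _ _ e := M.exists_h _ e
  whiskerR a T := M.hcomp a (Cell.mk (Diagram.id T))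
  whiskerR_mk d T N := M.evC_injective ((M.evC_hcomp _ _).trans (M.ev_h N).symm)
  exists_whiskerR d T := M.exists_h d _
  assoc := M.assoc
  assocInv S T R := M.symm (M.assoc S T R)
  assoc_mk S T R N := M.evC_injective ((M.evC_assoc S T R).trans (M.ev_a N).symm)
  exists_assoc := M.exists_a
  leftUnit := M.leftUnit
  leftUnitInv S := M.symm (M.leftUnit S)
  leftUnit_mk S := ⟨_, _, rfl⟩
  rightUnit := M.rightUnit
  rightUnitInv S := M.symm (M.rightUnit S)
  rightUnit_mk S := ⟨_, _, rfl⟩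
  id_vcomp a := M.evC_injective (by rw [evC_vcomp, evC_id, Category.id_comp])
  vcomp_id a := M.evC_injective (by rw [evC_vcomp, evC_id, Category.comp_id])
  vcomp_assoc a b c := M.evC_injective (by simp only [evC_vcomp, Category.assoc])
  assoc_assocInv S T R := M.evC_injective (by rw [evC_vcomp, evC_comp_symm, evC_id])
  assocInv_assoc S T R := M.evC_injective (by rw [evC_vcomp, evC_symm_comp, evC_id])
  leftUnit_leftUnitInv S := M.evC_injective (by rw [evC_vcomp, evC_comp_symm, evC_id])
  leftUnitInv_leftUnit S := M.evC_injective (by rw [evC_vcomp, evC_symm_comp, evC_id])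
  rightUnit_rightUnitInv S := M.evC_injective (by rw [evC_vcomp, evC_comp_symm, evC_id])
  rightUnitInv_rightUnit S := M.evC_injective (by rw [evC_vcomp, evC_symm_comp, evC_id])
  whiskerL_id S T := M.evC_injective (by
    simp only [evC_hcomp, evC_id]
    ext x
    simp)
  whiskerL_comp S _ _ _ a b := M.evC_injective (by
    simp only [evC_hcomp, evC_vcomp, evC_id]
    ext x
    simp)
  id_whiskerL a := M.evC_injective (by
    simp only [evC_hcomp, evC_vcomp, evC_id, evC_leftUnit, evC_symm_leftUnit]
    ext x
    simp only [NatTrans.comp_app, NatTrans.hcomp_app, NatTrans.id_app, Functor.whiskerRight_app,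
      Category.assoc, CategoryTheory.Functor.map_id, Category.comp_id]
    exact comp_app_comp (M.evC a) ((M.iota _).app x) _ _)
  comp_whiskerL S T _ _ a := M.evC_injective (by
    simp only [evC_hcomp, evC_vcomp, evC_id, evC_assoc, evC_symm_assoc]
    ext x
    simp only [NatTrans.comp_app, NatTrans.hcomp_app, NatTrans.id_app, Functor.whiskerRight_app,
      Functor.whiskerLeft_app, Category.assoc, CategoryTheory.Functor.map_id, Category.comp_id,
      Iso.inv_hom_id_app_assoc]
    exact comp_app_comp (M.evC a) ((M.mu S T).app x) _ _)
  id_whiskerR S T := M.evC_injective (by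
    simp only [evC_hcomp, evC_id]
    ext x
    simp)
  comp_whiskerR a b T := M.evC_injective (by
    simp only [evC_hcomp, evC_vcomp, evC_id]
    ext x
    simp)
  whiskerR_id a := M.evC_injective (by
    simp only [evC_hcomp, evC_vcomp, evC_id, evC_rightUnit, evC_symm_rightUnit]
    ext x
    have h := fun Z => (M.iota _).hom.naturality_assoc (Z := Z) ((M.evC a).app x)
    simp only [Functor.id_map] at h
    simp [← h])
  whiskerR_comp a T R := M.evC_injective (by
    simp only [evC_hcomp, evC_vcomp, evC_id, evC_assoc, evC_symm_assoc]
    ext x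
    have h := fun Z => (M.mu T R).hom.naturality_assoc (Z := Z) ((M.evC a).app x)
    simp only [Functor.comp_map] at h
    simp [← h])
  whisker_assoc S _ _ a R := M.evC_injective (by
    simp only [evC_hcomp, evC_vcomp, evC_id, evC_assoc, evC_symm_assoc]
    ext x
    simp)
  whisker_exchange a b := M.evC_injective (by
    simp only [evC_hcomp, evC_vcomp, evC_id]
    ext x
    simp)
  pentagon S T R Q := M.evC_injective (by
    simp only [evC_hcomp, evC_vcomp, evC_id, evC_assoc]
    ext x
    -- The comparisons for the pairs `S`, `T` and `R`, `Q` are independent. Their interchange is the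
    -- one ingredient beyond cancellation.
    have h := fun Z => (M.mu R Q).inv.naturality_assoc (Z := Z) ((M.mu S T).hom.app x)
    simp only [Functor.comp_map] at h
    simp
    exact congrArg ((M.fn Q).map ((M.mu _ R).hom.app x) ≫ ·) (h _ _))
  triangle S T := M.evC_injective (by
    simp only [evC_hcomp, evC_vcomp, evC_id, evC_assoc, evC_leftUnit, evC_rightUnit]
    ext x
    simp)

end Realization

end Fractions

/-! ## Existence of the two bicategories of fractions -/

namespace Fractions

open LieGpd TransGpd

theorem exists_lieFiller {X Y Z : LieGpd.{u}} (S : Span lieW X Y) (T : Span lieW Y Z) :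
    ∃ c : Filler S T, IsWeakFibreProduct c.θ.hom := by
  obtain ⟨P, p, q, θ, h⟩ := IsEssEquiv.exists_weakFibreProduct S.right T.mem
  exact ⟨⟨P, p, q, TwoCell.iso θ, LieGpd.calculus.comp_mem
    (h.isLocEquiv T.mem.isLocEquiv).isEssEquiv S.mem⟩, h⟩

theorem exists_eqFiller {A B D : TransGpd.{u}} (S : Span eqW A B) (T : Span eqW B D) :
    ∃ c : Filler S T, IsWeakFibreProduct (inclFiller c).θ.hom := by
  obtain ⟨P, p, q, θ, h⟩ := TransGpd.exists_weakFibreProduct S.right T.mem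
  exact ⟨⟨P, p, q, θ, TransGpd.calculus.comp_mem
    (h.isLocEquiv T.mem.isLocEquiv).isEssEquiv S.mem⟩, h⟩

/-- The realization of the spans of Lie groupoids on points, for given filling squares. -/
noncomputable def lieRealization
    (fill : ∀ {X Y Z : LieGpd.{u}} (S : Span lieW X Y) (T : Span lieW Y Z), Filler S T) :
    Realization lieW.{u} where
  Pt := LieGpd.Pt
  fn := Span.func
  ev := Diagram.ev
  ev_eq_iff _ _ := ⟨Diagram.rel_of_ev_eq, Diagram.Rel.ev_eq⟩
  id_mem := LieGpd.calculus.id_mem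
  fill := fill
  mu S T := (fill S T).mu
  iota _ := Span.iota _
  ev_id := Diagram.ev_id
  exists_inv d := by
    have := LieGpd.calculus.isIso d.α₂
    have h := d.ev_inverse (IsIso.hom_inv_id d.α₂) (IsIso.inv_hom_id d.α₂)
    exact ⟨d.inverse _, by rw [h, IsIso.hom_inv_id], by rw [h, IsIso.inv_hom_id]⟩
  exists_v := LieGpd.calculus.exists_vcomposite
  ev_v N := Diagram.ev_vcomp N
  exists_h d e := LieGpd.calculus.exists_hcomposite d e _ _
  ev_h N := Diagram.ev_hcomp N
  exists_a _ _ _ := LieGpd.calculus.exists_assocComparison _ _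
  ev_a N := Diagram.ev_assoc N
  ev_left {X _} S := by
    let c := fill (Span.id X (LieGpd.calculus.id_mem X)) S
    exact ⟨LieGpd.calculus.of_iso (λ_ (c.p ≫ 𝟙 X)).symm c.mem,
      LieGpd.calculus.of_iso c.θ c.mem, Diagram.ev_leftUnit c rfl⟩
  ev_right {_ Y} S := by
    let c := fill S (Span.id Y (LieGpd.calculus.id_mem Y))
    exact ⟨LieGpd.calculus.of_iso (λ_ (c.p ≫ S.left)).symm c.mem, c.mem, Diagram.ev_rightUnit c rfl⟩

theorem nonempty_lieFractions : Nonempty LieFractions.{u} :=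
  ⟨{ (lieRealization fun S T => (exists_lieFiller S T).choose).fractionBicategory with
    weakFibreProduct := fun S T => (exists_lieFiller S T).choose_spec }⟩

end Fractions

/-! ### Evaluation of diagrams of equivariant maps -/

namespace TransGpd

open Fractions

/-- The inclusion on vertical composites. -/
noncomputable def inclVComposite {A B : TransGpd.{u}} {S S' S'' : Span eqW A B} {d : Diagram S S'}
    {e : Diagram S' S''} (N : VComposite d e) : VComposite (inclDiagram d) (inclDiagram e) where
  apex := N.apex.toLieGpd
  r := Hom.toLieGpd N.r
  r' := Hom.toLieGpd N.r'
  σ := inclIso N.σ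
  mem := N.mem
  mem' := N.mem'

/-- The inclusion on horizontal composites. -/
noncomputable def inclHComposite {A B D : TransGpd.{u}} {S S' : Span eqW A B} {T T' : Span eqW B D}
    {d : Diagram S S'} {e : Diagram T T'} {c : Filler S T} {c' : Filler S' T'}
    (N : HComposite d e c c') :
    HComposite (inclDiagram d) (inclDiagram e) (inclFiller c) (inclFiller c') where
  apex := N.apex.toLieGpd
  n := Hom.toLieGpd N.n
  n' := Hom.toLieGpd N.n'
  r := Hom.toLieGpd N.r
  r' := Hom.toLieGpd N.r'
  σ := inclIso N.σ
  σ' := inclIso N.σ'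
  τ := inclIso N.τ
  τ' := N.τ'
  compat := N.compat
  mem := N.mem
  mem' := N.mem'

/-- The inclusion on comparisons of triple composites. -/
noncomputable def inclAssocComparison {A B D E : TransGpd.{u}} {S : Span eqW A B} {T : Span eqW B D}
    {R : Span eqW D E} {c : Filler S T} {c' : Filler T R} {a : Filler c.span R}
    {a' : Filler S c'.span} (N : AssocComparison a a') :
    AssocComparison (S := inclSpan S) (T := inclSpan T) (R := inclSpan R) (c := inclFiller c)
      (c' := inclFiller c') (inclFiller a) (inclFiller a') where
  apex := N.apex.toLieGpd
  n := Hom.toLieGpd N.n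
  n' := Hom.toLieGpd N.n'
  ρ := inclIso N.ρ
  τ := inclIso N.τ
  κ := inclIso N.κ
  compat₁ := N.compat₁
  compat₂ := N.compat₂
  mem := N.mem
  mem' := N.mem'

theorem rel_inclDiagram {A B : TransGpd.{u}} {S S' : Span eqW A B} {d e : Diagram S S'}
    (h : Diagram.Rel d e) : Diagram.Rel (inclDiagram d) (inclDiagram e) := by
  obtain ⟨N, s, s', η, η', h₁, h₂, h₃, h₄⟩ := h
  exact ⟨N.toLieGpd, Hom.toLieGpd s, Hom.toLieGpd s', inclIso η, inclIso η', h₁, h₂, h₃, h₄⟩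

/-- The overlap is found among translation groupoids, while the remaining equation is tested on
points of the underlying Lie groupoids. This gives faithfulness of the inclusion on 2-cells. -/
theorem ev_inclDiagram_eq_iff {A B : TransGpd.{u}} {S S' : Span eqW A B} (d e : Diagram S S') :
    (inclDiagram d).ev = (inclDiagram e).ev ↔ Diagram.Rel d e := by
  refine ⟨fun h => ?_, fun h => (rel_inclDiagram h).ev_eq⟩
  obtain ⟨N, s, s', η, η', h1, h2, h3⟩ := calculus.exists_overlap d e
  exact ⟨N, s, s', η, η', h1, h2, h3, Diagram.pasting_eq (d := inclDiagram d) (e := inclDiagram e)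
    (s := Hom.toLieGpd s) (s' := Hom.toLieGpd s') (η := inclIso η) (η' := inclIso η') h h3⟩

/-- The realization of the spans of equivariant maps on points, for given filling squares. -/
noncomputable def eqRealization
    (fill : ∀ {A B D : TransGpd.{u}} (S : Span eqW A B) (T : Span eqW B D), Filler S T) :
    Realization eqW.{u} where
  Pt A := A.toLieGpd.Pt
  fn S := (inclSpan S).func
  ev d := (inclDiagram d).ev
  ev_eq_iff := ev_inclDiagram_eq_iff
  id_mem := calculus.id_mem
  fill := fill
  mu S T := (inclFiller (fill S T)).mu
  iota A := Span.iota (LieGpd.calculus.id_mem A.toLieGpd)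
  ev_id S := Diagram.ev_id (inclSpan S)
  exists_inv d := by
    have := calculus.isIso d.α₂
    have h := (inclDiagram d).ev_inverse (IsIso.hom_inv_id d.α₂) (IsIso.inv_hom_id d.α₂)
    exact ⟨d.inverse _, (congrArg (_ ≫ ·) h).trans (IsIso.hom_inv_id _),
      (congrArg (· ≫ _) h).trans (IsIso.inv_hom_id _)⟩
  exists_v := calculus.exists_vcomposite
  ev_v N := Diagram.ev_vcomp (inclVComposite N)
  exists_h d e := calculus.exists_hcomposite d e _ _
  ev_h N := Diagram.ev_hcomp (inclHComposite N)
  exists_a _ _ _ := calculus.exists_assocComparison _ _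
  ev_a N := Diagram.ev_assoc (inclAssocComparison N)
  ev_left {A _} S := by
    let c := fill (Span.id A (calculus.id_mem A)) S
    exact ⟨calculus.of_iso (λ_ (c.p ≫ 𝟙 A)).symm c.mem, calculus.of_iso c.θ c.mem,
      Diagram.ev_leftUnit (inclFiller c) rfl⟩
  ev_right {_ B} S := by
    let c := fill S (Span.id B (calculus.id_mem B))
    exact ⟨calculus.of_iso (λ_ (c.p ≫ S.left)).symm c.mem, c.mem,
      Diagram.ev_rightUnit (inclFiller c) rfl⟩

theorem nonempty_eqTrFractions : Nonempty EqTrFractions.{u} :=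
  ⟨{ (eqRealization fun S T => (exists_eqFiller S T).choose).fractionBicategory with
    weakFibreProduct := fun S T => (exists_eqFiller S T).choose_spec }⟩

end TransGpd

/-! ## The homomorphism of bicategories induced by the inclusion -/

namespace Fractions

open LieGpd TransGpd

theorem id_hcomp_eq {X : Type*} [Category* X] {Y : Type*} [Category* Y] {Z : Type*} [Category* Z]
    (F : X ⥤ Y) {G G' : Y ⥤ Z} (τ : G ⟶ G') : 𝟙 F ◫ τ = Functor.whiskerLeft F τ := by
  ext x
  simp

theorem hcomp_id_eq {X : Type*} [Category* X] {Y : Type*} [Category* Y] {Z : Type*} [Category* Z]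
    {F F' : X ⥤ Y} (τ : F ⟶ F') (G : Y ⥤ Z) : τ ◫ 𝟙 G = Functor.whiskerRight τ G := by
  ext x
  simp

/-! ### 2-cells in an arbitrary bicategory of fractions of Lie groupoids -/

section

variable {X Y Z V : LieGpd.{u}}

/-- The natural transformation given by a 2-cell between spans of Lie groupoids. -/
noncomputable def Cell.ev {S S' : Span lieW X Y} : Cell S S' → (S.func ⟶ S'.func) :=
  Quot.lift Diagram.ev fun _ _ h => h.ev_eq

theorem Cell.ev_injective {S S' : Span lieW X Y} {a b : Cell S S'} (h : a.ev = b.ev) : a = b := by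
  induction a using Quot.inductionOn with | _ d
  induction b using Quot.inductionOn with | _ e
  exact Quot.sound (Diagram.rel_of_ev_eq h)

theorem Cell.ev_id (S : Span lieW X Y) : (Cell.mk (Diagram.id S)).ev = 𝟙 _ := Diagram.ev_id S

theorem Cell.exists_inv {S S' : Span lieW X Y} (a : Cell S S') :
    ∃ b : Cell S' S, b.ev = CategoryTheory.inv a.ev := by
  induction a using Quot.inductionOn with | _ d
  have := LieGpd.calculus.isIso d.α₂
  exact ⟨Cell.mk (d.inverse (CategoryTheory.inv d.α₂)),
    d.ev_inverse (IsIso.hom_inv_id d.α₂) (IsIso.inv_hom_id d.α₂)⟩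

/-- The inverse of a 2-cell between spans. -/
noncomputable def Cell.inverse {S S' : Span lieW X Y} (a : Cell S S') : Cell S' S :=
  a.exists_inv.choose

theorem Cell.ev_inverse {S S' : Span lieW X Y} (a : Cell S S') :
    a.inverse.ev = CategoryTheory.inv a.ev := a.exists_inv.choose_spec

variable (𝓑 : FractionBicategory lieW.{u})

/-- The operations of an arbitrary `FractionBicategory` are pinned down by pasting: a pasted diagram
exists, and the operation must equal its class. The same reasoning evaluates whiskering, associators
and unitors. -/
theorem ev_vcomp {S S' S'' : Span lieW X Y} (a : Cell S S') (b : Cell S' S'') :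
    (𝓑.vcomp a b).ev = a.ev ≫ b.ev := by
  induction a using Quot.inductionOn with | _ d
  induction b using Quot.inductionOn with | _ e
  obtain ⟨N⟩ := 𝓑.exists_vcomposite d e
  exact (congrArg Cell.ev (𝓑.vcomp_mk d e N)).trans (Diagram.ev_vcomp N)

theorem ev_whiskerL (S : Span lieW X Y) {T T' : Span lieW Y Z} (b : Cell T T') :
    (𝓑.whiskerL S b).ev = (𝓑.fill S T).mu.hom ≫ Functor.whiskerLeft S.func b.ev ≫
      (𝓑.fill S T').mu.inv := by
  induction b using Quot.inductionOn with | _ e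
  obtain ⟨N⟩ := 𝓑.exists_whiskerL S e
  refine (congrArg Cell.ev (𝓑.whiskerL_mk S e N)).trans ((Diagram.ev_hcomp N).trans ?_)
  rw [Diagram.ev_id, id_hcomp_eq]
  rfl

theorem ev_whiskerR {S S' : Span lieW X Y} (a : Cell S S') (T : Span lieW Y Z) :
    (𝓑.whiskerR a T).ev = (𝓑.fill S T).mu.hom ≫ Functor.whiskerRight a.ev T.func ≫
      (𝓑.fill S' T).mu.inv := by
  induction a using Quot.inductionOn with | _ d
  obtain ⟨N⟩ := 𝓑.exists_whiskerR d T
  refine (congrArg Cell.ev (𝓑.whiskerR_mk d T N)).trans ((Diagram.ev_hcomp N).trans ?_)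
  rw [Diagram.ev_id, hcomp_id_eq]
  rfl

theorem ev_assoc (S : Span lieW X Y) (T : Span lieW Y Z) (R : Span lieW Z V) :
    (𝓑.assoc S T R).ev = (𝓑.fill (𝓑.fill S T).span R).mu.hom ≫
      Functor.whiskerRight (𝓑.fill S T).mu.hom R.func ≫
      Functor.whiskerLeft S.func (𝓑.fill T R).mu.inv ≫ (𝓑.fill S (𝓑.fill T R).span).mu.inv := by
  obtain ⟨N⟩ := 𝓑.exists_assoc S T R
  exact (congrArg Cell.ev (𝓑.assoc_mk S T R N)).trans (Diagram.ev_assoc N)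

theorem ev_leftUnit (S : Span lieW X Y) : (𝓑.leftUnit S).ev =
    (𝓑.fill (Span.id X (𝓑.id_mem X)) S).mu.hom ≫
      Functor.whiskerRight (Span.iota (𝓑.id_mem X)).hom S.func := by
  obtain ⟨h, h', e⟩ := 𝓑.leftUnit_mk S
  exact (congrArg Cell.ev e).trans (Diagram.ev_leftUnit _ rfl)

theorem ev_rightUnit (S : Span lieW X Y) : (𝓑.rightUnit S).ev =
    (𝓑.fill S (Span.id Y (𝓑.id_mem Y))).mu.hom ≫
      Functor.whiskerLeft S.func (Span.iota (𝓑.id_mem Y)).hom := by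
  obtain ⟨h, h', e⟩ := 𝓑.rightUnit_mk S
  exact (congrArg Cell.ev e).trans (Diagram.ev_rightUnit _ rfl)

variable {𝓑} in
/-- Every 2-cell of the bicategory of fractions is invertible. -/
noncomputable def cellIso {P : LieGpd.{u} → Prop} {A B : Obj 𝓑 P} {S S' : A ⟶ B}
    (a : Cell (W := lieW) (X := A.obj) (Y := B.obj) S S') : S ≅ S' where
  hom := a
  inv := a.inverse
  hom_inv_id := Cell.ev_injective ((ev_vcomp 𝓑 _ _).trans (by
    rw [a.ev_inverse, IsIso.hom_inv_id]
    exact (Cell.ev_id _).symm))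
  inv_hom_id := Cell.ev_injective ((ev_vcomp 𝓑 _ _).trans (by
    rw [a.ev_inverse, IsIso.inv_hom_id]
    exact (Cell.ev_id _).symm))

/-- The canonical 2-cell between the composites of two spans along two filling squares. -/
noncomputable def compareCell {S : Span lieW X Y} {T : Span lieW Y Z} (c c' : Filler S T) :
    Cell c.span c'.span :=
  Cell.mk (LieGpd.calculus.exists_hcomposite (Diagram.id S) (Diagram.id T) c c').some.diagram

/-- The value does not depend on `N`, so by faithfulness all pasted comparisons of two filling
squares are the same 2-cell. -/
theorem ev_hcomposite_id {S : Span lieW X Y} {T : Span lieW Y Z} {c c' : Filler S T}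
    (N : HComposite (Diagram.id S) (Diagram.id T) c c') :
    N.diagram.ev = c.mu.hom ≫ c'.mu.inv := by
  rw [Diagram.ev_hcomp, Diagram.ev_id, Diagram.ev_id]
  ext x
  simp

theorem ev_compareCell {S : Span lieW X Y} {T : Span lieW Y Z} (c c' : Filler S T) :
    (compareCell c c').ev = c.mu.hom ≫ c'.mu.inv := ev_hcomposite_id _

theorem ev_compareCell_inverse {S : Span lieW X Y} {T : Span lieW Y Z} (c c' : Filler S T) :
    (compareCell c c').inverse.ev = c'.mu.hom ≫ c.mu.inv := by
  rw [Cell.ev_inverse, ev_compareCell]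
  simp

end

/-! ### Evaluation of the included equivariant 2-cells -/

section

variable (𝓐 : FractionBicategory eqW.{u}) {A B D E : TransGpd.{u}}

theorem inclCell_injective {S S' : Span eqW A B} {a b : Cell S S'} (h : inclCell a = inclCell b) :
    a = b := by
  induction a using Quot.inductionOn with | _ d
  induction b using Quot.inductionOn with | _ e
  exact Quot.sound ((ev_inclDiagram_eq_iff d e).1 (congrArg Cell.ev h))

theorem ev_inclCell_vcomp {S S' S'' : Span eqW A B} (a : Cell S S') (b : Cell S' S'') :
    (inclCell (𝓐.vcomp a b)).ev = (inclCell a).ev ≫ (inclCell b).ev := by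
  induction a using Quot.inductionOn with | _ d
  induction b using Quot.inductionOn with | _ e
  obtain ⟨N⟩ := 𝓐.exists_vcomposite d e
  exact (congrArg (fun a => (inclCell a).ev) (𝓐.vcomp_mk d e N)).trans
    (Diagram.ev_vcomp (inclVComposite N))

/-- The functor given by the inclusion of a composite of spans of equivariant maps. -/
noncomputable def inclMu (S : Span eqW A B) (T : Span eqW B D) :
    (inclSpan (𝓐.fill S T).span).func ≅ (inclSpan S).func ⋙ (inclSpan T).func :=
  (inclFiller (𝓐.fill S T)).mu

theorem ev_inclCell_whiskerL (S : Span eqW A B) {T T' : Span eqW B D} (b : Cell T T') :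
    (inclCell (𝓐.whiskerL S b)).ev = (inclMu 𝓐 S T).hom ≫
      Functor.whiskerLeft (inclSpan S).func (inclCell b).ev ≫
      (inclMu 𝓐 S T').inv := by
  induction b using Quot.inductionOn with | _ e
  obtain ⟨N⟩ := 𝓐.exists_whiskerL S e
  refine (congrArg (fun a => (inclCell a).ev) (𝓐.whiskerL_mk S e N)).trans
    ((Diagram.ev_hcomp (inclHComposite N)).trans ?_)
  have h : (inclDiagram (Diagram.id S)).ev = 𝟙 _ := Diagram.ev_id (inclSpan S)
  rw [h, id_hcomp_eq]
  rfl

theorem ev_inclCell_whiskerR {S S' : Span eqW A B} (a : Cell S S') (T : Span eqW B D) :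
    (inclCell (𝓐.whiskerR a T)).ev = (inclMu 𝓐 S T).hom ≫
      Functor.whiskerRight (inclCell a).ev (inclSpan T).func ≫
      (inclMu 𝓐 S' T).inv := by
  induction a using Quot.inductionOn with | _ d
  obtain ⟨N⟩ := 𝓐.exists_whiskerR d T
  refine (congrArg (fun a => (inclCell a).ev) (𝓐.whiskerR_mk d T N)).trans
    ((Diagram.ev_hcomp (inclHComposite N)).trans ?_)
  have h : (inclDiagram (Diagram.id T)).ev = 𝟙 _ := Diagram.ev_id (inclSpan T)
  rw [h, hcomp_id_eq]
  rfl

theorem ev_inclCell_assoc (S : Span eqW A B) (T : Span eqW B D) (R : Span eqW D E) :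
    (inclCell (𝓐.assoc S T R)).ev =
      (inclMu 𝓐 (𝓐.fill S T).span R).hom ≫
      Functor.whiskerRight (inclMu 𝓐 S T).hom (inclSpan R).func ≫
      Functor.whiskerLeft (inclSpan S).func (inclMu 𝓐 T R).inv ≫
      (inclMu 𝓐 S (𝓐.fill T R).span).inv := by
  obtain ⟨N⟩ := 𝓐.exists_assoc S T R
  exact (congrArg (fun a => (inclCell a).ev) (𝓐.assoc_mk S T R N)).trans
    (Diagram.ev_assoc (inclAssocComparison N))

theorem ev_inclCell_leftUnit (S : Span eqW A B) : (inclCell (𝓐.leftUnit S)).ev =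
    (inclMu 𝓐 (Span.id A (𝓐.id_mem A)) S).hom ≫
      Functor.whiskerRight (Span.iota (𝓐.id_mem A)).hom (inclSpan S).func := by
  obtain ⟨h, h', e⟩ := 𝓐.leftUnit_mk S
  exact (congrArg (fun a => (inclCell a).ev) e).trans
    (Diagram.ev_leftUnit (inclFiller (𝓐.fill (Span.id A (𝓐.id_mem A)) S)) rfl)

theorem ev_inclCell_rightUnit (S : Span eqW A B) : (inclCell (𝓐.rightUnit S)).ev =
    (inclMu 𝓐 S (Span.id B (𝓐.id_mem B))).hom ≫
      Functor.whiskerLeft (inclSpan S).func (Span.iota (𝓐.id_mem B)).hom := by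
  obtain ⟨h, h', e⟩ := 𝓐.rightUnit_mk S
  exact (congrArg (fun a => (inclCell a).ev) e).trans
    (Diagram.ev_rightUnit (inclFiller (𝓐.fill S (Span.id B (𝓐.id_mem B)))) rfl)

end

/-! ### Compatibility of the inclusion with composition and units -/

section

variable (𝓐 : FractionBicategory eqW.{u}) (𝓑 : FractionBicategory lieW.{u}) {A B D E : TransGpd.{u}}

/-- The comparison of the composites of spans of equivariant maps in the two bicategories of
fractions. -/
noncomputable def inclComp (S : Span eqW A B) (T : Span eqW B D) :
    Cell (inclSpan (𝓐.fill S T).span) (𝓑.fill (inclSpan S) (inclSpan T)).span :=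
  compareCell (inclFiller (𝓐.fill S T)) (𝓑.fill (inclSpan S) (inclSpan T))

theorem ev_inclComp (S : Span eqW A B) (T : Span eqW B D) : (inclComp 𝓐 𝓑 S T).ev =
    (inclMu 𝓐 S T).hom ≫ (𝓑.fill (inclSpan S) (inclSpan T)).mu.inv :=
  ev_compareCell _ _

theorem ev_inclComp_inverse (S : Span eqW A B) (T : Span eqW B D) :
    (inclComp 𝓐 𝓑 S T).inverse.ev =
      (𝓑.fill (inclSpan S) (inclSpan T)).mu.hom ≫ (inclMu 𝓐 S T).inv :=
  ev_compareCell_inverse _ _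

/-- After evaluation, the functor comparisons belonging to `𝓑` occur in inverse pairs and cancel,
leaving those belonging to `𝓐`. -/
theorem inclCell_whiskerL (S : Span eqW A B) {T T' : Span eqW B D} (b : Cell T T') :
    inclCell (𝓐.whiskerL S b) = 𝓑.vcomp (inclComp 𝓐 𝓑 S T) (𝓑.vcomp
      (𝓑.whiskerL (inclSpan S) (inclCell b)) (inclComp 𝓐 𝓑 S T').inverse) := by
  refine Cell.ev_injective ?_
  rw [ev_inclCell_whiskerL, ev_vcomp, ev_vcomp, ev_inclComp, ev_whiskerL, ev_inclComp_inverse]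
  simp

theorem inclCell_whiskerR {S S' : Span eqW A B} (a : Cell S S') (T : Span eqW B D) :
    inclCell (𝓐.whiskerR a T) = 𝓑.vcomp (inclComp 𝓐 𝓑 S T) (𝓑.vcomp
      (𝓑.whiskerR (inclCell a) (inclSpan T)) (inclComp 𝓐 𝓑 S' T).inverse) := by
  refine Cell.ev_injective ?_
  rw [ev_inclCell_whiskerR, ev_vcomp, ev_vcomp, ev_inclComp, ev_whiskerR, ev_inclComp_inverse]
  simp

theorem inclCell_assoc (S : Span eqW A B) (T : Span eqW B D) (R : Span eqW D E) :
    inclCell (𝓐.assoc S T R) = 𝓑.vcomp (inclComp 𝓐 𝓑 (𝓐.fill S T).span R)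
      (𝓑.vcomp (𝓑.whiskerR (inclComp 𝓐 𝓑 S T) (inclSpan R))
        (𝓑.vcomp (𝓑.assoc (inclSpan S) (inclSpan T) (inclSpan R))
          (𝓑.vcomp (𝓑.whiskerL (inclSpan S) (inclComp 𝓐 𝓑 T R).inverse)
            (inclComp 𝓐 𝓑 S (𝓐.fill T R).span).inverse))) := by
  refine Cell.ev_injective ?_
  rw [ev_inclCell_assoc]
  simp only [ev_vcomp, ev_inclComp, ev_whiskerR, ev_assoc, ev_whiskerL, ev_inclComp_inverse]
  ext x
  simp

theorem inclCell_leftUnit (S : Span eqW A B) :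
    inclCell (𝓐.leftUnit S) = 𝓑.vcomp (inclComp 𝓐 𝓑 (Span.id A (𝓐.id_mem A)) S)
      (𝓑.vcomp (𝓑.whiskerR (Cell.mk (Diagram.id (inclSpan (Span.id A (𝓐.id_mem A))))) (inclSpan S))
        (𝓑.leftUnit (inclSpan S))) := by
  -- The included identity span and the identity span of the Lie groupoid agree only by unfolding
  -- definitions. The cancellation is therefore proved for arbitrary functors and then specialised.
  have key {I G : A.toLieGpd.Pt ⥤ A.toLieGpd.Pt} {K K' : A.toLieGpd.Pt ⥤ B.toLieGpd.Pt}
      {J : A.toLieGpd.Pt ⥤ B.toLieGpd.Pt} (m : K ≅ I ⋙ J) (m' : K' ≅ I ⋙ J) (i : I ⟶ G) :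
      m.hom ≫ Functor.whiskerRight i J = (m.hom ≫ m'.inv) ≫
        (m'.hom ≫ Functor.whiskerRight (𝟙 I) J ≫ m'.inv) ≫ m'.hom ≫ Functor.whiskerRight i J := by
    simp
  refine Cell.ev_injective ((ev_inclCell_leftUnit 𝓐 S).trans ((key _ (𝓑.fill _ _).mu _).trans
    ((ev_vcomp _ _ _).trans ?_).symm))
  refine congrArg₂ (· ≫ ·) (ev_inclComp _ _ _ _) ((ev_vcomp _ _ _).trans
    (congrArg₂ (· ≫ ·) ((ev_whiskerR _ _ _).trans ?_) (ev_leftUnit _ _)))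
  rw [Cell.ev_id]

theorem inclCell_rightUnit (S : Span eqW A B) :
    inclCell (𝓐.rightUnit S) = 𝓑.vcomp (inclComp 𝓐 𝓑 S (Span.id B (𝓐.id_mem B)))
      (𝓑.vcomp (𝓑.whiskerL (inclSpan S) (Cell.mk (Diagram.id (inclSpan (Span.id B (𝓐.id_mem B))))))
        (𝓑.rightUnit (inclSpan S))) := by
  have key {I G : B.toLieGpd.Pt ⥤ B.toLieGpd.Pt} {K K' : A.toLieGpd.Pt ⥤ B.toLieGpd.Pt}
      {J : A.toLieGpd.Pt ⥤ B.toLieGpd.Pt} (m : K ≅ J ⋙ I) (m' : K' ≅ J ⋙ I) (i : I ⟶ G) :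
      m.hom ≫ Functor.whiskerLeft J i = (m.hom ≫ m'.inv) ≫
        (m'.hom ≫ Functor.whiskerLeft J (𝟙 I) ≫ m'.inv) ≫ m'.hom ≫ Functor.whiskerLeft J i := by
    simp
  refine Cell.ev_injective ((ev_inclCell_rightUnit 𝓐 S).trans ((key _ (𝓑.fill _ _).mu _).trans
    ((ev_vcomp _ _ _).trans ?_).symm))
  refine congrArg₂ (· ≫ ·) (ev_inclComp _ _ _ _) ((ev_vcomp _ _ _).trans
    (congrArg₂ (· ≫ ·) ((ev_whiskerL _ _ _).trans ?_) (ev_rightUnit _ _)))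
  rw [Cell.ev_id]

end

/-- The homomorphism of bicategories of fractions induced by the inclusion. -/
noncomputable def eqTrPseudofunctor (𝓐 : EqTrFractions.{u}) (𝓑 : LieFractions.{u}) :
    Pseudofunctor (OrbEqTr 𝓐) (OrbLieTr 𝓑) where
  toPrelaxFunctorStruct := eqTrInclusion 𝓐 𝓑
  map₂_id _ := rfl
  map₂_comp a b := Cell.ev_injective ((ev_inclCell_vcomp _ a b).trans (ev_vcomp _ _ _).symm)
  mapId A := cellIso (Cell.mk (Diagram.id (inclSpan (Span.id A.obj (𝓐.id_mem A.obj)))))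
  mapComp S T := cellIso (inclComp 𝓐.toFractionBicategory 𝓑.toFractionBicategory S T)
  map₂_whisker_left S _ _ b := inclCell_whiskerL 𝓐.toFractionBicategory 𝓑.toFractionBicategory S b
  map₂_whisker_right a T := inclCell_whiskerR 𝓐.toFractionBicategory 𝓑.toFractionBicategory a T
  map₂_associator S T R := inclCell_assoc 𝓐.toFractionBicategory 𝓑.toFractionBicategory S T R
  map₂_left_unitor S := inclCell_leftUnit 𝓐.toFractionBicategory 𝓑.toFractionBicategory S
  map₂_right_unitor S := inclCell_rightUnit 𝓐.toFractionBicategory 𝓑.toFractionBicategory S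

end Fractions

/-! ## Fullness on 2-cells -/

namespace LieGpd

open Mfd

/-- Two-cells descend along essential equivalences. -/
theorem IsEssEquiv.exists_twoCell_of_precomp {N P G : LieGpd.{u}} {m : N ⟶ P} (hm : IsEssEquiv m)
    {f g : P ⟶ G} (α : m ≫ f ⟶ m ≫ g) : ∃ β : f ⟶ g, m ◁ β = α := by
  have := hm.isEquivalence_fn
  -- On points the descended 2-cell is the extension along an equivalence. Only its smoothness
  -- remains.
  let τ : fn f ⟶ fn g := Fractions.extend (fn m) (F := fn f) (F' := fn g)
    (show fn m ⋙ fn f ⟶ fn m ⋙ fn g from nt α)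
  have h1 : ∀ x : N.obj, (τ.app (Hom.obj m x)).1 = TwoCell.app α x := fun x =>
    congrArg Subtype.val (Fractions.extend_app (fn m) (F := fn f) (F' := fn g) (nt α) x)
  have hs : ContMDiff P.obj.I G.arr.I ∞ fun y : P.obj => (τ.app y).1 := by
    refine contMDiff_of_local _ fun y => ?_
    -- Near `y` every object `u` is joined to `m (σ u)` by a smooth arrow `η u`. Naturality then
    -- gives the value at `u` as `g(η u) α(σ u) f(η u)⁻¹`, which is smooth in `u`.
    obtain ⟨x, a, h2, h3⟩ := hm.isLocEquiv.surj y
    obtain ⟨U, hU, σ, η, h4, h5, -, -⟩ := hm.isLocEquiv.sec x a h2 y h3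
    refine ⟨U, hU, G.mulHom (G.mulHom (η ≫ Hom.arr g) (σ ≫ TwoCell.app α) fun u => ?_)
      (η ≫ Hom.arr f ≫ G.inv) fun u => ?_, fun u => ?_⟩
    · exact (Hom.src_arr g _).trans ((congrArg (Hom.obj g) (h4 u)).trans (TwoCell.tgt_app α _).symm)
    · refine (G.src_comp _ _ _).trans ((TwoCell.src_app α _).trans ?_)
      exact ((G.tgt_inv _).trans ((Hom.src_arr f _).trans (congrArg (Hom.obj f) (h4 u)))).symm
    · have h6 : (fn f).map (⟨η u, h4 u, h5 u⟩ : Quiver.Hom (V := P.Pt) _ _) ≫ τ.app u.1 =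
          τ.app (Hom.obj m (σ u)) ≫ (fn g).map ⟨η u, h4 u, h5 u⟩ := τ.naturality _
      have h7 : τ.app u.1 = CategoryTheory.inv ((fn f).map
          (⟨η u, h4 u, h5 u⟩ : Quiver.Hom (V := P.Pt) _ _)) ≫
            τ.app (Hom.obj m (σ u)) ≫ (fn g).map ⟨η u, h4 u, h5 u⟩ := by
        rw [← h6, IsIso.inv_hom_id_assoc]
      rw [← Groupoid.inv_eq_inv] at h7
      refine Eq.trans ?_ (congrArg Subtype.val h7).symm
      exact G.comp_congr (G.comp_congr rfl (h1 _).symm _) rfl _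
  let β : TwoCell f g :=
    { app := homMk _ hs
      src_app := fun y => (τ.app y).2.1
      tgt_app := fun y => (τ.app y).2.2
      natural := fun a => (congrArg Subtype.val (τ.naturality (X := P.src a) (Y := P.tgt a)
        ⟨a, rfl, rfl⟩)).symm }
  exact ⟨β, TwoCell.ext_app h1⟩

end LieGpd

namespace Fractions

open LieGpd TransGpd

/-- A 2-cell between spans of Lie groupoids can be represented by a diagram on any square
over the left legs. -/
theorem exists_diagram_of_square {X Y : LieGpd.{u}} {S S' : Span lieW X Y} {P : LieGpd.{u}}
    {f : P ⟶ S.apex} {f' : P ⟶ S'.apex} (α : f ≫ S.left ≅ f' ≫ S'.left)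
    (hf : lieW (f ≫ S.left)) (hf' : lieW (f' ≫ S'.left)) (e : Diagram S S') :
    ∃ β : f ≫ S.right ⟶ f' ≫ S'.right, Diagram.Rel ⟨P, f, f', α, β, hf, hf'⟩ e := by
  obtain ⟨N, s, s', η, η', hs, h1, h2, h3⟩ := LieGpd.calculus.exists_overlap_of_square α hf e
  -- The relation with `e` prescribes `β` after restriction along the essential equivalence `s`, and
  -- that 2-cell descends.
  obtain ⟨β, hβ⟩ := IsEssEquiv.exists_twoCell_of_precomp hs
    ((α_ _ _ _).inv ≫ η.hom ▷ S.right ≫ (α_ _ _ _).hom ≫ s' ◁ e.α₂ ≫ (α_ _ _ _).inv ≫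
      η'.inv ▷ S'.right ≫ (α_ _ _ _).hom)
  refine ⟨β, N, s, s', η, η', h1, h2, h3, ?_⟩
  change (α_ _ _ _).hom ≫ s ◁ β ≫ (α_ _ _ _).inv ≫ η'.hom ▷ S'.right = _
  rw [hβ]
  simp

/-- The weak fibre product of the left legs is a translation groupoid, and a 2-cell on it between
equivariant maps is already a 2-cell of equivariant maps. -/
theorem inclCell_surjective {A B : TransGpd.{u}} (S S' : Span eqW A B)
    (c : Cell (inclSpan S) (inclSpan S')) : ∃ a : Cell S S', inclCell a = c := by
  induction c using Quot.inductionOn with | _ e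
  obtain ⟨P, f, f', θ, hP⟩ := TransGpd.exists_weakFibreProduct S.left S'.mem
  have hf : eqW (f ≫ S.left) := TransGpd.calculus.comp_mem
    (hP.isLocEquiv (IsEssEquiv.isLocEquiv S'.mem)).isEssEquiv S.mem
  have hf' : eqW (f' ≫ S'.left) := TransGpd.calculus.of_iso θ hf
  obtain ⟨β, hβ⟩ := exists_diagram_of_square (S := inclSpan S) (S' := inclSpan S')
    (f := Hom.toLieGpd f) (f' := Hom.toLieGpd f') (inclIso θ) hf hf' e
  exact ⟨Cell.mk ⟨P, f, f', θ, β, hf, hf'⟩, Quot.sound hβ⟩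

end Fractions

/-! ## The translation groupoid of a generalized map between translation groupoids -/

namespace Mfd

theorem contMDiffOn_of_restrict {X Y : Mfd.{u}} (U : TopologicalSpace.Opens X) (f : X → Y)
    (g : X.restrict U ⟶ Y) (h : ∀ u : X.restrict U, g u = f u.1) : ContMDiffOn X.I Y.I ∞ f U := by
  intro x hx
  refine ((contMDiffAt_subtype_iff (U := U) (x := ⟨x, hx⟩)).1 ?_).contMDiffWithinAt
  have h1 : (fun x : U => f x) = g.toFun := funext fun y => (h y).symm
  rw [h1]
  exact g.smooth _

theorem exists_extension {X Y : Mfd.{u}} {U : TopologicalSpace.Opens X} {x : X} (hx : x ∈ U)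
    (g : X.restrict U ⟶ Y) :
    ∃ f : X → Y, ContMDiffOn X.I Y.I ∞ f U ∧ ∀ u (hu : u ∈ U), f u = g ⟨u, hu⟩ := by
  have h : ∀ u : U, Function.extend Subtype.val g (fun _ => g ⟨x, hx⟩) u.1 = g u := fun u =>
    Subtype.val_injective.extend_apply _ _ u
  exact ⟨_, contMDiffOn_of_restrict U _ g fun u => (h u).symm, fun u hu => h ⟨u, hu⟩⟩

end Mfd

namespace TransGpd

open Mfd LieGpd Fractions

/-! ### Families of group elements and points of translation groupoids -/

section Maps

variable {A B : TransGpd.{u}} {T : Mfd.{u}}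

/-- The pointwise product of maps to a Lie group. -/
noncomputable def grpMul (a b : T ⟶ A.grp) : T ⟶ A.grp :=
  homMk (fun t => a t * b t) ((contMDiff a).mul (contMDiff b))

/-- The pointwise inverse of a map to a Lie group. -/
noncomputable def grpInv (a : T ⟶ A.grp) : T ⟶ A.grp :=
  homMk (fun t => (a t)⁻¹) ((contMDiff_inv A.grp.I ∞).comp (contMDiff a))

/-- The pointwise action of a map to a Lie group. -/
noncomputable def smulHom (a : T ⟶ A.grp) (x : T ⟶ A.space) : T ⟶ A.space :=
  homMk (fun t => a t • x t) (contMDiff_smul.comp ((contMDiff a).prodMk (contMDiff x)))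

@[simp] theorem grpMul_apply (a b : T ⟶ A.grp) (t : T) : grpMul a b t = a t * b t := rfl

@[simp] theorem grpInv_apply (a : T ⟶ A.grp) (t : T) : grpInv a t = (a t)⁻¹ := rfl

/-- A pair of group elements. -/
def grpPair (a : A.grp) (b : B.grp) : A.grp.prod B.grp := (a, b)

end Maps

section Points

variable {A B : TransGpd.{u}}

/-- The arrow of a translation groupoid given by a group element. -/
noncomputable def translation (g : A.grp) (x : A.space) :
    Quiver.Hom (V := A.toLieGpd.Pt) x (g • x) := ⟨(g, x), rfl, rfl⟩

/-- The group element of an arrow of a translation groupoid. -/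
noncomputable def grpOf {x y : A.toLieGpd.Pt} (f : x ⟶ y) : A.grp := f.1.1

theorem grpOf_smul {x y : A.space} (f : Quiver.Hom (V := A.toLieGpd.Pt) x y) :
    grpOf f • x = y := by
  obtain ⟨⟨g, z⟩, h1, h2⟩ := f
  have h1' : z = x := h1
  subst h1'
  exact h2

theorem grpOf_comp {x y z : A.toLieGpd.Pt} (f : x ⟶ y) (f' : y ⟶ z) :
    grpOf (f ≫ f') = grpOf f' * grpOf f := rfl

theorem grpOf_map (F : A.toLieGpd.Pt ⥤ B.toLieGpd.Pt) {x y : A.toLieGpd.Pt} (f : x ⟶ y) :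
    grpOf (F.map f) = grpOf (F.map (translation (grpOf f) x)) := by
  obtain ⟨⟨g, z⟩, h1, h2⟩ := f
  subst h1 h2
  rfl

theorem grpOf_map_mul (F : A.toLieGpd.Pt ⥤ B.toLieGpd.Pt) {x y z : A.toLieGpd.Pt} (f : x ⟶ y)
    (f' : y ⟶ z) : grpOf (F.map (translation (grpOf f' * grpOf f) x)) =
      grpOf (F.map f') * grpOf (F.map f) :=
  (grpOf_map F (f ≫ f')).symm.trans (congrArg grpOf (F.map_comp f f'))

end Points

/-! ### The principal bundle of a generalized map -/

section Bundle

variable {A B : TransGpd.{u}} {K : LieGpd.{u}}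

/-- The map on objects of a homomorphism to a translation groupoid. -/
noncomputable def base (w : K ⟶ A.toLieGpd) : K.obj ⟶ A.space := LieGpd.Hom.obj w

/-- The group component of a homomorphism to a translation groupoid. -/
noncomputable def label (w : K ⟶ A.toLieGpd) : K.arr ⟶ A.grp := LieGpd.Hom.arr w ≫ fst

theorem arr_eq (w : K ⟶ A.toLieGpd) (κ : K.arr) :
    LieGpd.Hom.arr w κ = (label w κ, base w (K.src κ)) :=
  Prod.ext rfl (LieGpd.Hom.src_arr w κ)

theorem label_smul (w : K ⟶ A.toLieGpd) (κ : K.arr) :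
    label w κ • base w (K.src κ) = base w (K.tgt κ) := by
  have h1 : (LieGpd.Hom.arr w κ).2 = base w (K.src κ) := LieGpd.Hom.src_arr w κ
  have h2 : (LieGpd.Hom.arr w κ).1 • (LieGpd.Hom.arr w κ).2 = base w (K.tgt κ) :=
    LieGpd.Hom.tgt_arr w κ
  rw [← h2, ← h1]
  rfl

theorem label_unit (w : K ⟶ A.toLieGpd) (k : K.obj) : label w (K.unit k) = 1 :=
  congrArg Prod.fst (LieGpd.Hom.arr_unit w k)

theorem label_comp (w : K ⟶ A.toLieGpd) (κ κ' : K.arr) (h : K.src κ = K.tgt κ') :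
    label w (K.comp κ κ' h) = label w κ * label w κ' :=
  congrArg Prod.fst (LieGpd.Hom.arr_comp w κ κ' h)

theorem exists_arr_of_smul {w : K ⟶ A.toLieGpd} (hw : IsLocEquiv w) {T : Mfd.{u}}
    (k k' : T ⟶ K.obj) (g : T ⟶ A.grp) (h : ∀ t, g t • base w (k t) = base w (k' t)) :
    ∃ κ : T ⟶ K.arr, (∀ t, label w (κ t) = g t) ∧ (∀ t, K.src (κ t) = k t) ∧
      ∀ t, K.tgt (κ t) = k' t := by
  obtain ⟨κ, h1, h2, h3⟩ := hw.lift k k' (pair g (k ≫ base w)) (fun t => rfl) h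
  exact ⟨κ, fun t => congrArg Prod.fst (h1 t), h2, h3⟩

/-- A (not necessarily smooth) extension of `φ` along `w`, in terms of group elements. -/
structure Cocycle (w : K ⟶ A.toLieGpd) (φ : K ⟶ B.toLieGpd) where
  pt : A.space → B.space
  coef : A.grp → A.space → B.grp
  cmp : K.obj → B.grp
  coef_smul : ∀ g x, coef g x • pt x = pt (g • x)
  coef_mul : ∀ g g' x, coef (g' * g) x = coef g' (g • x) * coef g x
  cmp_smul : ∀ k, cmp k • pt (base w k) = base φ k
  label_mul : ∀ κ, label φ κ * cmp (K.src κ) =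
    cmp (K.tgt κ) * coef (label w κ) (base w (K.src κ))

/-- The functor `S.func` and its comparison with the right leg are read off as group elements.
`S.cmp k` goes from the image of `k` to the functor applied to its base point, whereas `cmp` goes
back, hence the inverse. -/
theorem nonempty_cocycle (S : Span lieW A.toLieGpd B.toLieGpd) :
    Nonempty (Cocycle S.left S.right) := by
  refine ⟨⟨S.func.obj, fun g x => grpOf (S.func.map (translation g x)),
    fun k => (grpOf (S.cmp k))⁻¹, fun g x => grpOf_smul _,
    fun g g' x => grpOf_map_mul S.func (translation g x) (translation g' (g • x)), fun k => ?_,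
    fun κ => ?_⟩⟩
  · exact inv_smul_eq_iff.2 (grpOf_smul (S.cmp k)).symm
  · have h := congrArg grpOf (S.cmp_naturality
      (⟨κ, rfl, rfl⟩ : Quiver.Hom (V := S.apex.Pt) (S.apex.src κ) (S.apex.tgt κ)))
    rw [grpOf_comp, grpOf_comp, grpOf_map S.func] at h
    have h' : grpOf (S.cmp (S.apex.tgt κ)) * label S.right κ =
      grpOf (S.func.map (translation (label S.left κ) (base S.left (S.apex.src κ)))) *
        grpOf (S.cmp (S.apex.src κ)) := h
    rw [mul_inv_eq_iff_eq_mul, mul_assoc, ← h', inv_mul_cancel_left]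

namespace Cocycle

variable {w : K ⟶ A.toLieGpd} {φ : K ⟶ B.toLieGpd} (c : Cocycle w φ)

theorem coef_one (x : A.space) : c.coef 1 x = 1 := by
  have h := c.coef_mul 1 1 x
  rw [mul_one, one_smul] at h
  exact left_eq_mul.mp h

/-- The points of the bundle, given by generators. -/
noncomputable def gen (h : B.grp) (g : A.grp) (k : K.obj) : A.space × B.grp :=
  (g • base w k, h * c.cmp k * (c.coef g (base w k))⁻¹)

/-- Coordinates `(x, b)` stand for the arrow `b` out of `pt x`, and a generator is the composite of
`coef g` inverted, `cmp k` and `h`. Sliding an arrow `κ` across the middle replaces `(h, g, t κ)` by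
`(h φ(κ), g w(κ), s κ)`: the bundle is presented as a quotient by the arrows of `K`. -/
theorem gen_tgt (κ : K.arr) (h : B.grp) {g g' : A.grp} (hg : g * label w κ = g') :
    c.gen h g (K.tgt κ) = c.gen (h * label φ κ) g' (K.src κ) := by
  subst hg
  refine Prod.ext ?_ ?_
  · change g • base w (K.tgt κ) = (g * label w κ) • base w (K.src κ)
    rw [mul_smul, label_smul]
  · change h * c.cmp (K.tgt κ) * (c.coef g (base w (K.tgt κ)))⁻¹ =
      h * label φ κ * c.cmp (K.src κ) * (c.coef (g * label w κ) (base w (K.src κ)))⁻¹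
    rw [c.coef_mul, label_smul, mul_inv_rev, mul_assoc h (label φ κ), c.label_mul]
    simp only [mul_assoc, mul_inv_cancel_left]

end Cocycle

/-- A smooth local inverse of the map `(g, k) ↦ g • w k`. -/
structure LocalLift (w : K ⟶ A.toLieGpd) where
  U : TopologicalSpace.Opens A.space
  k : A.space → K.obj
  g : A.space → A.grp
  smooth_k : ContMDiffOn A.space.I K.obj.I ∞ k U
  smooth_g : ContMDiffOn A.space.I A.grp.I ∞ g U
  smul_base : ∀ x ∈ U, g x • base w (k x) = x

/-- These are the local solutions of essential surjectivity of `w`: an arrow from `w k` to `x` is a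
group element moving one to the other. -/
theorem exists_localLift {w : K ⟶ A.toLieGpd} (hw : IsLocEquiv w) (x : A.space) :
    ∃ L : LocalLift w, x ∈ L.U := by
  obtain ⟨k₀, a, h1, h2⟩ := hw.surj x
  obtain ⟨U, hU, σ, η, h3, h4, -, -⟩ := hw.sec k₀ a h1 x h2
  have h3' : ∀ u, (η u).2 = base w (σ u) := h3
  have h4' : ∀ u, (η u).1 • (η u).2 = u.1 := h4
  obtain ⟨k, hk, hk'⟩ := exists_extension hU σ
  obtain ⟨g, hg, hg'⟩ := exists_extension hU (η ≫ fst)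
  refine ⟨⟨U, k, g, hk, hg, fun y hy => ?_⟩, hU⟩
  have e : (η ⟨y, hy⟩).1 • base w (σ ⟨y, hy⟩) = y :=
    (congrArg ((η ⟨y, hy⟩).1 • ·) (h3' ⟨y, hy⟩).symm).trans (h4' ⟨y, hy⟩)
  rw [hk' y hy, hg' y hy]
  exact e

namespace Cocycle

variable {w : K ⟶ A.toLieGpd} {φ : K ⟶ B.toLieGpd} (c : Cocycle w φ)

/-- The trivialization of the bundle given by a local lift. -/
noncomputable def chart (L : LocalLift w) :
    PartialEquiv (A.space × B.grp) (A.space.prod B.grp) where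
  toFun z := (z.1, z.2 * (c.gen 1 (L.g z.1) (L.k z.1)).2⁻¹)
  invFun b := c.gen b.2 (L.g b.1) (L.k b.1)
  source := Prod.fst ⁻¹' L.U
  target := Prod.fst ⁻¹' L.U
  map_source' z hz := hz
  map_target' b hb := by
    change L.g b.1 • base w (L.k b.1) ∈ L.U
    rw [L.smul_base _ hb]
    exact hb
  left_inv' z hz := by
    refine Prod.ext (L.smul_base _ hz) ?_
    simp only [gen, one_mul, mul_assoc, inv_mul_cancel, mul_one]
  right_inv' b hb := by
    refine Prod.ext (L.smul_base _ hb) ?_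
    change b.2 * c.cmp (L.k b.1) * (c.coef (L.g b.1) (base w (L.k b.1)))⁻¹ *
      (c.gen 1 (L.g (L.g b.1 • base w (L.k b.1))) (L.k (L.g b.1 • base w (L.k b.1)))).2⁻¹ = b.2
    rw [L.smul_base _ hb]
    simp only [gen, one_mul, mul_assoc, mul_inv_cancel, mul_one]

theorem chart_gen (L : LocalLift w) (h : B.grp) {x : A.space} (hx : x ∈ L.U) :
    c.chart L (c.gen h (L.g x) (L.k x)) = (x, h) :=
  (c.chart L).right_inv (x := (x, h)) hx

/-- Smoothness enters here although the cocycle is not smooth. A generator and the one used by the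
chart over the same point differ by an arrow of `K`, which varies smoothly because `w` is fully
faithful, and the chart coordinate is `h` times its label under `φ`. -/
theorem exists_gen_eq (hw : IsLocEquiv w) (L : LocalLift w) {T : Mfd.{u}} (h : T ⟶ B.grp)
    (g : T ⟶ A.grp) (k : T ⟶ K.obj) (hL : ∀ t, g t • base w (k t) ∈ L.U) :
    ∃ m : T ⟶ B.grp, ∀ t, c.chart L (c.gen (h t) (g t) (k t)) = (g t • base w (k t), m t) := by
  let x := corestrict L.U (smulHom g (k ≫ base w)) hL
  let k' := x ≫ ofContMDiffOn L.U L.k L.smooth_k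
  let g' := x ≫ ofContMDiffOn L.U L.g L.smooth_g
  have hx : ∀ t, g' t • base w (k' t) = g t • base w (k t) := fun t => L.smul_base _ (hL t)
  obtain ⟨κ, h1, h2, h3⟩ := exists_arr_of_smul hw k' k (grpMul (grpInv g) g') fun t => by
    rw [grpMul_apply, grpInv_apply, mul_smul, hx, inv_smul_smul]
  refine ⟨grpMul h (κ ≫ label φ), fun t => ?_⟩
  have h4 := c.gen_tgt (κ t) (h t) (g := g t) (g' := g' t) (by
    rw [h1, grpMul_apply, grpInv_apply, mul_inv_cancel_left])
  rw [h2, h3] at h4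
  rw [h4]
  exact c.chart_gen L _ (hL t)

/-- The charts of the bundle associated to a generalized map. -/
noncomputable def data (hw : IsLocEquiv w) :
    GlueData (A.space.prod B.grp) A.space (A.space × B.grp) where
  ι := LocalLift w
  chart := c.chart
  π := Prod.fst
  U := LocalLift.U
  source_eq _ := rfl
  exists_mem z := exists_localLift hw z.1
  open_target L := continuous_preimage_isOpen (X := A.space.prod B.grp) fst L.U
  smooth_π L := (contMDiff (fst : A.space.prod B.grp ⟶ A.space)).contMDiffOn.congr fun b hb =>
    L.smul_base b.1 hb
  smooth_transition L L' := by
    have hset : (c.chart L).target ∩ (fun b => ((c.chart L).symm b).1) ⁻¹' (L'.U : Set A.space) =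
        (fst : A.space.prod B.grp ⟶ A.space) ⁻¹' ((L.U ⊓ L'.U : TopologicalSpace.Opens A.space) :
          Set A.space) := by
      ext b
      refine and_congr_right fun hb => ?_
      change L.g b.1 • base w (L.k b.1) ∈ L'.U ↔ b.1 ∈ L'.U
      rw [L.smul_base _ hb]
    rw [hset]
    let O : TopologicalSpace.Opens (A.space.prod B.grp) :=
      ⟨_, continuous_preimage_isOpen (X := A.space.prod B.grp) fst (L.U ⊓ L'.U)⟩
    let x : (A.space.prod B.grp).restrict O ⟶ A.space.restrict L.U :=
      corestrict L.U (incl O ≫ fst) fun b => b.2.1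
    have hx : ∀ b, (x ≫ ofContMDiffOn L.U L.g L.smooth_g) b •
        base w ((x ≫ ofContMDiffOn L.U L.k L.smooth_k) b) = (x b).1 := fun b =>
      L.smul_base _ (x b).2
    obtain ⟨m, hm⟩ := c.exists_gen_eq hw L' (incl O ≫ snd)
      (x ≫ ofContMDiffOn L.U L.g L.smooth_g) (x ≫ ofContMDiffOn L.U L.k L.smooth_k) fun b => by
        rw [hx]; exact b.2.2
    exact contMDiffOn_of_restrict O _ (pair (x ≫ incl L.U) m) fun b =>
      ((hm b).trans (congrArg (fun y => (y, m b)) (hx b))).symm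
  -- Chart domains are full preimages, so any chart at `z` also contains the other points of its
  -- fibre.
  separated z _ _ _ := exists_localLift hw z.1

/-- The total space of the bundle associated to a generalized map. -/
noncomputable def bundle (hw : IsLocEquiv w) : Mfd.{u} := (c.data hw).mfd

/-- The projection of the bundle. -/
noncomputable def proj (hw : IsLocEquiv w) : c.bundle hw ⟶ A.space :=
  homMk (c.data hw).proj (c.data hw).contMDiff_π

/-- The point of the bundle with given coordinates. -/
def ofProd (hw : IsLocEquiv w) (z : A.space × B.grp) : c.bundle hw := z

/-- The coordinates of a point of the bundle. -/
def toProd {hw : IsLocEquiv w} (z : c.bundle hw) : A.space × B.grp := z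

theorem contMDiff_gen (hw : IsLocEquiv w) {T : Mfd.{u}} (h : T ⟶ B.grp) (g : T ⟶ A.grp)
    (k : T ⟶ K.obj) : ContMDiff T.I (c.bundle hw).I ∞
      fun t => c.ofProd hw (c.gen (h t) (g t) (k t)) := by
  refine (c.data hw).contMDiff_of_charts _ (continuous (smulHom g (k ≫ base w))) fun t => ?_
  obtain ⟨L, hL⟩ := exists_localLift hw (g t • base w (k t))
  refine ⟨L, hL, ?_⟩
  let V : TopologicalSpace.Opens T :=
    ⟨_, continuous_preimage_isOpen (smulHom g (k ≫ base w)) L.U⟩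
  obtain ⟨m, hm⟩ := c.exists_gen_eq hw L (incl V ≫ h) (incl V ≫ g) (incl V ≫ k) fun v => v.2
  exact (contMDiffOn_of_restrict (Y := A.space.prod B.grp) V
    (fun t => c.chart L (c.gen (h t) (g t) (k t)))
    (pair (incl V ≫ smulHom g (k ≫ base w)) m) fun v => (hm v).symm).contMDiffAt
      (V.2.mem_nhds hL)

/-- The family of points of the bundle given by a family of generators. -/
noncomputable def genHom (hw : IsLocEquiv w) {T : Mfd.{u}} (h : T ⟶ B.grp) (g : T ⟶ A.grp)
    (k : T ⟶ K.obj) : T ⟶ c.bundle hw := homMk _ (c.contMDiff_gen hw h g k)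

/-- With `contMDiff_gen`, this makes smoothness on the bundle a question about generators: maps out
of it and its action are smooth once their formulas in `(h, g, k)` are. -/
theorem exists_local_gen (hw : IsLocEquiv w) {T : Mfd.{u}} (e : T ⟶ c.bundle hw) (t : T) :
    ∃ (V : TopologicalSpace.Opens T) (_ : t ∈ V) (h : T.restrict V ⟶ B.grp)
      (g : T.restrict V ⟶ A.grp) (k : T.restrict V ⟶ K.obj),
      ∀ v, e v.1 = c.ofProd hw (c.gen (h v) (g v) (k v)) := by
  obtain ⟨L, hL⟩ := exists_localLift hw (c.proj hw (e t))
  let V : TopologicalSpace.Opens T := ⟨_, continuous_preimage_isOpen (e ≫ c.proj hw) L.U⟩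
  let b : T.restrict V ⟶ A.space.prod B.grp := ofContMDiffOn V
    (fun t => (c.data hw).mchart L (e t))
    (((c.data hw).smooth_chart L).comp (contMDiff e).contMDiffOn fun v hv => hv)
  let x : T.restrict V ⟶ A.space.restrict L.U :=
    corestrict L.U (incl V ≫ e ≫ c.proj hw) fun v => v.2
  exact ⟨V, hL, b ≫ snd, x ≫ ofContMDiffOn L.U L.g L.smooth_g,
    x ≫ ofContMDiffOn L.U L.k L.smooth_k, fun v => ((c.chart L).left_inv v.2).symm⟩

theorem exists_gen (hw : IsLocEquiv w) (z : c.bundle hw) :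
    ∃ h g k, z = c.ofProd hw (c.gen h g k) := by
  obtain ⟨V, hV, h, g, k, e⟩ := c.exists_local_gen hw (𝟙 _) z
  exact ⟨_, _, _, e ⟨z, hV⟩⟩

/-- The map from the bundle to the target of the generalized map. -/
noncomputable def momentFun {hw : IsLocEquiv w} (z : c.bundle hw) : B.space :=
  (c.toProd z).2 • c.pt (c.toProd z).1

/-- The cocycle cancels out of this formula, which is why the moment map is smooth. -/
theorem momentFun_gen (hw : IsLocEquiv w) (h : B.grp) (g : A.grp) (k : K.obj) :
    c.momentFun (c.ofProd hw (c.gen h g k)) = h • base φ k := by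
  change (h * c.cmp k * (c.coef g (base w k))⁻¹) • c.pt (g • base w k) = h • base φ k
  rw [← c.coef_smul, mul_smul, inv_smul_smul, mul_smul, c.cmp_smul]

/-- The map from the bundle to the target of the generalized map, as a smooth map. -/
noncomputable def moment (hw : IsLocEquiv w) : c.bundle hw ⟶ B.space :=
  homMk c.momentFun (contMDiff_of_local _ fun z => by
    obtain ⟨V, hV, h, g, k, e⟩ := c.exists_local_gen hw (𝟙 _) z
    refine ⟨V, hV, smulHom h (k ≫ base φ), fun v => ?_⟩
    exact ((congrArg c.momentFun (e v)).trans (c.momentFun_gen hw _ _ _)).symm)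

/-- Viewing a point as an arrow out of `pt x`, the group of the target acts by postcomposition, and
that of the source moves `x` and precomposes with the inverse of `coef`. -/
noncomputable instance (hw : IsLocEquiv w) : MulAction (A.grp.prod B.grp) (c.bundle hw) where
  smul γ z := c.ofProd hw (γ.1 • (c.toProd z).1,
    γ.2 * (c.toProd z).2 * (c.coef γ.1 (c.toProd z).1)⁻¹)
  one_smul z := by
    refine Prod.ext (one_smul A.grp (c.toProd z).1) ?_
    change (1 : B.grp) * (c.toProd z).2 * (c.coef 1 (c.toProd z).1)⁻¹ = (c.toProd z).2
    rw [c.coef_one, inv_one, one_mul, mul_one]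
  mul_smul γ γ' z := by
    refine Prod.ext (mul_smul γ.1 γ'.1 (c.toProd z).1) ?_
    change γ.2 * γ'.2 * (c.toProd z).2 * (c.coef (γ.1 * γ'.1) (c.toProd z).1)⁻¹ =
      γ.2 * (γ'.2 * (c.toProd z).2 * (c.coef γ'.1 (c.toProd z).1)⁻¹) *
        (c.coef γ.1 (γ'.1 • (c.toProd z).1))⁻¹
    rw [c.coef_mul, mul_inv_rev]
    simp only [mul_assoc]

/-- On generators the action is left multiplication, with no trace of the cocycle. Its smoothness
follows. -/
theorem smul_gen (hw : IsLocEquiv w) (γ : A.grp.prod B.grp) (h : B.grp) (g : A.grp) (k : K.obj) :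
    γ • c.ofProd hw (c.gen h g k) = c.ofProd hw (c.gen (γ.2 * h) (γ.1 * g) k) := by
  refine Prod.ext (mul_smul γ.1 g (base w k)).symm ?_
  change γ.2 * (h * c.cmp k * (c.coef g (base w k))⁻¹) * (c.coef γ.1 (g • base w k))⁻¹ =
    γ.2 * h * c.cmp k * (c.coef (γ.1 * g) (base w k))⁻¹
  rw [c.coef_mul, mul_inv_rev]
  simp only [mul_assoc]

theorem proj_smul (hw : IsLocEquiv w) (γ : A.grp.prod B.grp) (z : c.bundle hw) :
    c.proj hw (γ • z) = γ.1 • c.proj hw z := rfl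

theorem moment_smul (hw : IsLocEquiv w) (γ : A.grp.prod B.grp) (z : c.bundle hw) :
    c.moment hw (γ • z) = γ.2 • c.moment hw z := by
  obtain ⟨h, g, k, rfl⟩ := c.exists_gen hw z
  rw [smul_gen]
  exact (c.momentFun_gen hw _ _ _).trans ((mul_smul _ _ _).trans
    (congrArg (γ.2 • ·) (c.momentFun_gen hw _ _ _).symm))

theorem smul_right_cancel (hw : IsLocEquiv w) {a : A.grp} {b b' : B.grp} {z : c.bundle hw}
    (h : grpPair a b • z = grpPair a b' • z) : b = b' := by
  have h1 : b * (c.toProd z).2 * (c.coef a (c.toProd z).1)⁻¹ =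
    b' * (c.toProd z).2 * (c.coef a (c.toProd z).1)⁻¹ := congrArg Prod.snd h
  exact mul_right_cancel (mul_right_cancel h1)

instance (hw : IsLocEquiv w) :
    ContMDiffSMul (A.grp.prod B.grp).I (c.bundle hw).I ∞ (A.grp.prod B.grp) (c.bundle hw) := by
  refine ⟨contMDiff_of_local (X := (A.grp.prod B.grp).prod (c.bundle hw)) (Y := c.bundle hw) _
    fun p => ?_⟩
  obtain ⟨V, hV, h, g, k, e⟩ := c.exists_local_gen hw
    (snd : (A.grp.prod B.grp).prod (c.bundle hw) ⟶ c.bundle hw) p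
  refine ⟨V, hV, c.genHom hw (grpMul (incl V ≫ fst ≫ snd) h) (grpMul (incl V ≫ fst ≫ fst) g) k,
    fun v => ?_⟩
  have e' : v.1.2 = c.ofProd hw (c.gen (h v) (g v) (k v)) := e v
  change c.ofProd hw (c.gen (v.1.1.2 * h v) (v.1.1.1 * g v) (k v)) = v.1.1 • v.1.2
  rw [e', smul_gen]

/-- The group of the target acts transitively on the fibres of the bundle, smoothly. -/
theorem exists_smul_eq (hw : IsLocEquiv w) {T : Mfd.{u}} (a : T ⟶ A.grp) (e e' : T ⟶ c.bundle hw)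
    (h : ∀ t, a t • c.proj hw (e t) = c.proj hw (e' t)) :
    ∃ b : T ⟶ B.grp, ∀ t, pair a b t • e t = e' t := by
  -- In coordinates the element is forced, since the group of the target acts freely on the second
  -- factor. The formula involves the cocycle, so smoothness needs a separate local argument.
  let b (t : T) : B.grp := (c.toProd (e' t)).2 *
    ((c.toProd (e t)).2 * (c.coef (a t) (c.toProd (e t)).1)⁻¹)⁻¹
  have hb : ∀ t, grpPair (a t) (b t) • e t = e' t := fun t => by
    refine Prod.ext (h t) ?_
    change b t * (c.toProd (e t)).2 * (c.coef (a t) (c.toProd (e t)).1)⁻¹ = (c.toProd (e' t)).2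
    rw [mul_assoc, inv_mul_cancel_right]
  refine ⟨homMk b (contMDiff_of_local _ fun t => ?_), hb⟩
  obtain ⟨V₁, hV₁, h₁, g₁, k₁, e₁⟩ := c.exists_local_gen hw e t
  obtain ⟨V₂, hV₂, h₂, g₂, k₂, e₂⟩ := c.exists_local_gen hw e' t
  let i₁ : T.restrict (V₁ ⊓ V₂) ⟶ T.restrict V₁ := corestrict V₁ (incl _) fun v => v.2.1
  let i₂ : T.restrict (V₁ ⊓ V₂) ⟶ T.restrict V₂ := corestrict V₂ (incl _) fun v => v.2.2
  let ag : T.restrict (V₁ ⊓ V₂) ⟶ A.grp := grpMul (incl _ ≫ a) (i₁ ≫ g₁)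
  have hp : ∀ v, ag v • base w (k₁ (i₁ v)) = g₂ (i₂ v) • base w (k₂ (i₂ v)) := fun v => by
    have h3 := h v.1
    have h4 : c.proj hw (e v.1) = g₁ (i₁ v) • base w (k₁ (i₁ v)) := congrArg Prod.fst (e₁ (i₁ v))
    have h5 : c.proj hw (e' v.1) = g₂ (i₂ v) • base w (k₂ (i₂ v)) := congrArg Prod.fst (e₂ (i₂ v))
    rw [h4, h5] at h3
    exact (mul_smul _ _ _).trans h3
  -- Smooth generators of `a • e` and `e'` lie over the same base points, so a smooth family of
  -- arrows `κ` joins them. By freeness `b` must be `h₂ φ(κ) h₁⁻¹`.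
  obtain ⟨κ, c1, c2, c3⟩ := exists_arr_of_smul hw (i₁ ≫ k₁) (i₂ ≫ k₂)
    (grpMul (grpInv (i₂ ≫ g₂)) ag) fun v => by
      refine (mul_smul (g₂ (i₂ v))⁻¹ (ag v) _).trans ?_
      exact inv_smul_eq_iff.2 (hp v)
  refine ⟨V₁ ⊓ V₂, ⟨hV₁, hV₂⟩, grpMul (grpMul (i₂ ≫ h₂) (κ ≫ label φ)) (grpInv (i₁ ≫ h₁)),
    fun v => c.smul_right_cancel hw (a := a v.1) (z := e v.1) (Eq.trans ?_ (hb v.1).symm)⟩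
  have h6 := c.gen_tgt (κ v) (h₂ (i₂ v)) (g := g₂ (i₂ v)) (g' := ag v) (by
    rw [c1]; exact mul_inv_cancel_left _ _)
  rw [c2, c3] at h6
  have e₁' : e v.1 = c.ofProd hw (c.gen (h₁ (i₁ v)) (g₁ (i₁ v)) (k₁ (i₁ v))) := e₁ (i₁ v)
  have e₂' : e' v.1 = c.ofProd hw (c.gen (h₂ (i₂ v)) (g₂ (i₂ v)) (k₂ (i₂ v))) := e₂ (i₂ v)
  rw [e₁', e₂', smul_gen]
  refine congrArg (c.ofProd hw) (Eq.trans ?_ h6.symm)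
  change c.gen (h₂ (i₂ v) * label φ (κ v) * (h₁ (i₁ v))⁻¹ * h₁ (i₁ v)) (ag v) (k₁ (i₁ v)) = _
  rw [inv_mul_cancel_right]
  rfl

/-- The translation groupoid of the bundle associated to a generalized map. -/
noncomputable def transGpd (hw : IsLocEquiv w) : TransGpd.{u} where
  grp := A.grp.prod B.grp
  space := c.bundle hw

/-- The projection of the bundle, as an equivariant map. -/
noncomputable def left (hw : IsLocEquiv w) : c.transGpd hw ⟶ A :=
  (⟨fst, c.proj hw, fun _ _ => rfl, fun γ z => c.proj_smul hw γ z⟩ : Hom (c.transGpd hw) A)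

/-- The map from the bundle to the target of the generalized map, as an equivariant map. -/
noncomputable def right (hw : IsLocEquiv w) : c.transGpd hw ⟶ B :=
  (⟨snd, c.moment hw, fun _ _ => rfl, fun γ z => c.moment_smul hw γ z⟩ : Hom (c.transGpd hw) B)

/-- Full faithfulness says that the group of the target acts simply transitively on fibres, with the
group element depending smoothly on the points. Local solvability is inherited from `w`. -/
theorem isLocEquiv_left (hw : IsLocEquiv w) : IsLocEquiv (Hom.toLieGpd (c.left hw)) where
  lift {T} e e' h h1 h2 := by
    have h1' : ∀ t, (h t).2 = c.proj hw (e t) := h1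
    have h2' : ∀ t, (h t).1 • (h t).2 = c.proj hw (e' t) := h2
    obtain ⟨b, hb⟩ := c.exists_smul_eq hw (h ≫ fst) e e' fun t =>
      (congrArg ((h t).1 • ·) (h1' t).symm).trans (h2' t)
    exact ⟨pair (pair (h ≫ fst) b) e, fun t => Prod.ext rfl (h1' t).symm, fun t => rfl, hb⟩
  faithful p p' h1 h2 h3 := by
    obtain ⟨⟨a, b⟩, z⟩ := p
    obtain ⟨⟨a', b'⟩, z'⟩ := p'
    obtain rfl : a = a' := congrArg Prod.fst h1
    obtain rfl : z = z' := h2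
    obtain rfl : b = b' := c.smul_right_cancel hw (a := a) (z := z) h3
    rfl
  surj y := by
    obtain ⟨L, hL⟩ := exists_localLift hw y
    refine ⟨c.ofProd hw (c.gen 1 (L.g y) (L.k y)), ((1 : A.grp), y), (L.smul_base y hL).symm,
      one_smul A.grp (show A.space from y)⟩
  sec z a ha y hy := by
    obtain ⟨g, x⟩ := a
    obtain rfl : x = c.proj hw z := ha
    obtain ⟨h₁, g₁, k₁, rfl⟩ := c.exists_gen hw z
    -- The arrow `g g₁` goes from `w k₁` to `y`. Following its local extension by `g⁻¹` gives
    -- generators of a family that starts at the given point and is carried to `U` by the constant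
    -- element `g`.
    obtain ⟨U, hU, σ, η, h3, h4, h5, h6⟩ := hw.sec k₁ ((g * g₁, base w k₁) : A.grp × A.space) rfl y
      ((mul_smul g g₁ (base w k₁)).trans hy)
    have h3' : ∀ u, (η u).2 = base w (σ u) := h3
    have h4' : ∀ u, (η u).1 • (η u).2 = u.1 := h4
    let s : A.space.restrict U ⟶ c.bundle hw := c.genHom hw (Mfd.const _ h₁)
      (grpMul (Mfd.const _ g⁻¹) (η ≫ fst)) σ
    have hs : s ⟨y, hU⟩ = c.ofProd hw (c.gen h₁ g₁ k₁) := by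
      have h6' : (η ⟨y, hU⟩).1 = g * g₁ := congrArg Prod.fst h6
      change c.ofProd hw (c.gen h₁ (g⁻¹ * (η ⟨y, hU⟩).1) (σ ⟨y, hU⟩)) = _
      rw [h6', h5, inv_mul_cancel_left]
    refine ⟨U, hU, s, pair (Mfd.const _ g) (s ≫ c.proj hw), fun u => rfl, fun u => ?_, hs,
      Prod.ext rfl (congrArg (c.proj hw) hs)⟩
    change g • ((g⁻¹ * (η u).1) • base w (σ u)) = u.1
    rw [mul_smul, smul_inv_smul, ← h3', h4']

/-- The homomorphism from the apex of a generalized map to the translation groupoid of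
the bundle. -/
noncomputable def compare (hw : IsLocEquiv w) : K ⟶ (c.transGpd hw).toLieGpd :=
  let j : K.obj ⟶ c.bundle hw := c.genHom hw (Mfd.const _ 1) (Mfd.const _ 1) (𝟙 _)
  ({ obj := j
     arr := pair (pair (label w) (label φ)) (K.src ≫ j)
     src_arr := fun _ => rfl
     tgt_arr := fun κ => by
       change grpPair (label w κ) (label φ κ) • c.ofProd hw (c.gen 1 1 (K.src κ)) =
         c.ofProd hw (c.gen 1 1 (K.tgt κ))
       rw [smul_gen, c.gen_tgt κ 1 rfl]
       change c.ofProd hw (c.gen (label φ κ * 1) (label w κ * 1) _) = _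
       rw [one_mul, one_mul, mul_one, mul_one]
     arr_unit := fun k => Prod.ext (Prod.ext (label_unit w k) (label_unit φ k))
       (congrArg j (K.src_unit k))
     arr_comp := fun κ κ' h => Prod.ext (Prod.ext (label_comp w κ κ' h) (label_comp φ κ κ' h))
       (congrArg j (K.src_comp κ κ' h)) } : LieGpd.Hom K (c.transGpd hw).toLieGpd)

/-- The point with generator `(1, 1, k)` lies over `w k` and has moment `φ k`, so the comparison
commutes strictly with both legs and the identities serve as 2-cells. -/
theorem compare_left (hw : IsLocEquiv w) : c.compare hw ≫ Hom.toLieGpd (c.left hw) = w := by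
  have h : ∀ k, (1 : A.grp) • base w k = base w k := fun k => one_smul _ _
  refine LieGpd.Hom.ext (hom_ext h) (hom_ext fun κ => ?_)
  exact (Prod.ext rfl (h _) : ((label w κ, (1 : A.grp) • base w (K.src κ)) : A.grp × A.space) =
    (label w κ, base w (K.src κ))).trans (arr_eq w κ).symm

theorem compare_right (hw : IsLocEquiv w) : c.compare hw ≫ Hom.toLieGpd (c.right hw) = φ := by
  have h : ∀ k, c.momentFun (c.ofProd hw (c.gen 1 1 k)) = base φ k := fun k =>
    (c.momentFun_gen hw _ _ _).trans (one_smul _ _)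
  refine LieGpd.Hom.ext (hom_ext h) (hom_ext fun κ => ?_)
  exact (Prod.ext rfl (h _) : ((label φ κ, c.momentFun (c.ofProd hw (c.gen 1 1 (K.src κ)))) :
    B.grp × B.space) = (label φ κ, base φ (K.src κ))).trans (arr_eq φ κ).symm

end Cocycle

/-- Every generalized map between translation groupoids is isomorphic to a span of equivariant
maps. -/
theorem exists_inclSpan_cell (S : Span lieW A.toLieGpd B.toLieGpd) :
    ∃ T : Span eqW A B, Nonempty (Cell (inclSpan T) S) := by
  obtain ⟨c⟩ := nonempty_cocycle S
  have hw : IsLocEquiv S.left := IsEssEquiv.isLocEquiv S.mem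
  refine ⟨⟨c.transGpd hw, c.left hw, c.right hw, (c.isLocEquiv_left hw).isEssEquiv⟩, ⟨Cell.mk ?_⟩⟩
  have h1 : c.compare hw ≫ Hom.toLieGpd (c.left hw) = 𝟙 _ ≫ S.left := c.compare_left hw
  have h2 : c.compare hw ≫ Hom.toLieGpd (c.right hw) = 𝟙 _ ≫ S.right := c.compare_right hw
  exact
    { apex := S.apex
      ν := c.compare hw
      ν' := 𝟙 _
      α₁ := eqToIso h1
      α₂ := eqToHom h2
      mem := h1.symm ▸ S.mem
      mem' := S.mem }

end Bundle

end TransGpd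

/-! ## The equivalence of bicategories -/

namespace Fractions

open LieGpd TransGpd

variable (𝓐 : EqTrFractions.{u}) (𝓑 : LieFractions.{u})

theorem isBiequivalence_eqTrPseudofunctor : IsBiequivalence (eqTrPseudofunctor 𝓐 𝓑) where
  essSurj := by
    rintro ⟨_, ⟨A, rfl⟩, hA⟩
    exact ⟨⟨A, hA⟩, ⟨Bicategory.Equivalence.id _⟩⟩
  localEquiv A B :=
    { faithful := ⟨fun h => inclCell_injective h⟩
      full := ⟨fun {S S'} c => inclCell_surjective S S' c⟩
      essSurj := ⟨fun S => by
        obtain ⟨T, ⟨c⟩⟩ := exists_inclSpan_cell (A := A.obj) (B := B.obj) S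
        exact ⟨T, ⟨cellIso c⟩⟩⟩ }

/-- The pseudofunctor uses one chosen pasting. Evaluation shows that any other gives the same class,
so the comparison is canonical. -/
theorem eqTrPseudofunctor_mapComp {A B D : TransGpd.{u}} (S : Span eqW A B) (T : Span eqW B D)
    (N : HComposite (Diagram.id (inclSpan S)) (Diagram.id (inclSpan T))
      (inclFiller (𝓐.fill S T)) (𝓑.fill (inclSpan S) (inclSpan T))) :
    inclComp 𝓐.toFractionBicategory 𝓑.toFractionBicategory S T = Cell.mk N.diagram :=
  Cell.ev_injective ((ev_inclComp _ _ S T).trans (ev_hcomposite_id N).symm)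

end Fractions

theorem theorem3p3 :
    Nonempty EqTrFractions.{u} ∧ Nonempty LieFractions.{u} ∧
    ∀ (𝓐 : EqTrFractions.{u}) (𝓑 : LieFractions.{u}),
      ∃ F : Pseudofunctor (OrbEqTr 𝓐) (OrbLieTr 𝓑),
        F.toPrelaxFunctorStruct = eqTrInclusion 𝓐 𝓑 ∧
        (∀ A : OrbEqTr 𝓐, HEq (F.mapId A).hom
          (Fractions.Cell.mk (Fractions.Diagram.id
            (TransGpd.inclSpan (Fractions.Span.id A.obj (𝓐.id_mem A.obj)))))) ∧
        (∀ {A B D : OrbEqTr 𝓐} (S : A ⟶ B) (T : B ⟶ D)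
          (N : Fractions.HComposite (Fractions.Diagram.id (TransGpd.inclSpan S))
            (Fractions.Diagram.id (TransGpd.inclSpan T)) (TransGpd.inclFiller (𝓐.fill S T))
            (𝓑.fill (TransGpd.inclSpan S) (TransGpd.inclSpan T))),
          HEq (F.mapComp S T).hom (Fractions.Cell.mk N.diagram)) ∧
        IsBiequivalence F :=
  ⟨TransGpd.nonempty_eqTrFractions, Fractions.nonempty_lieFractions, fun 𝓐 𝓑 =>
    -- The types of the comparison 2-cells mention the action of `F` on objects and 1-cells, known
    -- only through the first equation, hence heterogeneous equality. For the pseudofunctor supplied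
    -- here the types agree definitionally.
    ⟨Fractions.eqTrPseudofunctor 𝓐 𝓑, rfl, fun _ => HEq.rfl,
      fun S T N => heq_of_eq (Fractions.eqTrPseudofunctor_mapComp 𝓐 𝓑 S T N),
      Fractions.isBiequivalence_eqTrPseudofunctor 𝓐 𝓑⟩⟩
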